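/- **Setting.** Let $d,K,N\ge 1$. A labelled embedding $(z,y)\in\mathbb R^d\times\{\text{live},\text{spoof}\}$ has the law $D$: with probability $p_0\in(0,1)$ it is live and $z\sim\mathcal N(0,\sigma_0^2 I_d)$; with probability $1-p_0$ it is spoof and $z\sim\sum_{k=1}^K\pi_k\,\mathcal N(\mu_k,\sigma_{\mathrm{eff}}^2 I_d)$, where $\pi_k\ge 0$, $\sum_k\pi_k=1$, $\sigma_0>0$, $\sigma_{\mathrm{eff}}^2=\sigma_0^2+\varepsilon$, $\varepsilon>0$. Let $S=((z_i,y_i))_{i\le N}$ be i.i.d. from $D$, and put $\tilde y_i=-1$ for live, $\tilde y_i=+1$ for spoof. A hypothesis $h$ is a parameter with a score $f_h(z)$; it predicts spoof iff $f_h(z)>0$; $\mathcal R(h)$ is its misclassification probability under $D$ and $\hat{\mathcal R}(h)$ its fraction of errors on $S$. The likelihood is logistic, with negative logarithm $\sum_i\ln(1+e^{-\tilde y_i f_h(z_i)})$. * *Symmetric (linear) IRM:* $h=\beta\in\mathbb R^d$, $f_\beta(z)=\beta^\top z$, prior $\Pi_{\mathrm{sym}}=\mathcal N(0,\sigma_\beta^2I_d)$,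 $\sigma_\beta>0$. * *AsyIRM (radial):* $h=R\in\mathbb R$, $f_R(z)=\|z\|_2^q-R$ with $q\in\{1,2\}$ ($R$ is the radius or the squared radius), prior $\Pi_{\mathrm{asym}}=\mathcal N(\mu_R,\sigma_R^2)$, $\sigma_R>0$. In both cases $\mathcal P$ denotes either the Bayes posterior (proportional to likelihood times prior) or its Laplace approximation $\mathcal N(h_{\mathrm{MAP}},H^{-1})$, where $h_{\mathrm{MAP}}$ minimizes the negative log-posterior and $H=\sum_i c_iz_iz_i^\top+\sigma_\beta^{-2}I_d$, respectively $H=\sum_ic_i+\sigma_R^{-2}$, with $c_i=\sigma(a_i)(1-\sigma(a_i))$, $a_i=\tilde y_if_{h_{\mathrm{MAP}}}(z_i)$, $\sigma(t)=1/(1+e^{-t})$; the claims hold for each of the two choices. **Theorem.** 1. *(Symmetric IRM.)* For all $p_0,\sigma_0,\varepsilon,\sigma_\beta$ and $M>0$ there is a constant $C$ such that for all $d,K,N\ge1$, all weights $\pi_k$, all means with $\|\mu_k\|\le M\sqrt d$, and all $\delta\in(0,1)$, each of the following holds with probability at least $1-\delta$ over $S$: (a) $\mathrm{KL}(\mathcal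 P_{\mathrm{sym}}\|\Pi_{\mathrm{sym}})\le C\,(d+K)\ln(2N/\delta)$; (b) $\mathrm{KL}(\mathcal P_{\mathrm{sym}}\|\Pi_{\mathrm{sym}})<\infty$ and $\mathbb E_{h\sim\mathcal P_{\mathrm{sym}}}\mathcal R(h)\le\mathbb E_{h\sim\mathcal P_{\mathrm{sym}}}\hat{\mathcal R}(h)+\sqrt{\frac{\mathrm{KL}(\mathcal P_{\mathrm{sym}}\|\Pi_{\mathrm{sym}})+\ln(2\sqrt N/\delta)}{2N}}$; (c) $\mathcal R(h)\le\hat{\mathcal R}(h)+\sqrt{\frac{C(d+K)\ln(2N/\delta)}{N}}=\hat{\mathcal R}(h)+\tilde O\big(\sqrt{(d+K)/N}\big)$, both in expectation over $h\sim\mathcal P_{\mathrm{sym}}$ and, with $\mathcal P_{\mathrm{sym}}$-probability at least $1-\delta$, for the drawn $h$ itself. 2. *(AsyIRM.)* For every $\sigma_R>0$ there is a constant $C$, depending on nothing else, in particular not on $d$ or $K$, such that for all $d,K,N\ge1$, all $p_0,\sigma_0,\varepsilon,\pi_k,\mu_k,\mu_R$ as in the setting, both $q$, and all $\delta\in(0,1)$: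 for every sample $S$, (a) $\mathrm{KL}(\mathcal P_{\mathrm{asym}}\|\Pi_{\mathrm{asym}})\le C\big(\ln(2N)+(R_{\mathrm{MAP}}-\mu_R)^2\big)$, and each of the following holds with probability at least $1-\delta$ over $S$: (b) the inequality of 1(b) for $\mathcal P_{\mathrm{asym}},\Pi_{\mathrm{asym}}$; (c) $\mathcal R(h)\le\hat{\mathcal R}(h)+\sqrt{\frac{C\ln(2N/\delta)}{N}}=\hat{\mathcal R}(h)+\tilde O\big(\sqrt{1/N}\big)$, both in expectation over $h\sim\mathcal P_{\mathrm{asym}}$ and, with $\mathcal P_{\mathrm{asym}}$-probability at least $1-\delta$, for the drawn $h$ itself. 3. *(Strictly better scaling.)* For all $C,C',\eta>0$ there is $n_0$ such that $\sqrt{C'\ln(2N/\delta)/N}<\eta\sqrt{C(d+K)\ln(2N/\delta)/N}$ whenever $d+K\ge n_0$, $N\ge1$, $\delta\in(0,1)$. -/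

import Mathlib

open MeasureTheory ProbabilityTheory InformationTheory Filter
open scoped ENNReal RealInnerProductSpace

noncomputable section

namespace AsyIRM

/-- The embedding space `ℝ^d` with its Euclidean norm. -/
abbrev Feature (d : ℕ) : Type := EuclideanSpace ℝ (Fin d)

/-- A labelled embedding `(z, y)`; the label `false` is "live", `true` is "spoof". -/
abbrev Example (d : ℕ) : Type := Feature d × Bool

/-- The signed label: `-1` for live and `+1` for spoof. -/
def signedLabel (y : Bool) : ℝ := if y then 1 else -1

/-! ### The data distribution -/

/-- The isotropic Gaussian `N(m, v I_d)`. -/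
def isoGaussian {d : ℕ} (m : Feature d) (v : ℝ) : Measure (Feature d) :=
  multivariateGaussian m (v • (1 : Matrix (Fin d) (Fin d) ℝ))

/-- The asymmetric live/spoof distribution of a labelled embedding: with probability `p₀` the
example is live and `z ∼ N(0, σ₀² I)`; with probability `1 - p₀` it is spoof and `z` is drawn from
the Gaussian mixture `∑ₖ wₖ N(μₖ, σ_eff² I)`, where `σ_eff² = σ₀² + ε`. -/
def dataLaw {d K : ℕ} (p₀ σ₀ ε : ℝ) (w : Fin K → ℝ) (μ : Fin K → Feature d) :
    Measure (Example d) :=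
  ENNReal.ofReal p₀ • (isoGaussian (0 : Feature d) (σ₀ ^ 2)).prod (Measure.dirac false) +
    ENNReal.ofReal (1 - p₀) •
      (∑ k, ENNReal.ofReal (w k) • isoGaussian (μ k) (σ₀ ^ 2 + ε)).prod (Measure.dirac true)

/-- The law of `N` i.i.d. training examples. -/
def sampleLaw {d : ℕ} (D : Measure (Example d)) (N : ℕ) : Measure (Fin N → Example d) :=
  Measure.pi fun _ => D

/-! ### Classifiers given by a score, and their risks

A hypothesis is a parameter `θ : Θ`; `f θ z` is the score (spoof logit) of the embedding `z`. -/

/-- The hyperplane score `βᵀ z`. -/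
def linearScore {d : ℕ} (β : Feature d) (z : Feature d) : ℝ := ⟪β, z⟫

/-- The radial score `‖z‖ ^ q - R`.  For `q = 1` the parameter `R` is the decision radius itself,
for `q = 2` it is the squared radius. -/
def radialScore {d : ℕ} (q : ℕ) (R : ℝ) (z : Feature d) : ℝ := ‖z‖ ^ q - R

/-- The examples that `θ` misclassifies; `θ` predicts "spoof" exactly when the score is positive. -/
def errorSet {d : ℕ} {Θ : Type} (f : Θ → Feature d → ℝ) (θ : Θ) : Set (Example d) :=
  {x | ¬ (x.2 = true ↔ 0 < f θ x.1)}

/-- The true risk: the probability of misclassification. -/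
def risk {d : ℕ} {Θ : Type} (D : Measure (Example d)) (f : Θ → Feature d → ℝ) (θ : Θ) : ℝ :=
  D.real (errorSet f θ)

/-- The empirical risk: the fraction of misclassified training examples. -/
def empRisk {d N : ℕ} {Θ : Type} (S : Fin N → Example d) (f : Θ → Feature d → ℝ) (θ : Θ) : ℝ :=
  (1 / (N : ℝ)) * ∑ i, (errorSet f θ).indicator (fun _ => (1 : ℝ)) (S i)

/-! ### Logistic likelihood, maximum a posteriori estimates and posteriors -/

/-- The negative log-likelihood `∑ᵢ ln (1 + exp (-yᵢ f θ zᵢ))` with signed labels `yᵢ`. -/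
def logisticNLL {d N : ℕ} {Θ : Type} (f : Θ → Feature d → ℝ) (S : Fin N → Example d) (θ : Θ) : ℝ :=
  ∑ i, Real.log (1 + Real.exp (-(signedLabel (S i).2 * f θ (S i).1)))

/-- The curvature `c = σ(a) (1 - σ(a))` of the logistic loss at `a = y f θ z`. -/
def logisticCurv {d : ℕ} {Θ : Type} (f : Θ → Feature d → ℝ) (θ : Θ) (x : Example d) : ℝ :=
  Real.sigmoid (signedLabel x.2 * f θ x.1) * (1 - Real.sigmoid (signedLabel x.2 * f θ x.1))

/-- The exact Bayes posterior: proportional to likelihood times prior. -/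
def bayesPosterior {d N : ℕ} {Θ : Type} [MeasurableSpace Θ] (prior : Measure Θ)
    (f : Θ → Feature d → ℝ) (S : Fin N → Example d) : Measure Θ :=
  prior.tilted fun θ => -logisticNLL f S θ

/-- A global minimizer of `L` (if there is one). -/
def minimizer {Θ : Type} [Nonempty Θ] (L : Θ → ℝ) : Θ :=
  Classical.epsilon fun θ => ∀ θ', L θ ≤ L θ'

/-- The Gaussian prior `N(0, σβ² I_d)` on hyperplanes. -/
def symPrior (d : ℕ) (σβ : ℝ) : Measure (Feature d) := isoGaussian 0 (σβ ^ 2)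

/-- The negative log-posterior of `β`, up to an additive constant. -/
def symObjective {d N : ℕ} (σβ : ℝ) (S : Fin N → Example d) (β : Feature d) : ℝ :=
  logisticNLL linearScore S β + ‖β‖ ^ 2 / (2 * σβ ^ 2)

/-- The MAP estimate `β_MAP`. -/
def symMAP {d N : ℕ} (σβ : ℝ) (S : Fin N → Example d) : Feature d :=
  minimizer (symObjective σβ S)

/-- The Hessian `∑ᵢ cᵢ zᵢ zᵢᵀ + σβ⁻² I` of the negative log-posterior at `β_MAP`. -/
def symHessian {d N : ℕ} (σβ : ℝ) (S : Fin N → Example d) : Matrix (Fin d) (Fin d) ℝ :=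
  (∑ i, logisticCurv linearScore (symMAP σβ S) (S i) •
      Matrix.vecMulVec (fun j => (S i).1 j) (fun j => (S i).1 j)) +
    (1 / σβ ^ 2) • (1 : Matrix (Fin d) (Fin d) ℝ)

/-- The Laplace approximation `N(β_MAP, H⁻¹)` of the posterior. -/
def symLaplace {d N : ℕ} (σβ : ℝ) (S : Fin N → Example d) : Measure (Feature d) :=
  multivariateGaussian (symMAP σβ S) (symHessian σβ S)⁻¹

/-- The Gaussian prior `N(μR, σR²)` on the radial parameter. -/
def asymPrior (μR σR : ℝ) : Measure ℝ := gaussianReal μR (σR ^ 2).toNNReal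

/-- The negative log-posterior of the radial parameter, up to an additive constant. -/
def asymObjective {d N : ℕ} (q : ℕ) (μR σR : ℝ) (S : Fin N → Example d) (R : ℝ) : ℝ :=
  logisticNLL (radialScore q) S R + (R - μR) ^ 2 / (2 * σR ^ 2)

/-- The MAP estimate `R_MAP`. -/
def asymMAP {d N : ℕ} (q : ℕ) (μR σR : ℝ) (S : Fin N → Example d) : ℝ :=
  minimizer (asymObjective q μR σR S)

/-- The second derivative `∑ᵢ cᵢ + σR⁻²` of the negative log-posterior at `R_MAP`. -/
def asymHessian {d N : ℕ} (q : ℕ) (μR σR : ℝ) (S : Fin N → Example d) : ℝ :=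
  (∑ i, logisticCurv (radialScore q) (asymMAP q μR σR S) (S i)) + 1 / σR ^ 2

/-- The Laplace approximation `N(R_MAP, H⁻¹)` of the posterior. -/
def asymLaplace {d N : ℕ} (q : ℕ) (μR σR : ℝ) (S : Fin N → Example d) : Measure ℝ :=
  gaussianReal (asymMAP q μR σR S) (asymHessian q μR σR S)⁻¹.toNNReal

/-! ### Events of the training sample -/

/-- The PAC-Bayes inequality for the posterior `post` and the prior `prior`: the KL divergence is
finite and the expected true risk of a hypothesis drawn from the posterior is at most its expected
empirical risk plus `√((KL(post ‖ prior) + ln(2√N/δ)) / (2N))`. -/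
def PACBayesBound {d N : ℕ} {Θ : Type} [MeasurableSpace Θ] (D : Measure (Example d))
    (S : Fin N → Example d) (f : Θ → Feature d → ℝ) (post prior : Measure Θ) (δ : ℝ) : Prop :=
  klDiv post prior ≠ ⊤ ∧
    ∫ θ, risk D f θ ∂post ≤ ∫ θ, empRisk S f θ ∂post +
      Real.sqrt (((klDiv post prior).toReal + Real.log (2 * Real.sqrt N / δ)) / (2 * N))

/-- True risk at most empirical risk plus `rate`, for a hypothesis drawn from the posterior: on
average over the draw, and also for the single drawn hypothesis with probability `≥ 1 - δ`. -/
def RiskBound {d N : ℕ} {Θ : Type} [MeasurableSpace Θ] (D : Measure (Example d))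
    (S : Fin N → Example d) (f : Θ → Feature d → ℝ) (post : Measure Θ) (δ rate : ℝ) : Prop :=
  ∫ θ, risk D f θ ∂post ≤ ∫ θ, empRisk S f θ ∂post + rate ∧
    post {θ | ¬ risk D f θ ≤ empRisk S f θ + rate} ≤ ENNReal.ofReal δ

/-- The event `A` has probability at least `1 - δ`: its complement has (outer) measure `≤ δ`. -/
def HighProb {Ω : Type} [MeasurableSpace Ω] (P : Measure Ω) (δ : ℝ) (A : Ω → Prop) : Prop :=
  P {S | ¬ A S} ≤ ENNReal.ofReal δ

/-- `√(C (d + K) ln(2N/δ) / N)`, an explicit form of `Õ(√((d+K)/N))`. -/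
def symRate (C : ℝ) (d K N : ℕ) (δ : ℝ) : ℝ :=
  Real.sqrt (C * ((d : ℝ) + K) * Real.log (2 * N / δ) / N)

/-- `√(C ln(2N/δ) / N)`, an explicit form of `Õ(√(1/N))`. -/
def asymRate (C : ℝ) (N : ℕ) (δ : ℝ) : ℝ :=
  Real.sqrt (C * Real.log (2 * N / δ) / N)

/-! ### The MAP estimates exist -/

theorem logisticNLL_nonneg {d N : ℕ} {Θ : Type} (f : Θ → Feature d → ℝ) (S : Fin N → Example d)
    (θ : Θ) : 0 ≤ logisticNLL f S θ := by
  refine Finset.sum_nonneg fun i _ => Real.log_nonneg ?_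
  have := Real.exp_pos (-(signedLabel (S i).2 * f θ (S i).1))
  linarith

theorem symMAP_le {d N : ℕ} {σβ : ℝ} (hσ : 0 < σβ) (S : Fin N → Example d) (β : Feature d) :
    symObjective σβ S (symMAP σβ S) ≤ symObjective σβ S β := by
  refine Classical.epsilon_spec (p := fun θ => ∀ θ', symObjective σβ S θ ≤ symObjective σβ S θ')
    ?_ β
  refine Continuous.exists_forall_le ?_ ?_
  · unfold symObjective logisticNLL linearScore
    refine Continuous.add (continuous_finsetSum _ fun i _ => Continuous.log (by fun_prop)
      fun x => ?_) (by fun_prop)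
    have := Real.exp_pos (-(signedLabel (S i).2 * ⟪x, (S i).1⟫))
    positivity
  · refine tendsto_atTop_mono (f := fun β : Feature d => ‖β‖ ^ 2 / (2 * σβ ^ 2))
      (fun β => by have := logisticNLL_nonneg linearScore S β; unfold symObjective; linarith) ?_
    exact ((tendsto_pow_atTop two_ne_zero).comp (tendsto_norm_cocompact_atTop)).atTop_div_const
      (by positivity)

theorem asymMAP_le {d N : ℕ} (q : ℕ) (μR : ℝ) {σR : ℝ} (hσ : 0 < σR) (S : Fin N → Example d)
    (R : ℝ) : asymObjective q μR σR S (asymMAP q μR σR S) ≤ asymObjective q μR σR S R := by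
  refine Classical.epsilon_spec
    (p := fun θ => ∀ θ', asymObjective q μR σR S θ ≤ asymObjective q μR σR S θ') ?_ R
  refine Continuous.exists_forall_le ?_ ?_
  · unfold asymObjective logisticNLL radialScore
    refine Continuous.add (continuous_finsetSum _ fun i _ => Continuous.log (by fun_prop)
      fun x => ?_) (by fun_prop)
    have := Real.exp_pos (-(signedLabel (S i).2 * (‖(S i).1‖ ^ q - x)))
    positivity
  · refine tendsto_atTop_mono (f := fun R : ℝ => ‖R - μR‖ ^ 2 / (2 * σR ^ 2))
      (fun R => by
        have := logisticNLL_nonneg (radialScore q) S R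
        simp only [asymObjective, Real.norm_eq_abs, sq_abs]; linarith) ?_
    refine ((tendsto_pow_atTop two_ne_zero).comp
      (tendsto_norm_cocompact_atTop.comp ?_)).atTop_div_const (by positivity)
    exact (Homeomorph.subRight μR).isClosedEmbedding.tendsto_cocompact

end AsyIRM

end

open AsyIRM

/-!
Around the MAP estimate `m` the Bayes posterior and its Laplace approximation are both Gibbs
measures `exp (-‖x - m‖² / (2σ²) - G (x - m)) dx` with a convex excess loss `G ≥ 0` of curvature at
most `1/4` along each feature. A Gaussian test point at the scale balancing the two terms bounds the
normalizing constant from below, and with it both `KL(post ‖ prior)` and the exponential moments of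
the posterior relative to those of the prior, by `‖m - μ‖² / σ²` plus a dimension-many logarithm.

For the PAC-Bayes inequality, the number of errors of a fixed hypothesis is binomial, and mixing
over its parameter with the Krichevsky–Trofimov prior bounds the moment `𝔼 exp (2N (R - R̂)²)` by
`2√N`. Hence the average of `exp (2N (R - R̂)²)` over the prior is controlled with high probability,
and the exponential moments of the posterior transfer this to a single drawn hyperplane.

What remains for hyperplanes is the size of `β_MAP`. Every direction puts a positive fraction of the
live examples on its wrong side with a margin, so by a union bound over a net the objective grows
linearly in `‖β‖` as soon as `N` exceeds a multiple of `d ln (1/δ)`, while its value at `0` is at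
most `N ln 2`; for smaller `N` the bound at `0` already suffices.

For the radial classifiers `R_MAP` may be arbitrarily far from `μ_R`, so the posterior is not used
at all: the errors of `R` are the union of two monotone families of sets, which converge uniformly
by bracketing, whatever the dimension.
-/

namespace AsyIRM

/-! ### Likelihoods of binary strings -/

theorem bernoulli_mgf_le {p : ℝ} (h0 : 0 ≤ p) (h1 : p ≤ 1) (y : ℝ) :
    1 - p + p * Real.exp y ≤ Real.exp (p * y + y ^ 2 / 8) := by
  let P : Measure ℝ := bernoulliMeasure 1 0 ⟨p, h0, h1⟩
  have hexpect (g : ℝ → ℝ) : ∫ x, g x ∂P = p * g 1 + (1 - p) * g 0 :=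
    integral_bernoulliMeasure (1 : ℝ) 0 ⟨p, h0, h1⟩ g
  have hIcc : ∀ᵐ x ∂P, id x ∈ Set.Icc (0 : ℝ) 1 := by
    rw [ae_iff]
    exact bernoulliMeasure_apply_of_notMem_of_notMem _ measurableSet_Icc.compl (by simp) (by simp)
  have hoeffding := (hasSubgaussianMGF_of_mem_Icc aemeasurable_id hIcc).mgf_le y
  rw [mgf, hexpect, hexpect] at hoeffding
  simp only [id_eq, mul_one, mul_zero, add_zero, sub_zero, nnnorm_one] at hoeffding
  calc 1 - p + p * Real.exp y
      = Real.exp (p * y) * (p * Real.exp (y * (1 - p)) + (1 - p) * Real.exp (y * (0 - p))) := by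
        rw [mul_add, mul_left_comm, mul_left_comm _ (1 - p), ← Real.exp_add, ← Real.exp_add]
        ring_nf
        simp only [Real.exp_zero, mul_one]
        ring
    _ ≤ Real.exp (p * y) * Real.exp (y ^ 2 / 8) := by
        refine mul_le_mul_of_nonneg_left ?_ (Real.exp_pos _).le
        refine hoeffding.trans_eq ?_
        congr 1
        push_cast
        ring
    _ = _ := (Real.exp_add _ _).symm

theorem exp_mul_le_bernoulli_mgf {p : ℝ} (h0 : 0 ≤ p) (h1 : p ≤ 1) (y : ℝ) :
    Real.exp (p * y) ≤ 1 - p + p * Real.exp y := by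
  have := convexOn_exp.2 (Set.mem_univ y) (Set.mem_univ 0) h0 (sub_nonneg.2 h1) (by ring)
  simp only [smul_eq_mul, mul_zero, add_zero, Real.exp_zero, mul_one] at this
  linarith

theorem pow_le_div_pow_mul_exp {x y : ℝ} (hx : 0 ≤ x) (hy : 0 < y) (k : ℕ) :
    x ^ k ≤ (k / y) ^ k * Real.exp (y * x - k) := by
  rcases k.eq_zero_or_pos with rfl | hk
  · simpa using mul_nonneg hy.le hx
  have hle : x ≤ k / y * Real.exp (y * x / k - 1) := by
    calc x = k / y * (y * x / k - 1 + 1) := by field_simp; ring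
      _ ≤ _ := by gcongr; exact Real.add_one_le_exp _
  calc x ^ k ≤ (k / y * Real.exp (y * x / k - 1)) ^ k := by gcongr
    _ = _ := by
      rw [mul_pow, ← Real.exp_nat_mul]
      congr 2
      field_simp

theorem bernoulli_likelihood_le_max {p : ℝ} (h0 : 0 ≤ p) (h1 : p ≤ 1) {a b : ℕ}
    (hab : 0 < a + b) :
    p ^ a * (1 - p) ^ b ≤ ((a : ℝ) / (a + b)) ^ a * ((b : ℝ) / (a + b)) ^ b := by
  have hab' : (0 : ℝ) < a + b := by exact_mod_cast hab
  have hq : 0 ≤ 1 - p := sub_nonneg.2 h1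
  calc p ^ a * (1 - p) ^ b
      ≤ ((a / (a + b)) ^ a * Real.exp ((a + b) * p - a)) *
        ((b / (a + b)) ^ b * Real.exp ((a + b) * (1 - p) - b)) := by
        gcongr
        · exact pow_le_div_pow_mul_exp h0 hab' a
        · exact pow_le_div_pow_mul_exp hq hab' b
    _ = ((a : ℝ) / (a + b)) ^ a * ((b : ℝ) / (a + b)) ^ b *
        Real.exp ((a + b) * p - a + ((a + b) * (1 - p) - b)) := by rw [Real.exp_add]; ring
    _ = _ := by ring_nf; simp

/-- Exponential tilting by `l = 4 (a / (a + b) - p)`, followed by Hoeffding's lemma, turns the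
likelihood under `p` into the likelihood under the tilted parameter. -/
theorem bernoulli_likelihood_mul_exp_le {p : ℝ} (h0 : 0 ≤ p) (h1 : p ≤ 1) {a b : ℕ}
    (hab : 0 < a + b) :
    p ^ a * (1 - p) ^ b * Real.exp (2 * (a + b) * (p - a / (a + b)) ^ 2) ≤
      ((a : ℝ) / (a + b)) ^ a * ((b : ℝ) / (a + b)) ^ b := by
  have hab' : (0 : ℝ) < a + b := by exact_mod_cast hab
  set l : ℝ := 4 * (a / (a + b) - p) with hl
  have hal : (a + b) * (p * l + l ^ 2 / 8) + 2 * (a + b) * (p - a / (a + b)) ^ 2 = a * l := by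
    rw [hl]; field_simp; ring
  set z : ℝ := 1 - p + p * Real.exp l with hz
  have hzpos : 0 < z := (Real.exp_pos _).trans_le (exp_mul_le_bernoulli_mgf h0 h1 l)
  have htilt : 1 - p * Real.exp l / z = (1 - p) / z := by field_simp; rw [hz]; ring
  have hzpow : z ^ (a + b) ≤ Real.exp ((a + b) * (p * l + l ^ 2 / 8)) := by
    calc z ^ (a + b) ≤ Real.exp (p * l + l ^ 2 / 8) ^ (a + b) := by
          gcongr; exact bernoulli_mgf_le h0 h1 l
      _ = _ := by rw [← Real.exp_nat_mul]; push_cast; rfl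
  calc p ^ a * (1 - p) ^ b * Real.exp (2 * (a + b) * (p - a / (a + b)) ^ 2)
      ≤ (p * Real.exp l / z) ^ a * (1 - p * Real.exp l / z) ^ b := by
        rw [htilt, div_pow, div_pow, mul_pow, div_mul_div_comm, ← pow_add,
          le_div_iff₀ (by positivity)]
        calc p ^ a * (1 - p) ^ b * Real.exp (2 * (a + b) * (p - a / (a + b)) ^ 2) * z ^ (a + b)
            ≤ p ^ a * (1 - p) ^ b * Real.exp (2 * (a + b) * (p - a / (a + b)) ^ 2) *
              Real.exp ((a + b) * (p * l + l ^ 2 / 8)) := by gcongr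
          _ = p ^ a * (1 - p) ^ b * Real.exp (a * l) := by
            rw [mul_assoc, ← Real.exp_add, add_comm, hal]
          _ = _ := by rw [Real.exp_nat_mul]; ring
    _ ≤ _ := bernoulli_likelihood_le_max (by positivity)
        ((div_le_one hzpos).2 (by linarith)) hab

/-- The Krichevsky–Trofimov probability of a binary string with `a` ones and `b` zeros: the mixture
of the likelihoods `p ^ a * (1 - p) ^ b` over the arcsine law of `p`, in closed form. -/
noncomputable def ktProb (a b : ℕ) : ℝ :=
  (∏ i ∈ Finset.range a, ((i : ℝ) + 1 / 2)) * (∏ i ∈ Finset.range b, ((i : ℝ) + 1 / 2)) /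
    (a + b).factorial

theorem ktProb_pos (a b : ℕ) : 0 < ktProb a b := by
  have hprod (n : ℕ) : 0 < ∏ i ∈ Finset.range n, ((i : ℝ) + 1 / 2) :=
    Finset.prod_pos fun i _ => by positivity
  exact div_pos (mul_pos (hprod a) (hprod b)) (by positivity)

theorem ktProb_comm (a b : ℕ) : ktProb a b = ktProb b a := by
  rw [ktProb, ktProb, mul_comm, add_comm]

theorem ktProb_succ_left (a b : ℕ) :
    ktProb (a + 1) b = ktProb a b * (a + 1 / 2) / (a + b + 1) := by
  rw [ktProb, ktProb, Finset.prod_range_succ, show a + 1 + b = a + b + 1 by ring,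
    Nat.factorial_succ]
  generalize ∏ i ∈ Finset.range a, ((i : ℝ) + 1 / 2) = u
  generalize ∏ i ∈ Finset.range b, ((i : ℝ) + 1 / 2) = v
  push_cast
  field_simp

theorem ktProb_succ_left_add_succ_right (a b : ℕ) :
    ktProb (a + 1) b + ktProb a (b + 1) = ktProb a b := by
  rw [ktProb_comm a (b + 1), ktProb_succ_left, ktProb_succ_left, ktProb_comm b a,
    add_comm (b : ℝ) a]
  field_simp
  ring

/-- The number of ones in a binary string. -/
def ones {N : ℕ} (s : Fin N → Bool) : ℕ := ∑ i, (s i).toNat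

/-- The number of zeros in a binary string. -/
def zeros {N : ℕ} (s : Fin N → Bool) : ℕ := ∑ i, (!s i).toNat

theorem ones_add_zeros {N : ℕ} (s : Fin N → Bool) : ones s + zeros s = N := by
  have hbit (y : Bool) : y.toNat + (!y).toNat = 1 := by cases y <;> rfl
  simp [ones, zeros, ← Finset.sum_add_distrib, hbit]

theorem sum_ktProb_add_ones_add_zeros (N a b : ℕ) :
    ∑ s : Fin N → Bool, ktProb (a + ones s) (b + zeros s) = ktProb a b := by
  induction N generalizing a b with
  | zero => simp [ones, zeros]
  | succ N ih =>
    rw [← (Fin.consEquiv fun _ : Fin (N + 1) => Bool).sum_comp, Fintype.sum_prod_type,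
      Fintype.sum_bool, ← ktProb_succ_left_add_succ_right, ← ih (a + 1) b, ← ih a (b + 1)]
    simp [ones, zeros, Fin.sum_univ_succ, add_assoc]

/-- The integral of `log` over `[x, x + 1]` is at most its value at the midpoint. -/
theorem add_one_mul_log_sub_mul_log_le {x : ℝ} (hx : 0 ≤ x) :
    (x + 1) * Real.log (x + 1) - x * Real.log x ≤ 1 + Real.log (x + 1 / 2) := by
  have hlog : ∫ y in x..x + 1, Real.log y ≤
      ∫ y in x..x + 1, (Real.log (x + 1 / 2) - 1 + (x + 1 / 2)⁻¹ * y) := by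
    refine intervalIntegral.integral_mono_on_of_le_Ioo (by linarith)
      intervalIntegral.intervalIntegrable_log'
      (Continuous.intervalIntegrable (by fun_prop) _ _) fun y hy => ?_
    have hy0 : 0 < y := hx.trans_lt hy.1
    have htangent := Real.log_le_sub_one_of_pos (show 0 < y / (x + 1 / 2) by positivity)
    rw [Real.log_div hy0.ne' (by positivity), div_eq_inv_mul y] at htangent
    linarith
  rw [integral_log, intervalIntegral.integral_add (by simp)
    (Continuous.intervalIntegrable (by fun_prop) _ _), intervalIntegral.integral_const_mul,
    integral_id, intervalIntegral.integral_const, smul_eq_mul] at hlog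
  have hmid : (x + 1 / 2)⁻¹ * (((x + 1) ^ 2 - x ^ 2) / 2) = 1 := by field_simp; ring
  linarith

theorem succ_pow_succ_le (a : ℕ) :
    ((a : ℝ) + 1) ^ (a + 1) ≤ Real.exp 1 * ((a + 1 / 2) * (a : ℝ) ^ a) := by
  have hlog := add_one_mul_log_sub_mul_log_le a.cast_nonneg
  have ha : (0 : ℝ) < (a : ℝ) ^ a := by exact_mod_cast Nat.pow_self_pos
  rw [← Real.log_le_log_iff (by positivity) (by positivity),
    Real.log_mul (by positivity) (by positivity), Real.log_mul (by positivity) ha.ne',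
    Real.log_exp, Real.log_pow, Real.log_pow]
  push_cast
  linarith

theorem exp_one_mul_sqrt_mul_pow_le {N : ℕ} (hN : 0 < N) :
    Real.exp 1 * (Real.sqrt N * (N : ℝ) ^ N) ≤ Real.sqrt (N + 1) * ((N : ℝ) + 1) ^ N := by
  have hlog : (1 : ℝ) ≤ (N + 1 / 2) * Real.log (1 + 1 / N) := by
    calc (1 : ℝ) = (N + 1 / 2) * (2 * (1 / (N : ℝ)) / (1 / N + 2)) := by field_simp; ring
      _ ≤ _ := by gcongr; exact Real.le_log_one_add_of_nonneg (by positivity)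
  rw [show (1 : ℝ) + 1 / N = (N + 1) / N by field_simp,
    Real.log_div (by positivity) (by positivity)] at hlog
  rw [← Real.log_le_log_iff (by positivity) (by positivity),
    Real.log_mul (by positivity) (by positivity), Real.log_mul (by positivity) (by positivity),
    Real.log_mul (by positivity) (by positivity), Real.log_exp, Real.log_sqrt (by positivity),
    Real.log_sqrt (by positivity), Real.log_pow, Real.log_pow]
  linarith

theorem self_pow_mul_self_pow_le_ktProb_succ_left {a b : ℕ} (hab : 0 < a + b)
    (h : (a : ℝ) ^ a * (b : ℝ) ^ b ≤
      2 * (Real.sqrt (a + b) * ((a : ℝ) + b) ^ (a + b)) * ktProb a b) :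
    ((a + 1 : ℕ) : ℝ) ^ (a + 1) * (b : ℝ) ^ b ≤
      2 * (Real.sqrt ((a + 1 : ℕ) + b) * (((a + 1 : ℕ) : ℝ) + b) ^ (a + 1 + b)) *
        ktProb (a + 1) b := by
  have hsqrt := exp_one_mul_sqrt_mul_pow_le hab
  have hkt := ktProb_pos a b
  push_cast at hsqrt ⊢
  calc ((a : ℝ) + 1) ^ (a + 1) * (b : ℝ) ^ b
      ≤ Real.exp 1 * ((a + 1 / 2) * (a : ℝ) ^ a) * (b : ℝ) ^ b := by
        gcongr; exact succ_pow_succ_le a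
    _ = Real.exp 1 * (a + 1 / 2) * ((a : ℝ) ^ a * (b : ℝ) ^ b) := by ring
    _ ≤ Real.exp 1 * (a + 1 / 2) *
        (2 * (Real.sqrt (a + b) * ((a : ℝ) + b) ^ (a + b)) * ktProb a b) := by gcongr
    _ = 2 * (a + 1 / 2) * ktProb a b *
        (Real.exp 1 * (Real.sqrt (a + b) * ((a : ℝ) + b) ^ (a + b))) := by ring
    _ ≤ 2 * (a + 1 / 2) * ktProb a b *
        (Real.sqrt (a + b + 1) * ((a : ℝ) + b + 1) ^ (a + b)) := by gcongr
    _ = _ := by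
      rw [ktProb_succ_left, add_right_comm a 1 b, add_right_comm (a : ℝ) 1 b, pow_succ]
      field_simp

theorem self_pow_mul_self_pow_le_ktProb {a b : ℕ} (hab : 0 < a + b) :
    (a : ℝ) ^ a * (b : ℝ) ^ b ≤
      2 * (Real.sqrt (a + b) * ((a : ℝ) + b) ^ (a + b)) * ktProb a b := by
  induction a with
  | succ a ih =>
    rcases Nat.eq_zero_or_pos (a + b) with h | h
    · obtain ⟨rfl, rfl⟩ : a = 0 ∧ b = 0 := by omega
      norm_num [ktProb]
    · exact self_pow_mul_self_pow_le_ktProb_succ_left h (ih h)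
  | zero =>
    obtain ⟨b, rfl⟩ : ∃ c, b = c + 1 := ⟨b - 1, by omega⟩
    clear hab
    rw [ktProb_comm, mul_comm, zero_add (b + 1), ← add_zero (b + 1), add_comm ((0 : ℕ) : ℝ)]
    induction b with
    | zero => norm_num [ktProb]
    | succ b ih => exact self_pow_mul_self_pow_le_ktProb_succ_left (by omega) ih

theorem max_likelihood_le_ktProb {a b : ℕ} (hab : 0 < a + b) :
    ((a : ℝ) / (a + b)) ^ a * ((b : ℝ) / (a + b)) ^ b ≤
      2 * Real.sqrt (a + b) * ktProb a b := by
  have hab' : (0 : ℝ) < a + b := by exact_mod_cast hab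
  rw [div_pow, div_pow, div_mul_div_comm, ← pow_add, div_le_iff₀ (by positivity)]
  exact (self_pow_mul_self_pow_le_ktProb hab).trans_eq (by ring)

/-- Pinsker bounds each summand by a maximal likelihood, hence by a Krichevsky–Trofimov
probability, and these sum to one. -/
theorem sum_likelihood_mul_exp_le {p : ℝ} (h0 : 0 ≤ p) (h1 : p ≤ 1) {N : ℕ} (hN : 0 < N) :
    ∑ s : Fin N → Bool, p ^ ones s * (1 - p) ^ zeros s *
      Real.exp (2 * N * (p - ones s / N) ^ 2) ≤ 2 * Real.sqrt N := by
  have hterm (s : Fin N → Bool) : p ^ ones s * (1 - p) ^ zeros s *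
      Real.exp (2 * N * (p - ones s / N) ^ 2) ≤ 2 * Real.sqrt N * ktProb (ones s) (zeros s) := by
    have hs : 0 < ones s + zeros s := by rwa [ones_add_zeros]
    have hcast : (N : ℝ) = ones s + zeros s := by exact_mod_cast (ones_add_zeros s).symm
    rw [hcast]
    exact (bernoulli_likelihood_mul_exp_le h0 h1 hs).trans (max_likelihood_le_ktProb hs)
  calc _ ≤ ∑ s : Fin N → Bool, 2 * Real.sqrt N * ktProb (ones s) (zeros s) :=
        Finset.sum_le_sum fun s _ => hterm s
    _ = 2 * Real.sqrt N * ∑ s : Fin N → Bool, ktProb (0 + ones s) (0 + zeros s) := by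
        simp only [Finset.mul_sum, zero_add]
    _ = 2 * Real.sqrt N := by rw [sum_ktProb_add_ones_add_zeros]; simp [ktProb]

/-! ### Empirical frequencies -/

section EmpFreq

variable {X : Type*} {N : ℕ}

/-- The fraction of the sample `S` lying in `A`. -/
noncomputable def empFreq (A : Set X) (S : Fin N → X) : ℝ :=
  (1 / (N : ℝ)) * ∑ i, A.indicator (fun _ => (1 : ℝ)) (S i)

theorem empFreq_nonneg (A : Set X) (S : Fin N → X) : 0 ≤ empFreq A S :=
  mul_nonneg (by positivity) (Finset.sum_nonneg fun _ _ => Set.indicator_nonneg (by simp) _)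

theorem empFreq_le_one (A : Set X) (S : Fin N → X) : empFreq A S ≤ 1 := by
  have hsum : ∑ i, A.indicator (fun _ => (1 : ℝ)) (S i) ≤ N := by
    calc ∑ i, A.indicator (fun _ => (1 : ℝ)) (S i) ≤ ∑ _ : Fin N, (1 : ℝ) :=
          Finset.sum_le_sum fun i _ => Set.indicator_le_self' (fun _ _ => zero_le_one) _
      _ = N := by simp
  rw [empFreq, one_div_mul_eq_div]
  exact div_le_one_of_le₀ hsum N.cast_nonneg

theorem empFreq_mono {A B : Set X} (h : A ⊆ B) (S : Fin N → X) : empFreq A S ≤ empFreq B S := by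
  unfold empFreq
  gcongr with i

theorem empFreq_union {A B : Set X} (h : Disjoint A B) (S : Fin N → X) :
    empFreq (A ∪ B) S = empFreq A S + empFreq B S := by
  simp only [empFreq, ← mul_add, ← Finset.sum_add_distrib, Set.indicator_union_of_disjoint h]

theorem measurable_empFreq [MeasurableSpace X] {A : Set X} (hA : MeasurableSet A) :
    Measurable (empFreq A : (Fin N → X) → ℝ) :=
  (Finset.measurable_sum _ fun i _ =>
    (measurable_const.indicator hA).comp (measurable_pi_apply i)).const_mul _

open Classical in
/-- The binary string recording which sample points lie in `A`. -/
noncomputable def memberString (A : Set X) (S : Fin N → X) : Fin N → Bool :=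
  fun i => decide (S i ∈ A)

theorem empFreq_eq_ones_div (A : Set X) (S : Fin N → X) :
    empFreq A S = ones (memberString A S) / N := by
  have hbit (i : Fin N) :
      A.indicator (fun _ => (1 : ℝ)) (S i) = ((memberString A S i).toNat : ℝ) := by
    by_cases h : S i ∈ A <;> simp [memberString, h]
  simp only [empFreq, ones, hbit, Nat.cast_sum, one_div_mul_eq_div]

theorem preimage_memberString_singleton (A : Set X) (s : Fin N → Bool) :
    memberString A ⁻¹' {s} = Set.univ.pi fun i => if s i then A else Aᶜ := by
  ext S
  simp only [Set.mem_preimage, Set.mem_singleton_iff, funext_iff, Set.mem_univ_pi, memberString]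
  refine forall_congr' fun i => ?_
  cases s i <;> simp

variable [MeasurableSpace X] (D : Measure X) [IsProbabilityMeasure D] {A : Set X}

theorem measurable_memberString (hA : MeasurableSet A) :
    Measurable (memberString A : (Fin N → X) → Fin N → Bool) :=
  measurable_to_countable' fun s => by
    rw [preimage_memberString_singleton]
    exact .univ_pi fun i => by split_ifs; exacts [hA, hA.compl]

theorem map_memberString_singleton (hA : MeasurableSet A) (s : Fin N → Bool) :
    (Measure.pi fun _ : Fin N => D).map (memberString A) {s} =
      ENNReal.ofReal (D.real A ^ ones s * (1 - D.real A) ^ zeros s) := by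
  rw [Measure.map_apply (measurable_memberString hA) (measurableSet_singleton s),
    preimage_memberString_singleton, Measure.pi_pi, ← probReal_compl_eq_one_sub hA, ones, zeros,
    ← Finset.prod_pow_eq_pow_sum, ← Finset.prod_pow_eq_pow_sum, ← Finset.prod_mul_distrib,
    ENNReal.ofReal_prod_of_nonneg fun i _ => by positivity]
  refine Finset.prod_congr rfl fun i _ => ?_
  cases s i <;> simp

theorem lintegral_pi_exp_empFreq_le (hA : MeasurableSet A) (hN : 0 < N) :
    ∫⁻ S : Fin N → X, ENNReal.ofReal (Real.exp (2 * N * (D.real A - empFreq A S) ^ 2))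
      ∂(Measure.pi fun _ => D) ≤ ENNReal.ofReal (2 * Real.sqrt N) := by
  let p := D.real A
  have hp : 0 ≤ 1 - p := sub_nonneg.2 measureReal_le_one
  let g (s : Fin N → Bool) : ℝ := Real.exp (2 * N * (p - ones s / N) ^ 2)
  calc ∫⁻ S : Fin N → X, ENNReal.ofReal (Real.exp (2 * N * (p - empFreq A S) ^ 2))
        ∂(Measure.pi fun _ => D)
      = ∫⁻ s, ENNReal.ofReal (g s) ∂(Measure.pi fun _ : Fin N => D).map (memberString A) := by
        rw [lintegral_map (measurable_of_finite _) (measurable_memberString hA)]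
        simp only [g, empFreq_eq_ones_div]
    _ = ∑ s, ENNReal.ofReal (p ^ ones s * (1 - p) ^ zeros s * g s) := by
        rw [lintegral_fintype]
        refine Finset.sum_congr rfl fun s _ => ?_
        rw [map_memberString_singleton D hA, ← ENNReal.ofReal_mul (Real.exp_pos _).le, mul_comm]
    _ = ENNReal.ofReal (∑ s, p ^ ones s * (1 - p) ^ zeros s * g s) := by
        rw [ENNReal.ofReal_sum_of_nonneg fun s _ => by positivity]
    _ ≤ ENNReal.ofReal (2 * Real.sqrt N) :=
        ENNReal.ofReal_le_ofReal
          (sum_likelihood_mul_exp_le measureReal_nonneg measureReal_le_one hN)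

theorem measure_empFreq_deviation_le (hA : MeasurableSet A) (hN : 0 < N) {t : ℝ} (ht : 0 ≤ t) :
    (Measure.pi fun _ : Fin N => D) {S | empFreq A S + t < D.real A} ≤
      ENNReal.ofReal (2 * Real.sqrt N * Real.exp (-(2 * N * t ^ 2))) := by
  let F (S : Fin N → X) : ℝ := Real.exp (2 * N * (D.real A - empFreq A S) ^ 2)
  have hF : Measurable F := by
    have := measurable_empFreq (N := N) hA
    fun_prop
  have hsub : {S : Fin N → X | empFreq A S + t < D.real A} ⊆
      {S | ENNReal.ofReal (Real.exp (2 * N * t ^ 2)) ≤ ENNReal.ofReal (F S)} := by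
    intro S (hS : empFreq A S + t < D.real A)
    refine ENNReal.ofReal_le_ofReal (Real.exp_le_exp.2 ?_)
    have : t ≤ D.real A - empFreq A S := by linarith
    gcongr
  calc _ ≤ _ := measure_mono hsub
    _ ≤ (∫⁻ S, ENNReal.ofReal (F S) ∂(Measure.pi fun _ => D)) /
          ENNReal.ofReal (Real.exp (2 * N * t ^ 2)) :=
        meas_ge_le_lintegral_div hF.ennreal_ofReal.aemeasurable (by simp [Real.exp_pos]) (by simp)
    _ ≤ ENNReal.ofReal (2 * Real.sqrt N) / ENNReal.ofReal (Real.exp (2 * N * t ^ 2)) := by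
        gcongr; exact lintegral_pi_exp_empFreq_le D hA hN
    _ = _ := by
        rw [← ENNReal.ofReal_div_of_pos (Real.exp_pos _), Real.exp_neg, div_eq_mul_inv]

end EmpFreq

/-! ### The PAC-Bayes bound -/

section HighProb

variable {Ω : Type} [MeasurableSpace Ω] {P : Measure Ω} {δ δ' : ℝ} {A B : Ω → Prop}

theorem HighProb.mono (h : HighProb P δ A) (hAB : ∀ S, A S → B S) : HighProb P δ B :=
  (measure_mono fun S (hS : ¬ B S) (hA : A S) => hS (hAB S hA)).trans h

theorem HighProb.and (hA : HighProb P δ A) (hB : HighProb P δ' B) (hδ : 0 ≤ δ) (hδ' : 0 ≤ δ') :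
    HighProb P (δ + δ') fun S => A S ∧ B S := by
  rw [HighProb, ENNReal.ofReal_add hδ hδ']
  refine (measure_mono fun S hS => ?_).trans
    ((measure_union_le {S | ¬ A S} {S | ¬ B S}).trans (add_le_add hA hB))
  exact not_and_or.1 hS

end HighProb

theorem integral_le_of_integral_sq_le {Ω : Type*} [MeasurableSpace Ω] {P : Measure Ω}
    [IsProbabilityMeasure P] {X : Ω → ℝ} (hX : MemLp X 2 P) {r : ℝ} (hr : 0 ≤ r)
    (h : ∫ ω, X ω ^ 2 ∂P ≤ r ^ 2) : ∫ ω, X ω ∂P ≤ r := by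
  have hvar := variance_nonneg X P
  rw [variance_eq_sub hX, sub_nonneg] at hvar
  exact le_of_sq_le_sq (hvar.trans h) hr

theorem integral_le_of_integral_exp_le {Ω : Type*} [MeasurableSpace Ω] {P : Measure Ω}
    [IsProbabilityMeasure P] {X : Ω → ℝ} (hX : Integrable X P)
    (hexp : Integrable (fun ω => Real.exp (X ω)) P) {c : ℝ}
    (h : ∫ ω, Real.exp (X ω) ∂P ≤ Real.exp c) : ∫ ω, X ω ∂P ≤ c :=
  Real.exp_le_exp.1 <| (convexOn_exp.map_integral_le Real.continuous_exp.continuousOn isClosed_univ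
    (ae_of_all _ fun _ => Set.mem_univ _) hX hexp).trans h

/-- The variational inequality of Donsker and Varadhan. -/
theorem integral_le_toReal_klDiv_add_log {Θ : Type*} [MeasurableSpace Θ] {post prior : Measure Θ}
    [IsProbabilityMeasure post] [IsProbabilityMeasure prior] (h : klDiv post prior ≠ ⊤)
    {φ : Θ → ℝ} (hφ : Integrable φ post) (hexp : Integrable (fun θ => Real.exp (φ θ)) prior) :
    ∫ θ, φ θ ∂post ≤ (klDiv post prior).toReal + Real.log (∫ θ, Real.exp (φ θ) ∂prior) := by
  obtain ⟨hac, hint⟩ := klDiv_ne_top_iff.1 h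
  have := isProbabilityMeasure_tilted hexp
  have hllr := integral_llr_tilted_right hac hφ hexp hint
  have hnonneg := integral_llr_add_sub_measure_univ_nonneg
    (hac.trans (absolutelyContinuous_tilted hexp)) (integrable_llr_tilted_right hac hφ hint hexp)
  have hkl := toReal_klDiv_of_measure_eq hac (by simp)
  simp only [probReal_univ, add_sub_cancel_right] at hnonneg
  linarith

section Gap

variable {d N : ℕ} {Θ : Type}

theorem empRisk_eq_empFreq (S : Fin N → Example d) (f : Θ → Feature d → ℝ) (θ : Θ) :
    empRisk S f θ = empFreq (errorSet f θ) S := rfl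

/-- The generalization gap of the hypothesis `θ`. -/
noncomputable def genGap (D : Measure (Example d)) (f : Θ → Feature d → ℝ) (S : Fin N → Example d)
    (θ : Θ) : ℝ :=
  risk D f θ - empRisk S f θ

theorem genGap_sq_le_one (D : Measure (Example d)) [IsProbabilityMeasure D]
    (f : Θ → Feature d → ℝ) (S : Fin N → Example d) (θ : Θ) : genGap D f S θ ^ 2 ≤ 1 := by
  have hrisk : risk D f θ ∈ Set.Icc (0 : ℝ) 1 := ⟨measureReal_nonneg, measureReal_le_one⟩
  have hemp : empRisk S f θ ∈ Set.Icc (0 : ℝ) 1 := ⟨empFreq_nonneg _ _, empFreq_le_one _ _⟩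
  rw [genGap, sq_le_one_iff_abs_le_one, abs_le]
  constructor <;> linarith [hrisk.1, hrisk.2, hemp.1, hemp.2]

variable [MeasurableSpace Θ] {f : Θ → Feature d → ℝ}

theorem measurableSet_errorSet_prod (hf : Measurable (Function.uncurry f)) :
    MeasurableSet {x : Θ × Example d | x.2 ∈ errorSet f x.1} := by
  have hspoof : MeasurableSet {x : Θ × Example d | x.2.2 = true} :=
    (measurable_snd.comp measurable_snd) (measurableSet_singleton true)
  have hpos : MeasurableSet {x : Θ × Example d | 0 < f x.1 x.2.1} :=
    measurableSet_lt measurable_const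
      (hf.comp (measurable_fst.prodMk (measurable_fst.comp measurable_snd)))
  exact (hspoof.iff hpos).compl

theorem measurableSet_errorSet (hf : Measurable (Function.uncurry f)) (θ : Θ) :
    MeasurableSet (errorSet f θ) :=
  measurable_prodMk_left (measurableSet_errorSet_prod hf)

theorem measurable_empRisk_prod (hf : Measurable (Function.uncurry f)) :
    Measurable fun x : (Fin N → Example d) × Θ => empRisk x.1 f x.2 := by
  have hind : Measurable ({x : Θ × Example d | x.2 ∈ errorSet f x.1}.indicator fun _ => (1 : ℝ)) :=
    measurable_const.indicator (measurableSet_errorSet_prod hf)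
  exact (Finset.measurable_sum _ fun i _ =>
    hind.comp (measurable_snd.prodMk ((measurable_pi_apply i).comp measurable_fst))).const_mul _

theorem measurable_genGap_prod (D : Measure (Example d)) [SFinite D]
    (hf : Measurable (Function.uncurry f)) :
    Measurable fun x : (Fin N → Example d) × Θ => genGap D f x.1 x.2 := by
  have hrisk : Measurable (risk D f) :=
    (measurable_measure_prodMk_left (measurableSet_errorSet_prod hf)).ennreal_toReal
  exact (hrisk.comp measurable_snd).sub (measurable_empRisk_prod hf)

theorem measurable_genGap (D : Measure (Example d)) [SFinite D]
    (hf : Measurable (Function.uncurry f)) (S : Fin N → Example d) : Measurable (genGap D f S) :=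
  (measurable_genGap_prod D hf).comp measurable_prodMk_left

theorem integrable_empRisk (hf : Measurable (Function.uncurry f)) (S : Fin N → Example d)
    (post : Measure Θ) [IsFiniteMeasure post] : Integrable (empRisk S f) post :=
  Integrable.of_bound
    ((measurable_empRisk_prod hf).comp measurable_prodMk_left).aestronglyMeasurable
    1 (ae_of_all _ fun θ => by
      rw [empRisk_eq_empFreq, Real.norm_of_nonneg (empFreq_nonneg _ _)]
      exact empFreq_le_one _ _)

variable (D : Measure (Example d)) [IsProbabilityMeasure D] (hf : Measurable (Function.uncurry f))
  (S : Fin N → Example d) {post prior : Measure Θ}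

include hf in
theorem memLp_genGap (post : Measure Θ) [IsFiniteMeasure post] (p : ℝ≥0∞) :
    MemLp (genGap D f S) p post :=
  MemLp.of_bound (measurable_genGap D hf S).aestronglyMeasurable 1
    (ae_of_all _ fun θ => by simpa using genGap_sq_le_one D f S θ)

include hf in
theorem integrable_exp_mul_genGap_sq (post : Measure Θ) [IsFiniteMeasure post] (t : ℝ) :
    Integrable (fun θ => Real.exp (t * genGap D f S θ ^ 2)) post :=
  Integrable.of_bound
    (((measurable_genGap D hf S).pow_const 2).const_mul t).exp.aestronglyMeasurable
    (Real.exp |t|) (ae_of_all _ fun θ => by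
      rw [Real.norm_of_nonneg (Real.exp_pos _).le, Real.exp_le_exp]
      calc t * genGap D f S θ ^ 2 ≤ |t| * genGap D f S θ ^ 2 := by gcongr; exact le_abs_self t
        _ ≤ |t| := mul_le_of_le_one_right (abs_nonneg t) (genGap_sq_le_one D f S θ))

include hf in
theorem integral_risk_le_of_integral_genGap_sq_le [IsProbabilityMeasure post] {r : ℝ} (hr : 0 ≤ r)
    (h : ∫ θ, genGap D f S θ ^ 2 ∂post ≤ r ^ 2) :
    ∫ θ, risk D f θ ∂post ≤ ∫ θ, empRisk S f θ ∂post + r := by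
  have hemp := integrable_empRisk hf S post
  have hgap : Integrable (genGap D f S) post := memLp_one_iff_integrable.1 (memLp_genGap D hf S _ 1)
  calc ∫ θ, risk D f θ ∂post = ∫ θ, (empRisk S f θ + genGap D f S θ) ∂post := by simp [genGap]
    _ = ∫ θ, empRisk S f θ ∂post + ∫ θ, genGap D f S θ ∂post := integral_add hemp hgap
    _ ≤ _ := by gcongr; exact integral_le_of_integral_sq_le (memLp_genGap D hf S _ 2) hr h

/-- The exponential moment of the squared generalization gap under the prior, the quantity that
PAC-Bayes arguments transfer from the prior to the posterior. -/
noncomputable def gapMoment (D : Measure (Example d)) (f : Θ → Feature d → ℝ) (prior : Measure Θ)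
    (S : Fin N → Example d) : ℝ≥0∞ :=
  ∫⁻ θ, ENNReal.ofReal (Real.exp (2 * N * genGap D f S θ ^ 2)) ∂prior

include hf in
theorem highProb_gapMoment_lt (prior : Measure Θ) [IsProbabilityMeasure prior] (hN : 0 < N) {δ : ℝ}
    (hδ : 0 < δ) : HighProb (sampleLaw D N) δ fun S =>
      gapMoment D f prior S < ENNReal.ofReal (2 * Real.sqrt N / δ) := by
  have : IsProbabilityMeasure (sampleLaw D N) := by unfold sampleLaw; infer_instance
  have hjoint : Measurable fun x : (Fin N → Example d) × Θ =>
      ENNReal.ofReal (Real.exp (2 * N * genGap D f x.1 x.2 ^ 2)) :=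
    (((measurable_genGap_prod D hf).pow_const 2).const_mul _).exp.ennreal_ofReal
  have hmean : ∫⁻ S, gapMoment D f prior S ∂sampleLaw D N ≤ ENNReal.ofReal (2 * Real.sqrt N) := by
    unfold gapMoment
    rw [lintegral_lintegral_swap hjoint.aemeasurable]
    calc _ ≤ ∫⁻ _, ENNReal.ofReal (2 * Real.sqrt N) ∂prior :=
          lintegral_mono fun θ => lintegral_pi_exp_empFreq_le D (measurableSet_errorSet hf θ) hN
      _ = _ := by simp
  simp only [HighProb, not_lt]
  calc _ ≤ (∫⁻ S, gapMoment D f prior S ∂sampleLaw D N) / ENNReal.ofReal (2 * Real.sqrt N / δ) :=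
        meas_ge_le_lintegral_div hjoint.lintegral_prod_right'.aemeasurable
          (ENNReal.ofReal_pos.2 (by positivity)).ne' ENNReal.ofReal_ne_top
    _ ≤ ENNReal.ofReal (2 * Real.sqrt N) / ENNReal.ofReal (2 * Real.sqrt N / δ) := by gcongr
    _ = ENNReal.ofReal δ := by
        rw [← ENNReal.ofReal_div_of_pos (by positivity)]
        congr 1
        field_simp

include hf in
theorem pacBayesBound_of_gapMoment_lt [IsProbabilityMeasure post] [IsProbabilityMeasure prior]
    (hN : 1 ≤ N) {δ : ℝ} (hδ : 0 < δ) (hδ1 : δ < 1) (hkl : klDiv post prior ≠ ⊤)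
    (h : gapMoment D f prior S < ENNReal.ofReal (2 * Real.sqrt N / δ)) :
    PACBayesBound D S f post prior δ := by
  have hN' : (1 : ℝ) ≤ N := by exact_mod_cast hN
  have hint := integrable_exp_mul_genGap_sq D hf S prior (2 * N)
  have hmoment : ∫ θ, Real.exp (2 * N * genGap D f S θ ^ 2) ∂prior ≤ 2 * Real.sqrt N / δ := by
    rw [integral_eq_lintegral_of_nonneg_ae (ae_of_all _ fun θ => (Real.exp_pos _).le)
      hint.aestronglyMeasurable]
    exact ENNReal.toReal_le_of_le_ofReal (by positivity) h.le
  have hvar := integral_le_toReal_klDiv_add_log hkl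
    ((memLp_genGap D hf S post 2).integrable_sq.const_mul (2 * (N : ℝ))) hint
  rw [integral_const_mul] at hvar
  have hlog := Real.log_le_log (integral_exp_pos hint) hmoment
  have hlogpos : 0 ≤ Real.log (2 * Real.sqrt N / δ) := by
    refine Real.log_nonneg ((one_le_div₀ hδ).2 ?_)
    linarith [Real.one_le_sqrt.2 hN']
  refine ⟨hkl, integral_risk_le_of_integral_genGap_sq_le D hf S (Real.sqrt_nonneg _) ?_⟩
  rw [Real.sq_sqrt (by positivity), le_div_iff₀ (by positivity)]
  linarith

/-- The posterior `post` is controlled by `prior` at level `κ`: besides the Kullback–Leibler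
divergence, it is the exponential moments that are needed to bound the risk of a single draw. -/
structure PosteriorControl {E : Type*} [MeasurableSpace E] (prior post : Measure E) (κ : ℝ) :
    Prop where
  isProbabilityMeasure : IsProbabilityMeasure post
  klDiv_le : klDiv post prior ≤ ENNReal.ofReal κ
  lintegral_exp_half_le : ∀ φ : E → ℝ, Measurable φ →
    ∫⁻ x, ENNReal.ofReal (Real.exp (φ x / 2)) ∂post ≤
      ENNReal.ofReal (Real.exp κ) * (1 + ∫⁻ x, ENNReal.ofReal (Real.exp (φ x)) ∂prior)

theorem PosteriorControl.klDiv_ne_top {κ : ℝ} (h : PosteriorControl prior post κ) :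
    klDiv post prior ≠ ⊤ :=
  (h.klDiv_le.trans_lt ENNReal.ofReal_lt_top).ne

include hf in
theorem highProb_pacBayesBound (prior : Measure Θ) [IsProbabilityMeasure prior]
    {post : (Fin N → Example d) → Measure Θ} {κ : (Fin N → Example d) → ℝ}
    (hpost : ∀ S, PosteriorControl prior (post S) (κ S)) (hN : 1 ≤ N) {δ : ℝ} (hδ : 0 < δ)
    (hδ1 : δ < 1) :
    HighProb (sampleLaw D N) δ fun S => PACBayesBound D S f (post S) prior δ :=
  (highProb_gapMoment_lt D hf prior hN hδ).mono fun S hS =>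
    have := (hpost S).isProbabilityMeasure
    pacBayesBound_of_gapMoment_lt D hf S hN hδ hδ1 (hpost S).klDiv_ne_top hS

include hf in
theorem integral_risk_le_of_lintegral_exp_genGap_sq_le [IsProbabilityMeasure post] (hN : 0 < N)
    {r : ℝ} (hr : 0 ≤ r) (h : ∫⁻ θ, ENNReal.ofReal (Real.exp (N * genGap D f S θ ^ 2)) ∂post ≤
      ENNReal.ofReal (Real.exp (N * r ^ 2))) :
    ∫ θ, risk D f θ ∂post ≤ ∫ θ, empRisk S f θ ∂post + r := by
  have hint := integrable_exp_mul_genGap_sq D hf S post N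
  have hmoment : ∫ θ, Real.exp (N * genGap D f S θ ^ 2) ∂post ≤ Real.exp (N * r ^ 2) := by
    rw [integral_eq_lintegral_of_nonneg_ae (ae_of_all _ fun θ => (Real.exp_pos _).le)
      hint.aestronglyMeasurable]
    exact ENNReal.toReal_le_of_le_ofReal (Real.exp_pos _).le h
  have hjensen := integral_le_of_integral_exp_le
    ((memLp_genGap D hf S post 2).integrable_sq.const_mul (N : ℝ)) hint hmoment
  rw [integral_const_mul] at hjensen
  exact integral_risk_le_of_integral_genGap_sq_le D hf S hr
    (le_of_mul_le_mul_left hjensen (by exact_mod_cast hN))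

include hf in
theorem measure_genGap_gt_le {δ r : ℝ} (hr : 0 ≤ r)
    (h : ∫⁻ θ, ENNReal.ofReal (Real.exp (N * genGap D f S θ ^ 2)) ∂post ≤
      ENNReal.ofReal (δ * Real.exp (N * r ^ 2))) :
    post {θ | ¬ risk D f θ ≤ empRisk S f θ + r} ≤ ENNReal.ofReal δ := by
  have hmeas : Measurable fun θ => ENNReal.ofReal (Real.exp (N * genGap D f S θ ^ 2)) :=
    (((measurable_genGap D hf S).pow_const 2).const_mul _).exp.ennreal_ofReal
  have hsub : {θ | ¬ risk D f θ ≤ empRisk S f θ + r} ⊆ {θ | ENNReal.ofReal (Real.exp (N * r ^ 2)) ≤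
      ENNReal.ofReal (Real.exp (N * genGap D f S θ ^ 2))} := by
    intro θ (hθ : ¬ risk D f θ ≤ empRisk S f θ + r)
    have : r ≤ genGap D f S θ := by rw [genGap]; linarith
    refine ENNReal.ofReal_le_ofReal (Real.exp_le_exp.2 ?_)
    gcongr
  calc _ ≤ _ := measure_mono hsub
    _ ≤ _ := meas_ge_le_lintegral_div hmeas.aemeasurable
        (ENNReal.ofReal_pos.2 (Real.exp_pos _)).ne' ENNReal.ofReal_ne_top
    _ ≤ ENNReal.ofReal (δ * Real.exp (N * r ^ 2)) / ENNReal.ofReal (Real.exp (N * r ^ 2)) := by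
        gcongr
    _ = ENNReal.ofReal δ := by
        rw [← ENNReal.ofReal_div_of_pos (Real.exp_pos _),
          mul_div_cancel_right₀ _ (Real.exp_pos _).ne']

include hf in
theorem riskBound_of_gapMoment_lt {κ : ℝ} (hpost : PosteriorControl prior post κ) (hN : 0 < N)
    {δ G r : ℝ} (hδ1 : δ ≤ 1) (hG : 0 ≤ G) (hr : 0 ≤ r)
    (h : gapMoment D f prior S < ENNReal.ofReal G)
    (hκ : Real.exp κ * (1 + G) ≤ δ * Real.exp (N * r ^ 2)) : RiskBound D S f post δ r := by
  have := hpost.isProbabilityMeasure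
  have hmoment : ∫⁻ θ, ENNReal.ofReal (Real.exp (N * genGap D f S θ ^ 2)) ∂post ≤
      ENNReal.ofReal (δ * Real.exp (N * r ^ 2)) := by
    calc ∫⁻ θ, ENNReal.ofReal (Real.exp (N * genGap D f S θ ^ 2)) ∂post
        = ∫⁻ θ, ENNReal.ofReal (Real.exp (2 * N * genGap D f S θ ^ 2 / 2)) ∂post := by
          simp only [mul_assoc, mul_div_cancel_left₀ _ (two_ne_zero (α := ℝ))]
      _ ≤ ENNReal.ofReal (Real.exp κ) * (1 + gapMoment D f prior S) :=
          hpost.lintegral_exp_half_le _ (((measurable_genGap D hf S).pow_const 2).const_mul _)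
      _ ≤ ENNReal.ofReal (Real.exp κ) * (1 + ENNReal.ofReal G) := by gcongr
      _ = ENNReal.ofReal (Real.exp κ * (1 + G)) := by
          rw [ENNReal.ofReal_mul (Real.exp_pos _).le, ENNReal.ofReal_add zero_le_one hG,
            ENNReal.ofReal_one]
      _ ≤ _ := ENNReal.ofReal_le_ofReal hκ
  refine ⟨integral_risk_le_of_lintegral_exp_genGap_sq_le D hf S hN hr (hmoment.trans ?_),
    measure_genGap_gt_le D hf S hr hmoment⟩
  exact ENNReal.ofReal_le_ofReal (mul_le_of_le_one_left (Real.exp_pos _).le hδ1)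

omit [IsProbabilityMeasure D] in
include hf in
theorem riskBound_of_forall_le [IsProbabilityMeasure post] {δ rate : ℝ}
    (h : ∀ θ, risk D f θ ≤ empRisk S f θ + rate) : RiskBound D S f post δ rate := by
  have hemp := integrable_empRisk hf S post
  refine ⟨?_, by simp [h]⟩
  calc ∫ θ, risk D f θ ∂post ≤ ∫ θ, (empRisk S f θ + rate) ∂post :=
        integral_mono_of_nonneg (ae_of_all _ fun _ => measureReal_nonneg)
          (hemp.add (integrable_const rate)) (ae_of_all _ h)
    _ = _ := by rw [integral_add hemp (integrable_const rate)]; simp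

end Gap

/-! ### Exponential tilts of a measure -/

section Tilted

variable {E : Type*} [MeasurableSpace E] {prior : Measure E} [IsProbabilityMeasure prior]
  {h g : E → ℝ}

theorem integrable_tilted_of_le (hh : AEStronglyMeasurable h prior)
    (hexp : Integrable (fun x => Real.exp (h x)) prior) (hg : Integrable g (prior.tilted h))
    (hle : ∀ x, h x ≤ g x) : Integrable h (prior.tilted h) := by
  rw [integrable_tilted_iff hexp] at hg ⊢
  refine (hg.norm.add (integrable_const 1)).mono' (hexp.aestronglyMeasurable.smul hh)
    (ae_of_all _ fun x => ?_)
  simp only [Pi.add_apply, norm_smul, Real.norm_eq_abs, Real.abs_exp]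
  rcases le_total 0 (h x) with hx | hx
  · have : |h x| ≤ |g x| := abs_le_abs_of_nonneg hx (hle x)
    have := mul_le_mul_of_nonneg_left this (Real.exp_pos (h x)).le
    linarith
  · have hbound : Real.exp (h x) * |h x| ≤ 1 := by
      rw [abs_of_nonpos hx]
      calc Real.exp (h x) * -h x ≤ Real.exp (h x) * Real.exp (-h x) := by
            gcongr; linarith [Real.add_one_le_exp (-h x)]
        _ = 1 := by rw [← Real.exp_add, add_neg_cancel, Real.exp_zero]
    have : 0 ≤ Real.exp (h x) * |g x| := by positivity
    linarith

theorem klDiv_tilted_le (hh : AEStronglyMeasurable h prior)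
    (hexp : Integrable (fun x => Real.exp (h x)) prior) (hg : Integrable g (prior.tilted h))
    (hle : ∀ x, h x - Real.log (∫ x, Real.exp (h x) ∂prior) ≤ g x) :
    klDiv (prior.tilted h) prior ≤ ENNReal.ofReal (∫ x, g x ∂prior.tilted h) := by
  set logZ := Real.log (∫ x, Real.exp (h x) ∂prior)
  have := isProbabilityMeasure_tilted hexp
  have hac := tilted_absolutelyContinuous prior h
  have hint : Integrable (fun x => h x - logZ) (prior.tilted h) :=
    (integrable_tilted_of_le hh hexp (hg.add (integrable_const logZ)) fun x => by
      simpa using sub_le_iff_le_add.1 (hle x)).sub (integrable_const _)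
  have hllr : llr (prior.tilted h) prior =ᵐ[prior.tilted h] fun x => h x - logZ :=
    hac.ae_le (log_rnDeriv_tilted_left_self hexp)
  rw [klDiv_of_ac_of_integrable hac (hint.congr hllr.symm)]
  simp only [probReal_univ, add_sub_cancel_right]
  rw [integral_congr_ae hllr]
  exact ENNReal.ofReal_le_ofReal (integral_mono hint hg hle)

theorem lintegral_tilted_exp_half_le (hh : Measurable h)
    (hexp : Integrable (fun x => Real.exp (h x)) prior) {φ s : E → ℝ} (hφ : Measurable φ)
    {c : ℝ} (hle : ∀ x, h x - Real.log (∫ x, Real.exp (h x) ∂prior) ≤ c + s x) :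
    ∫⁻ x, ENNReal.ofReal (Real.exp (φ x / 2)) ∂prior.tilted h ≤
      ENNReal.ofReal (Real.exp (c / 2)) * (∫⁻ x, ENNReal.ofReal (Real.exp (φ x)) ∂prior +
        ∫⁻ x, ENNReal.ofReal (Real.exp (s x)) ∂prior.tilted h) := by
  have hZ : 0 < ∫ x, Real.exp (h x) ∂prior := integral_exp_pos hexp
  set logZ := Real.log (∫ x, Real.exp (h x) ∂prior) with hlogZ
  have hchange : ∫⁻ x, ENNReal.ofReal (Real.exp (φ x - (h x - logZ))) ∂prior.tilted h =
      ∫⁻ x, ENNReal.ofReal (Real.exp (φ x)) ∂prior := by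
    rw [lintegral_tilted]
    refine lintegral_congr fun x => ?_
    rw [← ENNReal.ofReal_mul (by positivity), ← Real.exp_log hZ, ← hlogZ, ← Real.exp_sub,
      ← Real.exp_add]
    ring_nf
  have hpoint : ∀ x, Real.exp (φ x / 2) ≤
      Real.exp (c / 2) * (Real.exp (φ x - (h x - logZ)) + Real.exp (s x)) := by
    intro x
    have hamgm := two_mul_le_add_sq (Real.exp ((φ x - (h x - logZ)) / 2)) (Real.exp (s x / 2))
    rw [← Real.exp_nat_mul, ← Real.exp_nat_mul, mul_assoc, ← Real.exp_add] at hamgm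
    push_cast at hamgm
    simp only [mul_div_cancel₀ _ (two_ne_zero (α := ℝ))] at hamgm
    calc Real.exp (φ x / 2)
        ≤ Real.exp (c / 2) * Real.exp ((φ x - (h x - logZ)) / 2 + s x / 2) := by
          rw [← Real.exp_add, Real.exp_le_exp]
          linarith [hle x]
      _ ≤ _ := by
          gcongr
          linarith [Real.exp_pos ((φ x - (h x - logZ)) / 2 + s x / 2)]
  rw [← hchange, ← lintegral_add_left (by fun_prop), ← lintegral_const_mul' _ _ (by simp)]
  refine lintegral_mono fun x => ?_
  rw [← ENNReal.ofReal_add (by positivity) (by positivity), ← ENNReal.ofReal_mul (by positivity)]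
  exact ENNReal.ofReal_le_ofReal (hpoint x)

theorem posteriorControl_tilted (hh : Measurable h)
    (hexp : Integrable (fun x => Real.exp (h x)) prior) {s : E → ℝ} {c b : ℝ} (hc : 0 ≤ c)
    (hb : 0 ≤ b) (hle : ∀ x, h x - Real.log (∫ x, Real.exp (h x) ∂prior) ≤ c + s x)
    (hs : Integrable s (prior.tilted h))
    (hexps : Integrable (fun x => Real.exp (s x)) (prior.tilted h))
    (hsb : ∫ x, Real.exp (s x) ∂prior.tilted h ≤ Real.exp b) :
    PosteriorControl prior (prior.tilted h) (c + b) := by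
  have := isProbabilityMeasure_tilted hexp
  refine ⟨this, ?_, fun φ hφ => ?_⟩
  · refine (klDiv_tilted_le hh.aestronglyMeasurable hexp ((integrable_const c).add hs) hle).trans
      (ENNReal.ofReal_le_ofReal ?_)
    rw [Pi.add_def, integral_add (integrable_const c) hs]
    simpa using integral_le_of_integral_exp_le hs hexps hsb
  · refine (lintegral_tilted_exp_half_le hh hexp hφ hle).trans ?_
    rw [← ofReal_integral_eq_lintegral_ofReal hexps (ae_of_all _ fun _ => (Real.exp_pos _).le)]
    have hexpb : ENNReal.ofReal (Real.exp b) ≥ 1 := by simpa using hb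
    calc _ ≤ ENNReal.ofReal (Real.exp c) *
          (ENNReal.ofReal (Real.exp b) * ∫⁻ x, ENNReal.ofReal (Real.exp (φ x)) ∂prior +
            ENNReal.ofReal (Real.exp b)) := by
          gcongr
          · linarith
          · exact le_mul_of_one_le_left' hexpb
      _ = _ := by
          rw [Real.exp_add, ENNReal.ofReal_mul (Real.exp_pos c).le]
          ring

end Tilted

/-! ### Gibbs perturbations of an isotropic Gaussian -/

section Gibbs

variable {V : Type*} [NormedAddCommGroup V] [InnerProductSpace ℝ V]

section ExcessLoss

variable {ι : Type*} [Fintype ι] {b : ι → V} {G : V → ℝ}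

/-- `G` behaves like the excess of a logistic loss over its linearization at a minimizer, where the
`b i` are the gradients of the individual scores: it is convex, nonnegative, and dominated by the
quadratic form with the maximal logistic curvature `1/4`. -/
structure IsExcessLoss (b : ι → V) (G : V → ℝ) : Prop where
  convexOn : ConvexOn ℝ Set.univ G
  nonneg : ∀ u, 0 ≤ G u
  le_sq : ∀ u, G u ≤ (∑ i, ⟪b i, u⟫ ^ 2) / 8

theorem IsExcessLoss.map_zero (hG : IsExcessLoss b G) : G 0 = 0 :=
  le_antisymm (by simpa using hG.le_sq 0) (hG.nonneg 0)

theorem IsExcessLoss.le_map_smul (hG : IsExcessLoss b G) {c : ℝ} (hc : 1 ≤ c) (u : V) :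
    G u ≤ G (c • u) := by
  have hc0 : 0 < c := by linarith
  have hinv : c⁻¹ ≤ 1 := inv_le_one_of_one_le₀ hc
  have hconv := hG.convexOn.2 (Set.mem_univ 0) (Set.mem_univ (c • u))
    (sub_nonneg.2 hinv) (inv_nonneg.2 hc0.le) (sub_add_cancel _ _)
  rw [smul_zero, zero_add, inv_smul_smul₀ hc0.ne', hG.map_zero, smul_zero, zero_add,
    smul_eq_mul] at hconv
  exact hconv.trans (mul_le_of_le_one_left (hG.nonneg _) hinv)

theorem IsExcessLoss.comp_smul (hG : IsExcessLoss b G) (c : ℝ) :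
    IsExcessLoss (fun i => c • b i) fun u => G (c • u) where
  convexOn := hG.convexOn.comp_linearMap (LinearMap.lsmul ℝ V c)
  nonneg u := hG.nonneg _
  le_sq u := by simpa only [real_inner_smul_left, real_inner_smul_right] using hG.le_sq (c • u)

theorem IsExcessLoss.continuous [FiniteDimensional ℝ V] (hG : IsExcessLoss b G) : Continuous G :=
  continuousOn_univ.1 (hG.convexOn.continuousOn isOpen_univ)

end ExcessLoss

/-- The negative logarithm, up to an additive constant, of the density of a Gaussian of variance
`σ ^ 2` perturbed by the energy `G`, as a function of the deviation `u` from the mode. -/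
noncomputable def gibbsEnergy (G : V → ℝ) (σ : ℝ) (u : V) : ℝ := G u + ‖u‖ ^ 2 / (2 * σ ^ 2)

theorem gibbsEnergy_mul_smul (G : V → ℝ) (σ : ℝ) {c : ℝ} (hc : c ≠ 0) (u : V) :
    gibbsEnergy G (c * σ) (c • u) = gibbsEnergy (fun v => G (c • v)) σ u := by
  rw [gibbsEnergy, gibbsEnergy, norm_smul, mul_pow, mul_pow, Real.norm_eq_abs, sq_abs,
    mul_left_comm, mul_div_mul_left _ _ (pow_ne_zero 2 hc)]

theorem IsExcessLoss.gibbsEnergy_sub_le {ι : Type*} [Fintype ι] {b : ι → V} {G : V → ℝ}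
    (hG : IsExcessLoss b G) (μ m : V) (σ : ℝ) (x : V) :
    gibbsEnergy 0 σ (x - μ) - gibbsEnergy G σ (x - m) ≤
      3 / 2 * ‖m - μ‖ ^ 2 / σ ^ 2 + ‖x - m‖ ^ 2 / (4 * σ ^ 2) := by
  have htri : ‖x - μ‖ ≤ ‖x - m‖ + ‖m - μ‖ := norm_sub_le_norm_sub_add_norm_sub x m μ
  have hsq : ‖x - μ‖ ^ 2 ≤ 3 / 2 * ‖x - m‖ ^ 2 + 3 * ‖m - μ‖ ^ 2 := by
    have := pow_le_pow_left₀ (norm_nonneg _) htri 2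
    nlinarith [sq_nonneg (‖x - m‖ - 2 * ‖m - μ‖)]
  have hnonneg := hG.nonneg (x - m)
  have hscaled := div_le_div_of_nonneg_right hsq (by positivity : 0 ≤ 2 * σ ^ 2)
  simp only [gibbsEnergy, Pi.zero_apply]
  have hsplit : (3 / 2 * ‖x - m‖ ^ 2 + 3 * ‖m - μ‖ ^ 2) / (2 * σ ^ 2) =
      3 / 2 * ‖m - μ‖ ^ 2 / σ ^ 2 + ‖x - m‖ ^ 2 / (4 * σ ^ 2) + ‖x - m‖ ^ 2 / (2 * σ ^ 2) := by
    ring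
  linarith

omit [InnerProductSpace ℝ V] in
theorem gibbsEnergy_sqrt_two_mul (G : V → ℝ) (σ : ℝ) (u : V) :
    gibbsEnergy G (Real.sqrt 2 * σ) u = gibbsEnergy G σ u - ‖u‖ ^ 2 / (4 * σ ^ 2) := by
  rw [gibbsEnergy, gibbsEnergy, mul_pow, Real.sq_sqrt zero_le_two]
  ring

variable [MeasureSpace V]

/-- The probability measure with density proportional to `exp (-gibbsEnergy G σ (x - m))`; it is `0`
if that function is not integrable. -/
noncomputable def gibbs (m : V) (σ : ℝ) (G : V → ℝ) : Measure V :=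
  volume.tilted fun x => -gibbsEnergy G σ (x - m)

/-- `prior` is the isotropic Gaussian measure with mean `μ` and variance `σ ^ 2`.  The second
moments are recorded because `V` stands both for `ℝ` and for `EuclideanSpace ℝ (Fin d)`. -/
structure IsIsotropicGaussian (prior : Measure V) (μ : V) (σ : ℝ) : Prop where
  isProbabilityMeasure : IsProbabilityMeasure prior
  eq_gibbs : prior = gibbs μ σ 0
  integrable_sq : ∀ b, Integrable (fun x => ⟪b, x - μ⟫ ^ 2) prior
  integral_sq : ∀ b, ∫ x, ⟪b, x - μ⟫ ^ 2 ∂prior = σ ^ 2 * ‖b‖ ^ 2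

variable [BorelSpace V] {prior : Measure V} {μ m : V} {σ : ℝ} {ι : Type*} [Fintype ι]
  {b : ι → V} {G : V → ℝ}

/-- Jensen's inequality; shrinking the deviation by `t` makes the bound as small as required. -/
theorem exp_neg_le_integral_exp_neg_smul [FiniteDimensional ℝ V]
    (h : IsIsotropicGaussian prior μ σ) (hG : IsExcessLoss b G) (t : ℝ) :
    Real.exp (-(t ^ 2 * (σ ^ 2 * ∑ i, ‖b i‖ ^ 2) / 8)) ≤
      ∫ x, Real.exp (-G (t • (x - μ))) ∂prior := by
  have := h.isProbabilityMeasure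
  have hcont : Continuous fun x => G (t • (x - μ)) := hG.continuous.comp (by fun_prop)
  have hsq : Integrable (fun x => t ^ 2 * (∑ i, ⟪b i, x - μ⟫ ^ 2) / 8) prior :=
    ((integrable_finsetSum _ fun i _ => h.integrable_sq (b i)).const_mul _).div_const _
  have hle : ∀ x, G (t • (x - μ)) ≤ t ^ 2 * (∑ i, ⟪b i, x - μ⟫ ^ 2) / 8 := fun x => by
    simpa only [real_inner_smul_right, mul_pow, ← Finset.mul_sum] using hG.le_sq (t • (x - μ))
  have hint : Integrable (fun x => G (t • (x - μ))) prior :=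
    hsq.mono' hcont.aestronglyMeasurable (ae_of_all _ fun x => by
      rw [Real.norm_of_nonneg (hG.nonneg _)]; exact hle x)
  have hmean : ∫ x, G (t • (x - μ)) ∂prior ≤ t ^ 2 * (σ ^ 2 * ∑ i, ‖b i‖ ^ 2) / 8 := by
    refine (integral_mono hint hsq hle).trans_eq ?_
    rw [integral_div, integral_const_mul, integral_finsetSum _ fun i _ => h.integrable_sq (b i)]
    simp only [h.integral_sq, Finset.mul_sum]
  have hexp : Integrable (fun x => Real.exp (-G (t • (x - μ)))) prior :=
    Integrable.of_bound hcont.neg.rexp.aestronglyMeasurable 1 (ae_of_all _ fun x => by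
      simpa [Real.norm_of_nonneg (Real.exp_pos _).le] using hG.nonneg _)
  calc _ ≤ Real.exp (∫ x, -G (t • (x - μ)) ∂prior) := by
        rw [Real.exp_le_exp, integral_neg]; linarith
    _ ≤ _ := convexOn_exp.map_integral_le Real.continuous_exp.continuousOn isClosed_univ
        (ae_of_all _ fun _ => Set.mem_univ _) hint.neg hexp

variable [(volume : Measure V).IsAddHaarMeasure]

omit [InnerProductSpace ℝ V] in
theorem integral_exp_neg_gibbsEnergy_sub (G : V → ℝ) (σ : ℝ) (m : V) :
    ∫ x, Real.exp (-gibbsEnergy G σ (x - m)) = ∫ u, Real.exp (-gibbsEnergy G σ u) :=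
  integral_sub_right_eq_self (fun u => Real.exp (-gibbsEnergy G σ u)) m

theorem IsIsotropicGaussian.integrable_exp_neg (h : IsIsotropicGaussian prior μ σ) :
    Integrable fun u : V => Real.exp (-gibbsEnergy 0 σ u) := by
  by_contra hnot
  have hnot' : ¬ Integrable fun x : V => Real.exp (-gibbsEnergy 0 σ (x - μ)) := fun hint =>
    hnot (by simpa using hint.comp_add_right μ)
  have := h.isProbabilityMeasure
  refine IsProbabilityMeasure.ne_zero prior ?_
  rw [h.eq_gibbs, gibbs, tilted_of_not_integrable hnot']

theorem IsIsotropicGaussian.integral_exp (h : IsIsotropicGaussian prior μ σ) (g : V → ℝ) :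
    ∫ x, Real.exp (g x) ∂prior = (∫ x, Real.exp (g x - gibbsEnergy 0 σ (x - μ))) /
      ∫ u : V, Real.exp (-gibbsEnergy 0 σ u) := by
  rw [h.eq_gibbs, gibbs, integral_exp_tilted, integral_exp_neg_gibbsEnergy_sub]
  simp only [Pi.add_apply, neg_add_eq_sub]

theorem gibbs_eq_tilted (h : IsIsotropicGaussian prior μ σ) (m : V) (G : V → ℝ) :
    gibbs m σ G = prior.tilted fun x => gibbsEnergy 0 σ (x - μ) - gibbsEnergy G σ (x - m) := by
  rw [h.eq_gibbs, gibbs, gibbs, tilted_tilted (h.integrable_exp_neg.comp_sub_right μ)]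
  simp only [Pi.add_def, neg_add_cancel_left, sub_eq_add_neg]

variable [FiniteDimensional ℝ V]

theorem IsExcessLoss.integrable_exp_neg_gibbsEnergy (hG : IsExcessLoss b G)
    (h : IsIsotropicGaussian prior μ σ) : Integrable fun u => Real.exp (-gibbsEnergy G σ u) := by
  have hcont := hG.continuous
  refine h.integrable_exp_neg.mono' (by unfold gibbsEnergy; fun_prop) (ae_of_all _ fun u => ?_)
  rw [Real.norm_of_nonneg (Real.exp_pos _).le, Real.exp_le_exp]
  simpa [gibbsEnergy] using hG.nonneg u

theorem integral_exp_neg_gibbsEnergy_mul (G : V → ℝ) (σ : ℝ) {c : ℝ} (hc : 0 < c) :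
    ∫ u, Real.exp (-gibbsEnergy G (c * σ) u) =
      c ^ Module.finrank ℝ V * ∫ u, Real.exp (-gibbsEnergy (fun v => G (c • v)) σ u) := by
  have hscale := Measure.integral_comp_smul_of_nonneg volume
    (fun u => Real.exp (-gibbsEnergy G (c * σ) u)) c (hR := hc.le)
  simp only [gibbsEnergy_mul_smul G σ hc.ne'] at hscale
  rw [hscale, smul_eq_mul, mul_inv_cancel_left₀ (by positivity)]

theorem integral_exp_neg_smul_mul_le (h : IsIsotropicGaussian prior μ σ) (hG : IsExcessLoss b G)
    {t : ℝ} (ht : 0 < t) (ht1 : t ≤ 1) :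
    t ^ Module.finrank ℝ V *
      ((∫ x, Real.exp (-G (t • (x - μ))) ∂prior) * ∫ u : V, Real.exp (-gibbsEnergy 0 σ u)) ≤
      ∫ u, Real.exp (-gibbsEnergy G σ u) := by
  have hZ := integral_exp_pos h.integrable_exp_neg
  have htrans := integral_exp_neg_gibbsEnergy_sub (fun v => G (t • v)) σ μ
  have hterm : ∀ x, -G (t • (x - μ)) - gibbsEnergy 0 σ (x - μ) =
      -gibbsEnergy (fun v => G (t • v)) σ (x - μ) := fun x => by simp [gibbsEnergy]; ring
  simp only [h.integral_exp, hterm, htrans]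
  rw [div_mul_cancel₀ _ hZ.ne', ← integral_exp_neg_gibbsEnergy_mul G σ ht]
  refine integral_mono_of_nonneg (ae_of_all _ fun u => (Real.exp_pos _).le)
    (hG.integrable_exp_neg_gibbsEnergy h) (ae_of_all _ fun u => Real.exp_le_exp.2 ?_)
  rw [neg_le_neg_iff, gibbsEnergy, gibbsEnergy, mul_pow, mul_left_comm (2 : ℝ),
    mul_comm (t ^ 2), ← div_div _ _ (t ^ 2)]
  exact add_le_add_right (le_div_self (by positivity) (by positivity) (pow_le_one₀ ht.le ht1)) _

/-- A bound for the drop of the logarithmic normalizing constant of a Gaussian caused by an excess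
loss; `n` is the dimension, `A` the variance times the sum of the squared gradient norms. -/
noncomputable def gibbsDrop (n : ℕ) (A : ℝ) : ℝ := n / 2 + n / 2 * Real.log (1 + A / (4 * n))

theorem gibbsDrop_nonneg (n : ℕ) {A : ℝ} (hA : 0 ≤ A) : 0 ≤ gibbsDrop n A := by
  have : 0 ≤ Real.log (1 + A / (4 * n)) := Real.log_nonneg (le_add_of_nonneg_right (by positivity))
  unfold gibbsDrop
  positivity

/-- The witness `t = (1 + A / (4 * n)) ^ (-1/2)` balances the two factors. -/
theorem exists_exp_neg_gibbsDrop_le {n : ℕ} {A : ℝ} (hA : 0 ≤ A) (hn : n = 0 → A = 0) :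
    ∃ t : ℝ, 0 < t ∧ t ≤ 1 ∧
      Real.exp (-gibbsDrop n A) ≤ t ^ n * Real.exp (-(t ^ 2 * A / 8)) := by
  set s : ℝ := 1 + A / (4 * n) with hs
  have hs1 : 1 ≤ s := le_add_of_nonneg_right (by positivity)
  have hs0 : 0 < s := by linarith
  refine ⟨(Real.sqrt s)⁻¹, by positivity, inv_le_one_of_one_le₀ (Real.one_le_sqrt.2 hs1), ?_⟩
  have hpow : (Real.sqrt s)⁻¹ ^ n = Real.exp (-(n / 2 * Real.log s)) := by
    rw [← Real.exp_log (show 0 < (Real.sqrt s)⁻¹ ^ n by positivity), Real.log_pow, Real.log_inv,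
      Real.log_sqrt hs0.le]
    ring_nf
  have hAs : A ≤ 4 * n * s := by
    rcases eq_or_ne n 0 with h0 | h0
    · simp [hn h0, h0]
    · rw [hs]
      field_simp
      linarith [show (0 : ℝ) ≤ n from n.cast_nonneg]
  have hquad : (Real.sqrt s)⁻¹ ^ 2 * A / 8 ≤ n / 2 := by
    rw [inv_pow, Real.sq_sqrt hs0.le, inv_mul_eq_div, div_div, div_le_iff₀ (by positivity)]
    linarith
  rw [hpow, ← Real.exp_add, Real.exp_le_exp, gibbsDrop]
  linarith

theorem exp_neg_gibbsDrop_mul_le (h : IsIsotropicGaussian prior μ σ) (hG : IsExcessLoss b G) :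
    Real.exp (-gibbsDrop (Module.finrank ℝ V) (σ ^ 2 * ∑ i, ‖b i‖ ^ 2)) *
      ∫ u : V, Real.exp (-gibbsEnergy 0 σ u) ≤ ∫ u, Real.exp (-gibbsEnergy G σ u) := by
  have hdim : Module.finrank ℝ V = 0 → σ ^ 2 * ∑ i, ‖b i‖ ^ 2 = 0 := fun h0 => by
    have := Module.finrank_zero_iff.1 h0
    simp [Subsingleton.elim _ (0 : V)]
  obtain ⟨t, ht, ht1, hle⟩ := exists_exp_neg_gibbsDrop_le (by positivity) hdim
  have hjensen := exp_neg_le_integral_exp_neg_smul h hG t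
  refine le_trans ?_ (integral_exp_neg_smul_mul_le h hG ht ht1)
  rw [← mul_assoc]
  exact mul_le_mul_of_nonneg_right (hle.trans (by gcongr))
    (integral_exp_pos h.integrable_exp_neg).le

theorem IsExcessLoss.integrable_exp_neg_gibbsEnergy_mul (hG : IsExcessLoss b G)
    (h : IsIsotropicGaussian prior μ σ) {c : ℝ} (hc : c ≠ 0) :
    Integrable fun u => Real.exp (-gibbsEnergy G (c * σ) u) := by
  rw [← integrable_comp_smul_iff volume _ hc]
  simpa only [gibbsEnergy_mul_smul G σ hc] using (hG.comp_smul c).integrable_exp_neg_gibbsEnergy h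

theorem IsExcessLoss.integral_exp_neg_gibbsEnergy_mul_le (hG : IsExcessLoss b G)
    (h : IsIsotropicGaussian prior μ σ) {c : ℝ} (hc : 1 ≤ c) :
    ∫ u, Real.exp (-gibbsEnergy G (c * σ) u) ≤
      c ^ Module.finrank ℝ V * ∫ u, Real.exp (-gibbsEnergy G σ u) := by
  rw [integral_exp_neg_gibbsEnergy_mul G σ (by linarith)]
  gcongr ?_ * ?_
  refine integral_mono_of_nonneg (ae_of_all _ fun u => (Real.exp_pos _).le)
    (hG.integrable_exp_neg_gibbsEnergy h) (ae_of_all _ fun u => Real.exp_le_exp.2 ?_)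
  exact neg_le_neg (add_le_add_left (hG.le_map_smul hc u) _)

/-- An upper bound for the divergence of a Gibbs posterior with mode `m` from the Gaussian prior
with mean `μ`, when `b` lists the gradients of the scores. -/
noncomputable def tiltBound (μ m : V) (σ : ℝ) (b : ι → V) : ℝ :=
  3 / 2 * ‖m - μ‖ ^ 2 / σ ^ 2 + gibbsDrop (Module.finrank ℝ V) (σ ^ 2 * ∑ i, ‖b i‖ ^ 2) +
    Module.finrank ℝ V / 2

theorem integrable_exp_gibbs (h : IsIsotropicGaussian prior μ σ) (hG : IsExcessLoss b G) (m : V) :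
    Integrable (fun x => Real.exp (‖x - m‖ ^ 2 / (4 * σ ^ 2))) (gibbs m σ G) := by
  rw [gibbs, integrable_tilted_iff ((hG.integrable_exp_neg_gibbsEnergy h).comp_sub_right m)]
  refine ((hG.integrable_exp_neg_gibbsEnergy_mul h
    (Real.sqrt_ne_zero'.2 zero_lt_two)).comp_sub_right m).congr (ae_of_all _ fun x => ?_)
  simp only [gibbsEnergy_sqrt_two_mul, smul_eq_mul, ← Real.exp_add, neg_sub', sub_neg_eq_add]

theorem integral_exp_gibbs_le (h : IsIsotropicGaussian prior μ σ) (hG : IsExcessLoss b G) (m : V) :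
    ∫ x, Real.exp (‖x - m‖ ^ 2 / (4 * σ ^ 2)) ∂gibbs m σ G ≤
      Real.exp (Module.finrank ℝ V / 2) := by
  have hZ := integral_exp_pos (hG.integrable_exp_neg_gibbsEnergy h)
  have hsqrt : Real.sqrt 2 ≤ Real.exp (1 / 2) := by
    rw [Real.exp_half]
    exact Real.sqrt_le_sqrt (by linarith [Real.exp_one_gt_d9])
  rw [gibbs, integral_exp_tilted, integral_exp_neg_gibbsEnergy_sub, div_le_iff₀ hZ]
  simp only [Pi.add_apply]
  calc ∫ x, Real.exp (-gibbsEnergy G σ (x - m) + ‖x - m‖ ^ 2 / (4 * σ ^ 2))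
      = ∫ x, Real.exp (-gibbsEnergy G (Real.sqrt 2 * σ) (x - m)) := by
        simp only [gibbsEnergy_sqrt_two_mul, neg_sub', sub_neg_eq_add]
    _ = ∫ u, Real.exp (-gibbsEnergy G (Real.sqrt 2 * σ) u) :=
        integral_exp_neg_gibbsEnergy_sub _ _ _
    _ ≤ Real.sqrt 2 ^ Module.finrank ℝ V * ∫ u, Real.exp (-gibbsEnergy G σ u) :=
        hG.integral_exp_neg_gibbsEnergy_mul_le h (Real.one_le_sqrt.2 one_le_two)
    _ ≤ Real.exp (1 / 2) ^ Module.finrank ℝ V * ∫ u, Real.exp (-gibbsEnergy G σ u) := by gcongr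
    _ = _ := by rw [← Real.exp_nat_mul, mul_one_div]

theorem integrable_exp_gibbsEnergy_sub (h : IsIsotropicGaussian prior μ σ)
    (hG : IsExcessLoss b G) (m : V) : Integrable
      (fun x => Real.exp (gibbsEnergy 0 σ (x - μ) - gibbsEnergy G σ (x - m))) prior := by
  rw [h.eq_gibbs, gibbs, integrable_tilted_iff (h.integrable_exp_neg.comp_sub_right μ)]
  simpa only [smul_eq_mul, ← Real.exp_add, sub_eq_add_neg, neg_add_cancel_left] using
    (hG.integrable_exp_neg_gibbsEnergy h).comp_sub_right m

theorem neg_gibbsDrop_le_log_integral (h : IsIsotropicGaussian prior μ σ)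
    (hG : IsExcessLoss b G) (m : V) :
    -gibbsDrop (Module.finrank ℝ V) (σ ^ 2 * ∑ i, ‖b i‖ ^ 2) ≤ Real.log
      (∫ x, Real.exp (gibbsEnergy 0 σ (x - μ) - gibbsEnergy G σ (x - m)) ∂prior) := by
  have hZ := integral_exp_pos (hG.integrable_exp_neg_gibbsEnergy h)
  have hZ0 := integral_exp_pos h.integrable_exp_neg
  simp only [h.integral_exp, sub_sub_cancel_left]
  rw [integral_exp_neg_gibbsEnergy_sub, Real.le_log_iff_exp_le (by positivity), le_div_iff₀ hZ0]
  exact exp_neg_gibbsDrop_mul_le h hG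

theorem posteriorControl_gibbs (h : IsIsotropicGaussian prior μ σ) (hG : IsExcessLoss b G) (m : V) :
    PosteriorControl prior (gibbs m σ G) (tiltBound μ m σ b) := by
  have := h.isProbabilityMeasure
  have hdrop := gibbsDrop_nonneg (Module.finrank ℝ V) (by positivity : 0 ≤ σ ^ 2 * ∑ i, ‖b i‖ ^ 2)
  have hlog := neg_gibbsDrop_le_log_integral h hG m
  have hs := integrable_exp_gibbs h hG m
  have hsb := integral_exp_gibbs_le h hG m
  have hmeas : Measurable fun x => gibbsEnergy 0 σ (x - μ) - gibbsEnergy G σ (x - m) := by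
    have := hG.continuous.measurable
    simp only [gibbsEnergy, Pi.zero_apply]
    fun_prop
  rw [gibbs_eq_tilted h] at hs hsb ⊢
  refine posteriorControl_tilted hmeas (integrable_exp_gibbsEnergy_sub h hG m) (by positivity)
    (by positivity) (fun x => ?_) ?_ hs hsb
  · have := hG.gibbsEnergy_sub_le μ m σ x
    linarith
  · refine hs.mono' (by fun_prop) (ae_of_all _ fun x => ?_)
    rw [Real.norm_of_nonneg (by positivity)]
    linarith [Real.add_one_le_exp (‖x - m‖ ^ 2 / (4 * σ ^ 2))]

end Gibbs

/-! ### The logistic loss -/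

section Logistic

/-- The logistic loss of a margin `x`. -/
noncomputable def logisticLoss (x : ℝ) : ℝ := Real.log (1 + Real.exp (-x))

/-- The excess of the logistic loss at `a + y` over its linearization at `a`. -/
noncomputable def logisticExcess (a y : ℝ) : ℝ :=
  logisticLoss (a + y) - logisticLoss a + Real.sigmoid (-a) * y

theorem hasDerivAt_logisticLoss (x : ℝ) : HasDerivAt logisticLoss (-Real.sigmoid (-x)) x := by
  have h := (((hasDerivAt_neg x).exp).const_add 1).log (by positivity)
  refine h.congr_deriv ?_
  rw [← Real.sigmoid_mul_rexp_neg, Real.sigmoid_def]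
  ring

theorem logisticExcess_eq (a y : ℝ) : logisticExcess a y =
    Real.log (1 - Real.sigmoid (-a) + Real.sigmoid (-a) * Real.exp (-y)) -
      Real.sigmoid (-a) * -y := by
  have hratio : 1 - Real.sigmoid (-a) + Real.sigmoid (-a) * Real.exp (-y) =
      (1 + Real.exp (-(a + y))) / (1 + Real.exp (-a)) := by
    rw [← Real.sigmoid_mul_rexp_neg, Real.sigmoid_def, neg_add, Real.exp_add]
    field_simp
    ring
  rw [hratio, Real.log_div (by positivity) (by positivity), logisticExcess, logisticLoss,
    logisticLoss]
  ring

theorem logisticExcess_nonneg (a y : ℝ) : 0 ≤ logisticExcess a y := by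
  have h := exp_mul_le_bernoulli_mgf (Real.sigmoid_nonneg (-a)) (Real.sigmoid_le_one (-a)) (-y)
  rw [logisticExcess_eq, sub_nonneg]
  exact (Real.le_log_iff_exp_le ((Real.exp_pos _).trans_le h)).2 h

theorem logisticExcess_le (a y : ℝ) : logisticExcess a y ≤ y ^ 2 / 8 := by
  have hpos := (Real.exp_pos _).trans_le
    (exp_mul_le_bernoulli_mgf (Real.sigmoid_nonneg (-a)) (Real.sigmoid_le_one (-a)) (-y))
  have h := bernoulli_mgf_le (Real.sigmoid_nonneg (-a)) (Real.sigmoid_le_one (-a)) (-y)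
  rw [neg_sq] at h
  rw [logisticExcess_eq, sub_le_iff_le_add']
  exact (Real.log_le_iff_le_exp hpos).2 h

theorem convexOn_logisticLoss : ConvexOn ℝ Set.univ logisticLoss := by
  have hderiv : deriv logisticLoss = fun x => -Real.sigmoid (-x) :=
    funext fun x => (hasDerivAt_logisticLoss x).deriv
  refine Monotone.convexOn_univ_of_deriv (fun x => (hasDerivAt_logisticLoss x).differentiableAt) ?_
  rw [hderiv]
  exact fun x y hxy => neg_le_neg (Real.sigmoid_le (neg_le_neg hxy))

theorem convexOn_logisticExcess (a : ℝ) : ConvexOn ℝ Set.univ (logisticExcess a) := by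
  refine (((convexOn_logisticLoss.translate_right a).add_const (-logisticLoss a)).add
    (LinearMap.convexOn (LinearMap.mulLeft ℝ (Real.sigmoid (-a))) convex_univ)).congr ?_
  intro y _
  simp [logisticExcess, sub_eq_add_neg]

variable {V : Type*} [NormedAddCommGroup V] [InnerProductSpace ℝ V] {ι : Type*} [Fintype ι]

theorem isExcessLoss_sum {g : ι → ℝ → ℝ} (hconv : ∀ i, ConvexOn ℝ Set.univ (g i))
    (h0 : ∀ i y, 0 ≤ g i y) (hle : ∀ i y, g i y ≤ y ^ 2 / 8) (b : ι → V) :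
    IsExcessLoss b fun u => ∑ i, g i ⟪b i, u⟫ where
  convexOn := by
    have h := Finset.sum_induction (fun i u => g i ⟪b i, u⟫) (ConvexOn ℝ Set.univ)
      (fun _ _ => ConvexOn.add) (convexOn_const 0 convex_univ)
      fun i (_ : i ∈ Finset.univ) => (hconv i).comp_linearMap (innerₗ V (b i))
    rwa [Finset.sum_fn] at h
  nonneg u := Finset.sum_nonneg fun i _ => h0 i _
  le_sq u := by
    rw [Finset.sum_div]
    exact Finset.sum_le_sum fun i _ => hle i _

/-- The negative logarithm, up to an additive constant, of a logistic likelihood with margins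
`a i + ⟪b i, x⟫` times a Gaussian prior with mean `μ` and variance `σ ^ 2`. -/
noncomputable def negLogPosterior (a : ι → ℝ) (b : ι → V) (μ : V) (σ : ℝ) (x : V) : ℝ :=
  ∑ i, logisticLoss (a i + ⟪b i, x⟫) + ‖x - μ‖ ^ 2 / (2 * σ ^ 2)

variable {a : ι → ℝ} {b : ι → V} {μ m : V} {σ : ℝ}

theorem hasDerivAt_negLogPosterior (a : ι → ℝ) (b : ι → V) (μ : V) (σ : ℝ) (m u : V) :
    HasDerivAt (fun t : ℝ => negLogPosterior a b μ σ (m + t • u))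
      (∑ i, -Real.sigmoid (-(a i + ⟪b i, m⟫)) * ⟪b i, u⟫ + ⟪m - μ, u⟫ / σ ^ 2) 0 := by
  have hline : HasDerivAt (fun t : ℝ => m + t • u) u 0 := by
    simpa using ((hasDerivAt_id (0 : ℝ)).smul_const u).const_add m
  have hloss : ∀ i, HasDerivAt (fun t : ℝ => logisticLoss (a i + ⟪b i, m + t • u⟫))
      (-Real.sigmoid (-(a i + ⟪b i, m⟫)) * ⟪b i, u⟫) 0 := fun i => by
    have hmargin := ((innerSL ℝ (b i)).hasFDerivAt.comp_hasDerivAt 0 hline).const_add (a i)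
    refine HasDerivAt.comp (h₂ := logisticLoss) 0 ?_ hmargin
    simpa using hasDerivAt_logisticLoss (a i + ⟪b i, m⟫)
  have hsq := ((hline.sub_const μ).norm_sq).div_const (2 * σ ^ 2)
  refine ((HasDerivAt.fun_sum fun i _ => hloss i).add hsq).congr_deriv ?_
  rw [zero_smul, add_zero, mul_div_mul_left _ _ two_ne_zero]

theorem sum_sigmoid_mul_inner_of_forall_le
    (hm : ∀ x, negLogPosterior a b μ σ m ≤ negLogPosterior a b μ σ x) (u : V) :
    ∑ i, Real.sigmoid (-(a i + ⟪b i, m⟫)) * ⟪b i, u⟫ = ⟪m - μ, u⟫ / σ ^ 2 := by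
  have hmin : IsLocalMin (fun t : ℝ => negLogPosterior a b μ σ (m + t • u)) 0 :=
    Eventually.of_forall fun t => by simpa using hm (m + t • u)
  have h := hmin.hasDerivAt_eq_zero (hasDerivAt_negLogPosterior a b μ σ m u)
  simp only [neg_mul, Finset.sum_neg_distrib] at h
  linarith

/-- The linear terms of the expansion around the minimizer cancel. -/
theorem negLogPosterior_eq_gibbsEnergy
    (hm : ∀ x, negLogPosterior a b μ σ m ≤ negLogPosterior a b μ σ x) (x : V) :
    negLogPosterior a b μ σ x =
      gibbsEnergy (fun u => ∑ i, logisticExcess (a i + ⟪b i, m⟫) ⟪b i, u⟫) σ (x - m) +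
        negLogPosterior a b μ σ m := by
  have hstat := sum_sigmoid_mul_inner_of_forall_le hm (x - m)
  have hmargin : ∀ i, a i + ⟪b i, m⟫ + ⟪b i, x - m⟫ = a i + ⟪b i, x⟫ := fun i => by
    rw [inner_sub_right]; ring
  have hnorm : ‖x - μ‖ ^ 2 = ‖m - μ‖ ^ 2 + 2 * ⟪m - μ, x - m⟫ + ‖x - m‖ ^ 2 := by
    rw [← norm_add_sq_real, sub_add_sub_cancel']
  simp only [gibbsEnergy, negLogPosterior, logisticExcess, hmargin, Finset.sum_add_distrib,
    Finset.sum_sub_distrib, hstat, hnorm]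
  ring

theorem tilted_add_const {E : Type*} [MeasurableSpace E] (ν : Measure E) (f : E → ℝ) (c : ℝ) :
    (ν.tilted fun x => f x + c) = ν.tilted f := by
  simp only [Measure.tilted, Real.exp_add, integral_mul_const]
  simp only [mul_div_mul_right _ _ (Real.exp_ne_zero c)]

variable [MeasureSpace V] [BorelSpace V] [(volume : Measure V).IsAddHaarMeasure]
  {prior : Measure V}

theorem tilted_logistic_eq_gibbs (h : IsIsotropicGaussian prior μ σ)
    (hm : ∀ x, negLogPosterior a b μ σ m ≤ negLogPosterior a b μ σ x) :
    (prior.tilted fun x => -∑ i, logisticLoss (a i + ⟪b i, x⟫)) =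
      gibbs m σ fun u => ∑ i, logisticExcess (a i + ⟪b i, m⟫) ⟪b i, u⟫ := by
  rw [h.eq_gibbs, gibbs, tilted_tilted (h.integrable_exp_neg.comp_sub_right μ), gibbs,
    ← tilted_add_const _ _ (negLogPosterior a b μ σ m)]
  congr 1
  funext x
  have hexpand := negLogPosterior_eq_gibbsEnergy hm x
  rw [negLogPosterior] at hexpand
  simp only [Pi.add_apply, gibbsEnergy, Pi.zero_apply] at hexpand ⊢
  linarith

theorem posteriorControl_tilted_logistic [FiniteDimensional ℝ V]
    (h : IsIsotropicGaussian prior μ σ)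
    (hm : ∀ x, negLogPosterior a b μ σ m ≤ negLogPosterior a b μ σ x) :
    PosteriorControl prior (prior.tilted fun x => -∑ i, logisticLoss (a i + ⟪b i, x⟫))
      (tiltBound μ m σ b) := by
  rw [tilted_logistic_eq_gibbs h hm]
  exact posteriorControl_gibbs h (isExcessLoss_sum (fun i => convexOn_logisticExcess _)
    (fun i => logisticExcess_nonneg _) (fun i => logisticExcess_le _) b) m

theorem posteriorControl_gibbs_sq [FiniteDimensional ℝ V] (h : IsIsotropicGaussian prior μ σ)
    {c : ι → ℝ} (hc0 : ∀ i, 0 ≤ c i) (hc : ∀ i, c i ≤ 1 / 4) (b : ι → V) (m : V) :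
    PosteriorControl prior (gibbs m σ fun u => ∑ i, c i / 2 * ⟪b i, u⟫ ^ 2)
      (tiltBound μ m σ b) := by
  refine posteriorControl_gibbs h (isExcessLoss_sum (g := fun i y => c i / 2 * y ^ 2)
    (fun i => ?_) (fun i y => ?_) (fun i y => ?_) b) m
  · exact even_two.convexOn_pow.smul (by linarith [hc0 i])
  · have := hc0 i
    positivity
  · nlinarith [hc i, sq_nonneg y]

end Logistic

/-! ### Densities of Gaussian measures -/

section GaussianDensity

theorem map_tilted {E F : Type*} [MeasurableSpace E] [MeasurableSpace F] (ν : Measure E)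
    (f : E → ℝ) (e : E ≃ᵐ F) : (ν.tilted f).map e = (ν.map e).tilted (f ∘ e.symm) := by
  ext s hs
  rw [e.map_apply, tilted_apply' _ _ (e.measurable hs), tilted_apply' _ _ hs, e.restrict_map,
    lintegral_map_equiv, integral_map_equiv]
  simp only [Function.comp_apply, e.symm_apply_apply]

theorem tilted_smul_measure {E : Type*} [MeasurableSpace E] (ν : Measure E) (f : E → ℝ)
    {c : ℝ≥0∞} (hc0 : c ≠ 0) (hc : c ≠ ⊤) : (c • ν).tilted f = ν.tilted f := by
  have hc' : 0 < c.toReal := ENNReal.toReal_pos hc0 hc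
  rw [Measure.tilted, Measure.tilted, integral_smul_measure, withDensity_smul_measure,
    ← withDensity_smul' _ _ hc]
  congr 1
  funext x
  rw [Pi.smul_apply, smul_eq_mul, smul_eq_mul, mul_comm c.toReal, ← div_div,
    ENNReal.ofReal_div_of_pos hc', ENNReal.ofReal_toReal hc, ENNReal.mul_div_cancel hc0 hc]

section StdGaussian

variable (E : Type*) [NormedAddCommGroup E] [InnerProductSpace ℝ E] [FiniteDimensional ℝ E]
  [MeasurableSpace E] [BorelSpace E]

theorem integrable_exp_neg_norm_sq_div_two :
    Integrable fun x : E => Real.exp (-(‖x‖ ^ 2 / 2)) := by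
  refine (GaussianFourier.integrable_cexp_neg_mul_sq_norm_add (V := E) (b := 1 / 2)
    (by norm_num) 0 0).norm.congr (ae_of_all _ fun x => ?_)
  simp only [Complex.norm_exp]
  congr 1
  simp [← Complex.ofReal_pow]
  ring

theorem stdGaussian_eq_tilted :
    stdGaussian E = (volume : Measure E).tilted fun x => -(‖x‖ ^ 2 / 2) := by
  have hb : 0 < (1 / 2 : ℂ).re := by norm_num
  have hint := integrable_exp_neg_norm_sq_div_two E
  have := isProbabilityMeasure_tilted hint
  have hZ := integral_exp_pos hint
  have hexp : ∀ x : E, (Real.exp (-(‖x‖ ^ 2 / 2)) : ℂ) = Complex.exp (-(1 / 2) * ‖x‖ ^ 2) :=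
    fun x => by push_cast; ring_nf
  refine Measure.ext_of_charFun (funext fun t => ?_)
  have hfourier := GaussianFourier.integral_cexp_neg_mul_sq_norm_add hb Complex.I t
  rw [← GaussianFourier.integral_cexp_neg_mul_sq_norm hb] at hfourier
  have hsq : Complex.I ^ 2 * (‖t‖ : ℂ) ^ 2 / (4 * (1 / 2)) = -(‖t‖ : ℂ) ^ 2 / 2 := by
    rw [Complex.I_sq]; ring
  simp only [Complex.exp_add, ← hexp, integral_complex_ofReal, real_inner_comm _ t,
    mul_comm Complex.I, hsq] at hfourier
  rw [charFun_stdGaussian, charFun_apply, integral_tilted]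
  simp only [Complex.real_smul, Complex.ofReal_div, div_mul_eq_mul_div]
  rw [integral_div, hfourier, mul_div_cancel_left₀ _ (by exact_mod_cast hZ.ne')]

end StdGaussian

variable {ι : Type*} [Fintype ι] [DecidableEq ι]

open scoped MatrixOrder in
theorem sqrt_inv_mul_sqrt_inv {H : Matrix ι ι ℝ} (hH : H.PosDef) :
    CFC.sqrt H⁻¹ * CFC.sqrt H⁻¹ = H⁻¹ :=
  CFC.sqrt_mul_sqrt_self _ hH.inv.posSemidef.nonneg

open scoped MatrixOrder in
theorem norm_sqrt_inv_mul_sq {H : Matrix ι ι ℝ} (hH : H.PosDef) (u : EuclideanSpace ℝ ι) :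
    ‖Matrix.toEuclideanCLM (𝕜 := ℝ) (CFC.sqrt H⁻¹ * H) u‖ ^ 2 =
      ⟪u, Matrix.toEuclideanCLM (𝕜 := ℝ) H u⟫ := by
  have hstar : star (CFC.sqrt H⁻¹ * H) * (CFC.sqrt H⁻¹ * H) = H := by
    rw [star_mul, (CFC.sqrt_nonneg H⁻¹).isSelfAdjoint.star_eq,
      show star H = H from hH.isHermitian, mul_assoc, ← mul_assoc (CFC.sqrt H⁻¹),
      sqrt_inv_mul_sqrt_inv hH, Matrix.nonsing_inv_mul _ (isUnit_iff_ne_zero.2 hH.det_pos.ne'),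
      mul_one]
  rw [← real_inner_self_eq_norm_sq, ← ContinuousLinearMap.adjoint_inner_right,
    ← ContinuousLinearMap.star_eq_adjoint, ← map_star, ← mul_apply_eq_comp, ← map_mul,
    hstar]

open scoped MatrixOrder in
theorem multivariateGaussian_inv_eq_tilted (m : EuclideanSpace ℝ ι) {H : Matrix ι ι ℝ}
    (hH : H.PosDef) : multivariateGaussian m H⁻¹ = volume.tilted fun x =>
      -(⟪x - m, Matrix.toEuclideanCLM (𝕜 := ℝ) H (x - m)⟫ / 2) := by
  set A := CFC.sqrt H⁻¹
  have hAH : A * (A * H) = 1 := by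
    rw [← mul_assoc, sqrt_inv_mul_sqrt_inv hH,
      Matrix.nonsing_inv_mul _ (isUnit_iff_ne_zero.2 hH.det_pos.ne')]
  let φ := Matrix.toEuclideanCLM (n := ι) (𝕜 := ℝ)
  let T : EuclideanSpace ℝ ι ≃L[ℝ] EuclideanSpace ℝ ι :=
    ContinuousLinearEquiv.equivOfInverse' (φ A) (φ (A * H))
      (by rw [← ContinuousLinearMap.mul_def, ← map_mul, hAH, map_one]; rfl)
      (by rw [← ContinuousLinearMap.mul_def, ← map_mul, mul_eq_one_comm.1 hAH, map_one]; rfl)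
  let e := (T.toHomeomorph.trans (Homeomorph.addLeft m)).toMeasurableEquiv
  have := T.isAddHaarMeasure_map volume
  have hmap : volume.map e = volume.map T := by
    rw [← map_add_left_eq_self (volume.map T) m, Measure.map_map (by fun_prop) (by fun_prop)]
    rfl
  have hsmul : volume.map T = (Measure.addHaarScalarFactor (volume.map T) volume : ℝ≥0∞) • volume :=
    Measure.isAddLeftInvariant_eq_smul _ _
  change (stdGaussian (EuclideanSpace ℝ ι)).map e = _
  rw [stdGaussian_eq_tilted, map_tilted, hmap, hsmul, tilted_smul_measure _ _
    (by exact_mod_cast (Measure.addHaarScalarFactor_pos_of_isAddHaarMeasure _ _).ne')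
    ENNReal.coe_ne_top]
  congr 1
  funext x
  rw [← norm_sqrt_inv_mul_sq hH, ← neg_add_eq_sub]
  rfl

theorem gaussianReal_eq_tilted (m : ℝ) {v : NNReal} (hv : v ≠ 0) :
    gaussianReal m v = volume.tilted fun x => -((x - m) ^ 2 / (2 * v)) := by
  have hone := integral_gaussianPDFReal_eq_one m hv
  simp only [gaussianPDFReal, integral_const_mul, neg_div] at hone
  rw [gaussianReal_of_var_ne_zero _ hv, Measure.tilted]
  congr 1
  funext x
  rw [gaussianPDF, gaussianPDFReal, neg_div, eq_inv_of_mul_eq_one_left hone, inv_mul_eq_div]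

end GaussianDensity

/-! ### The Gaussian priors and their posteriors -/

theorem posDef_smul_one (d : ℕ) {v : ℝ} (hv : 0 < v) :
    (v • (1 : Matrix (Fin d) (Fin d) ℝ)).PosDef :=
  Matrix.PosDef.one.smul hv

instance isGaussian_isoGaussian {d : ℕ} (m : Feature d) (v : ℝ) : IsGaussian (isoGaussian m v) := by
  unfold isoGaussian; infer_instance

theorem isoGaussian_eq_gibbs {d : ℕ} (m : Feature d) {σ : ℝ} (hσ : 0 < σ) :
    isoGaussian m (σ ^ 2) = gibbs m σ 0 := by
  have hinv : σ ^ 2 • (1 : Matrix (Fin d) (Fin d) ℝ) = ((σ ^ 2)⁻¹ • 1)⁻¹ :=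
    (Matrix.inv_eq_left_inv (by
      rw [smul_mul_smul_comm, mul_one, mul_inv_cancel₀ (by positivity), one_smul])).symm
  rw [isoGaussian, hinv, multivariateGaussian_inv_eq_tilted m (posDef_smul_one d (by positivity)),
    gibbs]
  congr 1
  funext x
  rw [map_smul, map_one, gibbsEnergy, smul_apply, one_apply_eq_self, real_inner_smul_right,
    real_inner_self_eq_norm_sq, Pi.zero_apply]
  field_simp
  ring

theorem integrable_inner_sub_sq {V : Type*} [NormedAddCommGroup V] [InnerProductSpace ℝ V]
    [CompleteSpace V] [SecondCountableTopology V] [MeasurableSpace V] [BorelSpace V]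
    (ν : Measure V) [IsGaussian ν] (b m : V) : Integrable (fun x => ⟪b, x - m⟫ ^ 2) ν := by
  have hsub : MemLp (fun x : V => x - m) 2 ν := IsGaussian.memLp_two_id.sub (memLp_const m)
  exact (hsub.const_inner b).integrable_sq

theorem integral_inner_sub_sq {d : ℕ} (m : Feature d) {v : ℝ} (hv : 0 ≤ v) (b : Feature d) :
    ∫ x, ⟪b, x - m⟫ ^ 2 ∂isoGaussian m v = v * ‖b‖ ^ 2 := by
  have hcov := covarianceBilin_multivariateGaussian (μ := m) (Matrix.PosSemidef.one.smul hv) b b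
  rw [covarianceBilin_apply IsGaussian.memLp_two_id, integral_id_multivariateGaussian',
    ← Matrix.inner_toEuclideanCLM, map_smul, map_one, smul_apply, one_apply_eq_self,
    real_inner_smul_right, real_inner_self_eq_norm_sq] at hcov
  simpa only [isoGaussian, sq] using hcov

theorem isIsotropicGaussian_symPrior (d : ℕ) {σβ : ℝ} (hσ : 0 < σβ) :
    IsIsotropicGaussian (symPrior d σβ) 0 σβ where
  isProbabilityMeasure := by unfold symPrior; infer_instance
  eq_gibbs := isoGaussian_eq_gibbs 0 hσ
  integrable_sq b := integrable_inner_sub_sq (isoGaussian 0 (σβ ^ 2)) b 0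
  integral_sq b := integral_inner_sub_sq 0 (by positivity) b

theorem isIsotropicGaussian_asymPrior (μR : ℝ) {σR : ℝ} (hσ : 0 < σR) :
    IsIsotropicGaussian (asymPrior μR σR) μR σR where
  isProbabilityMeasure := by unfold asymPrior; infer_instance
  eq_gibbs := by
    rw [asymPrior, gaussianReal_eq_tilted μR (by simpa using hσ.ne'), gibbs]
    simp only [gibbsEnergy, Pi.zero_apply, zero_add, Real.norm_eq_abs, sq_abs,
      Real.coe_toNNReal _ (sq_nonneg σR)]
  integrable_sq b := integrable_inner_sub_sq (gaussianReal μR (σR ^ 2).toNNReal) b μR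
  integral_sq b := by
    have hvar := variance_id_gaussianReal (μ := μR) (v := (σR ^ 2).toNNReal)
    rw [variance_eq_integral aemeasurable_id] at hvar
    simp only [id, integral_id_gaussianReal, Real.coe_toNNReal _ (sq_nonneg σR)] at hvar
    simp only [RCLike.inner_apply, conj_trivial, mul_pow]
    rw [integral_mul_const, asymPrior, hvar, Real.norm_eq_abs, sq_abs]

theorem signedLabel_sq (y : Bool) : signedLabel y ^ 2 = 1 := by
  cases y <;> simp [signedLabel]

section Posterior

variable {d N : ℕ}

theorem logisticCurv_nonneg {Θ : Type} (f : Θ → Feature d → ℝ) (θ : Θ) (x : Example d) :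
    0 ≤ logisticCurv f θ x :=
  mul_nonneg (Real.sigmoid_nonneg _) (sub_nonneg.2 (Real.sigmoid_le_one _))

theorem logisticCurv_le {Θ : Type} (f : Θ → Feature d → ℝ) (θ : Θ) (x : Example d) :
    logisticCurv f θ x ≤ 1 / 4 := by
  unfold logisticCurv
  nlinarith [sq_nonneg (Real.sigmoid (signedLabel x.2 * f θ x.1) - 1 / 2)]

/-- The signed embeddings `ỹᵢ zᵢ`, which are the gradients of the margins in the linear model. -/
noncomputable def signedFeature (S : Fin N → Example d) (i : Fin N) : Feature d :=
  signedLabel (S i).2 • (S i).1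

theorem norm_signedFeature_sq (S : Fin N → Example d) (i : Fin N) :
    ‖signedFeature S i‖ ^ 2 = ‖(S i).1‖ ^ 2 := by
  rw [signedFeature, norm_smul, mul_pow, Real.norm_eq_abs, sq_abs, signedLabel_sq, one_mul]

section Linear

variable {σβ : ℝ}

theorem logisticNLL_linearScore (S : Fin N → Example d) (β : Feature d) :
    logisticNLL linearScore S β = ∑ i, logisticLoss (0 + ⟪signedFeature S i, β⟫) := by
  simp only [logisticNLL, linearScore, logisticLoss, signedFeature, real_inner_comm β,
    real_inner_smul_right, zero_add]

theorem symObjective_eq_negLogPosterior (S : Fin N → Example d) (β : Feature d) :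
    symObjective σβ S β = negLogPosterior (fun _ => 0) (signedFeature S) 0 σβ β := by
  rw [symObjective, logisticNLL_linearScore, negLogPosterior, sub_zero]

theorem posteriorControl_bayesPosterior_symPrior (hσ : 0 < σβ) (S : Fin N → Example d) :
    PosteriorControl (symPrior d σβ) (bayesPosterior (symPrior d σβ) linearScore S)
      (tiltBound 0 (symMAP σβ S) σβ (signedFeature S)) := by
  simp only [bayesPosterior, logisticNLL_linearScore]
  refine posteriorControl_tilted_logistic (isIsotropicGaussian_symPrior d hσ) fun β => ?_
  simpa only [symObjective_eq_negLogPosterior] using symMAP_le hσ S β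

theorem inner_symHessian (S : Fin N → Example d) (u : Feature d) :
    ⟪u, Matrix.toEuclideanCLM (𝕜 := ℝ) (symHessian σβ S) u⟫ =
      ∑ i, logisticCurv linearScore (symMAP σβ S) (S i) * ⟪signedFeature S i, u⟫ ^ 2 +
        ‖u‖ ^ 2 / σβ ^ 2 := by
  have hrank_one : ∀ z : Feature d, ⟪u, Matrix.toEuclideanCLM (𝕜 := ℝ)
      (Matrix.vecMulVec (fun j => z j) fun j => z j) u⟫ = ⟪z, u⟫ ^ 2 := fun z => by
    rw [Matrix.inner_toEuclideanCLM, Matrix.vecMulVec_mulVec,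
      EuclideanSpace.inner_eq_star_dotProduct, star_trivial, dotProduct_smul,
      dotProduct_comm (fun j => z j), MulOpposite.smul_eq_mul_unop, MulOpposite.unop_op, sq]
  simp only [symHessian, map_add, map_sum, map_smul, map_one, add_apply, sum_apply, smul_apply,
    one_apply_eq_self, inner_add_right, inner_sum, real_inner_smul_right,
    real_inner_self_eq_norm_sq, hrank_one, signedFeature, real_inner_smul_left, mul_pow,
    signedLabel_sq, one_mul, one_div_mul_eq_div]

theorem posDef_symHessian (hσ : 0 < σβ) (S : Fin N → Example d) : (symHessian σβ S).PosDef := by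
  refine Matrix.PosDef.posSemidef_add ?_ (posDef_smul_one d (by positivity))
  refine Matrix.posSemidef_sum _ fun i _ => Matrix.PosSemidef.smul ?_ (logisticCurv_nonneg _ _ _)
  simpa only [star_trivial] using Matrix.posSemidef_vecMulVec_self_star (fun j => (S i).1 j)

theorem symLaplace_eq_gibbs (hσ : 0 < σβ) (S : Fin N → Example d) :
    symLaplace σβ S = gibbs (symMAP σβ S) σβ fun u =>
      ∑ i, logisticCurv linearScore (symMAP σβ S) (S i) / 2 * ⟪signedFeature S i, u⟫ ^ 2 := by
  rw [symLaplace, multivariateGaussian_inv_eq_tilted _ (posDef_symHessian hσ S), gibbs]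
  simp only [inner_symHessian, gibbsEnergy, add_div, Finset.sum_div, div_mul_eq_mul_div, div_div,
    mul_comm (σβ ^ 2)]

theorem posteriorControl_sym (hσ : 0 < σβ) {post : (Fin N → Example d) → Measure (Feature d)}
    (hpost : post ∈ ({bayesPosterior (symPrior d σβ) linearScore, symLaplace σβ} :
      Set ((Fin N → Example d) → Measure (Feature d)))) (S : Fin N → Example d) :
    PosteriorControl (symPrior d σβ) (post S)
      (tiltBound 0 (symMAP σβ S) σβ (signedFeature S)) := by
  rcases hpost with rfl | rfl
  · exact posteriorControl_bayesPosterior_symPrior hσ S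
  · rw [symLaplace_eq_gibbs hσ]
    exact posteriorControl_gibbs_sq (isIsotropicGaussian_symPrior d hσ)
      (fun _ => logisticCurv_nonneg _ _ _) (fun _ => logisticCurv_le _ _ _) _ _

end Linear

section Radial

variable {σR : ℝ}

theorem logisticNLL_radialScore (q : ℕ) (S : Fin N → Example d) (R : ℝ) :
    logisticNLL (radialScore q) S R =
      ∑ i, logisticLoss (signedLabel (S i).2 * ‖(S i).1‖ ^ q + ⟪-signedLabel (S i).2, R⟫) := by
  refine Finset.sum_congr rfl fun i _ => ?_
  rw [logisticLoss, radialScore, RCLike.inner_apply, conj_trivial]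
  ring_nf

theorem asymObjective_eq_negLogPosterior (q : ℕ) (μR : ℝ) (S : Fin N → Example d) (R : ℝ) :
    asymObjective q μR σR S R = negLogPosterior
      (fun i => signedLabel (S i).2 * ‖(S i).1‖ ^ q) (fun i => -signedLabel (S i).2) μR σR R := by
  rw [asymObjective, logisticNLL_radialScore, negLogPosterior, Real.norm_eq_abs, sq_abs]

theorem posteriorControl_bayesPosterior_asymPrior (q : ℕ) (μR : ℝ) (hσ : 0 < σR)
    (S : Fin N → Example d) :
    PosteriorControl (asymPrior μR σR) (bayesPosterior (asymPrior μR σR) (radialScore q) S)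
      (tiltBound μR (asymMAP q μR σR S) σR fun i => -signedLabel (S i).2) := by
  simp only [bayesPosterior, logisticNLL_radialScore]
  refine posteriorControl_tilted_logistic (isIsotropicGaussian_asymPrior μR hσ) fun R => ?_
  simpa only [asymObjective_eq_negLogPosterior] using asymMAP_le q μR hσ S R

theorem asymHessian_pos (q : ℕ) (μR : ℝ) (hσ : 0 < σR) (S : Fin N → Example d) :
    0 < asymHessian q μR σR S :=
  add_pos_of_nonneg_of_pos (Finset.sum_nonneg fun _ _ => logisticCurv_nonneg _ _ _)
    (by positivity)

theorem asymLaplace_eq_gibbs (q : ℕ) (μR : ℝ) (hσ : 0 < σR) (S : Fin N → Example d) :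
    asymLaplace q μR σR S = gibbs (asymMAP q μR σR S) σR fun u =>
      ∑ i, logisticCurv (radialScore q) (asymMAP q μR σR S) (S i) / 2 *
        ⟪-signedLabel (S i).2, u⟫ ^ 2 := by
  have hH := asymHessian_pos q μR hσ S
  rw [asymLaplace, gaussianReal_eq_tilted _ (by simpa using hH), gibbs]
  congr 1
  funext R
  simp only [Real.coe_toNNReal _ (inv_pos.2 hH).le, gibbsEnergy, RCLike.inner_apply, conj_trivial,
    mul_pow, neg_sq, signedLabel_sq, mul_one, ← Finset.sum_mul, ← Finset.sum_div, Real.norm_eq_abs,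
    sq_abs]
  unfold asymHessian
  field_simp

theorem posteriorControl_asym (q : ℕ) (μR : ℝ) (hσ : 0 < σR)
    {post : (Fin N → Example d) → Measure ℝ}
    (hpost : post ∈ ({bayesPosterior (asymPrior μR σR) (radialScore q), asymLaplace q μR σR} :
      Set ((Fin N → Example d) → Measure ℝ))) (S : Fin N → Example d) :
    PosteriorControl (asymPrior μR σR) (post S)
      (tiltBound μR (asymMAP q μR σR S) σR fun i => -signedLabel (S i).2) := by
  rcases hpost with rfl | rfl
  · exact posteriorControl_bayesPosterior_asymPrior q μR hσ S
  · rw [asymLaplace_eq_gibbs q μR hσ]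
    exact posteriorControl_gibbs_sq (isIsotropicGaussian_asymPrior μR hσ)
      (fun _ => logisticCurv_nonneg _ _ _) (fun _ => logisticCurv_le _ _ _) _ _

end Radial

end Posterior

/-! ### The data distribution -/

section DataLaw

variable {d K : ℕ} {p₀ σ₀ ε : ℝ} {w : Fin K → ℝ} {μ : Fin K → Feature d}

theorem lintegral_dataLaw (p₀ σ₀ ε : ℝ) (w : Fin K → ℝ) (μ : Fin K → Feature d)
    {g : Example d → ℝ≥0∞} (hg : Measurable g) :
    ∫⁻ x, g x ∂(dataLaw p₀ σ₀ ε w μ) =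
      ENNReal.ofReal p₀ * ∫⁻ z, g (z, false) ∂(isoGaussian (0 : Feature d) (σ₀ ^ 2)) +
      ENNReal.ofReal (1 - p₀) *
        ∑ k, ENNReal.ofReal (w k) * ∫⁻ z, g (z, true) ∂(isoGaussian (μ k) (σ₀ ^ 2 + ε)) := by
  have : IsFiniteMeasure (∑ k, ENNReal.ofReal (w k) • isoGaussian (μ k) (σ₀ ^ 2 + ε)) := ⟨by
    simp [Measure.finsetSum_apply]⟩
  rw [dataLaw, lintegral_add_measure, lintegral_smul_measure, lintegral_smul_measure,
    Measure.prod_dirac, Measure.prod_dirac, lintegral_map hg measurable_prodMk_right,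
    lintegral_map hg measurable_prodMk_right, lintegral_finsetSum_measure]
  simp only [lintegral_smul_measure, smul_eq_mul]

theorem ofReal_mul_add_ofReal_mul_sum (hp0 : 0 ≤ p₀) (hp1 : p₀ ≤ 1) (hw : ∀ k, 0 ≤ w k)
    (hw1 : ∑ k, w k = 1) (a : ℝ≥0∞) :
    ENNReal.ofReal p₀ * a + ENNReal.ofReal (1 - p₀) * ∑ k, ENNReal.ofReal (w k) * a = a := by
  rw [← Finset.sum_mul, ← ENNReal.ofReal_sum_of_nonneg fun k _ => hw k, hw1, ENNReal.ofReal_one,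
    one_mul, ← add_mul, ← ENNReal.ofReal_add hp0 (sub_nonneg.2 hp1), add_sub_cancel,
    ENNReal.ofReal_one, one_mul]

theorem isProbabilityMeasure_dataLaw (σ₀ ε : ℝ) (μ : Fin K → Feature d) (hp0 : 0 ≤ p₀)
    (hp1 : p₀ ≤ 1) (hw : ∀ k, 0 ≤ w k) (hw1 : ∑ k, w k = 1) :
    IsProbabilityMeasure (dataLaw p₀ σ₀ ε w μ) := ⟨by
  rw [← lintegral_one, lintegral_dataLaw _ _ _ _ _ measurable_const]
  simpa only [lintegral_one, measure_univ] using ofReal_mul_add_ofReal_mul_sum hp0 hp1 hw hw1 1⟩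

theorem integrable_norm_sub_sq (m : Feature d) (v : ℝ) :
    Integrable (fun x => ‖x - m‖ ^ 2) (isoGaussian m v) :=
  (IsGaussian.memLp_two_id.sub (memLp_const m)).integrable_norm_pow two_ne_zero

theorem integral_norm_sub_sq (m : Feature d) {v : ℝ} (hv : 0 ≤ v) :
    ∫ x, ‖x - m‖ ^ 2 ∂isoGaussian m v = d * v := by
  let e := EuclideanSpace.basisFun (Fin d) ℝ
  calc ∫ x, ‖x - m‖ ^ 2 ∂isoGaussian m v = ∫ x, ∑ j, ⟪e j, x - m⟫ ^ 2 ∂isoGaussian m v := by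
        simp only [e.sum_sq_inner_right]
    _ = ∑ j, v * ‖e j‖ ^ 2 := by
        rw [integral_finsetSum _ fun j _ => integrable_inner_sub_sq _ (e j) m]
        simp only [integral_inner_sub_sq m hv]
    _ = d * v := by simp [e]

theorem lintegral_norm_sq_isoGaussian_le (m : Feature d) {v : ℝ} (hv : 0 ≤ v) :
    ∫⁻ x, ENNReal.ofReal (‖x‖ ^ 2) ∂(isoGaussian m v) ≤
      ENNReal.ofReal (2 * (d * v + ‖m‖ ^ 2)) := by
  have hle : ∀ x : Feature d, ‖x‖ ^ 2 ≤ 2 * (‖x - m‖ ^ 2 + ‖m‖ ^ 2) := fun x => by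
    have htri : ‖x‖ ≤ ‖x - m‖ + ‖m‖ := by simpa using norm_add_le (x - m) m
    exact (pow_le_pow_left₀ (norm_nonneg _) htri 2).trans add_sq_le
  have hint : Integrable (fun x => 2 * (‖x - m‖ ^ 2 + ‖m‖ ^ 2)) (isoGaussian m v) :=
    ((integrable_norm_sub_sq m v).add (integrable_const _)).const_mul 2
  refine (lintegral_mono fun x => ENNReal.ofReal_le_ofReal (hle x)).trans_eq ?_
  rw [← ofReal_integral_eq_lintegral_ofReal hint (ae_of_all _ fun x => by positivity),
    integral_const_mul, integral_add (integrable_norm_sub_sq m v) (integrable_const _),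
    integral_norm_sub_sq m hv, integral_const, probReal_univ, one_smul]

theorem lintegral_norm_sq_dataLaw_le {M : ℝ} (hp0 : 0 ≤ p₀) (hp1 : p₀ ≤ 1) (hε : 0 ≤ ε)
    (hw : ∀ k, 0 ≤ w k) (hw1 : ∑ k, w k = 1) (hμ : ∀ k, ‖μ k‖ ≤ M * Real.sqrt d) :
    ∫⁻ x, ENNReal.ofReal (‖x.1‖ ^ 2) ∂(dataLaw p₀ σ₀ ε w μ) ≤
      ENNReal.ofReal (2 * (σ₀ ^ 2 + ε + M ^ 2) * d) := by
  have hlive : ∫⁻ z, ENNReal.ofReal (‖z‖ ^ 2) ∂(isoGaussian (0 : Feature d) (σ₀ ^ 2)) ≤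
      ENNReal.ofReal (2 * (σ₀ ^ 2 + ε + M ^ 2) * d) := by
    refine (lintegral_norm_sq_isoGaussian_le 0 (sq_nonneg σ₀)).trans (ENNReal.ofReal_le_ofReal ?_)
    have : 0 ≤ d * (ε + M ^ 2) := by positivity
    rw [norm_zero]
    linarith
  have hspoof : ∀ k, ∫⁻ z, ENNReal.ofReal (‖z‖ ^ 2) ∂(isoGaussian (μ k) (σ₀ ^ 2 + ε)) ≤
      ENNReal.ofReal (2 * (σ₀ ^ 2 + ε + M ^ 2) * d) := fun k => by
    refine (lintegral_norm_sq_isoGaussian_le (μ k) (by positivity)).trans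
      (ENNReal.ofReal_le_ofReal ?_)
    have hk := pow_le_pow_left₀ (norm_nonneg _) (hμ k) 2
    rw [mul_pow, Real.sq_sqrt (Nat.cast_nonneg d)] at hk
    linarith
  rw [lintegral_dataLaw _ _ _ _ _ (by fun_prop),
    ← ofReal_mul_add_ofReal_mul_sum hp0 hp1 hw hw1 (ENNReal.ofReal (2 * _ * d))]
  gcongr with k
  exact hspoof k

theorem map_inner_isoGaussian (σ : ℝ) (u : Feature d) :
    (isoGaussian (0 : Feature d) (σ ^ 2)).map (fun z => ⟪u, z⟫) =
      (gaussianReal 0 1).map ((σ * ‖u‖) * ·) := by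
  have hmean : ∫ x, innerSL ℝ u x ∂(isoGaussian (0 : Feature d) (σ ^ 2)) = 0 := by
    rw [ContinuousLinearMap.integral_comp_comm _ IsGaussian.integrable_fun_id, isoGaussian,
      integral_id_multivariateGaussian, map_zero]
  have hvar : Var[innerSL ℝ u; isoGaussian (0 : Feature d) (σ ^ 2)] = (σ * ‖u‖) ^ 2 := by
    rw [variance_eq_integral (by fun_prop), hmean, mul_pow,
      ← integral_inner_sub_sq 0 (sq_nonneg σ) u]
    simp only [innerSL_apply_apply, sub_zero]
  have hmap := IsGaussian.map_eq_gaussianReal (μ := isoGaussian (0 : Feature d) (σ ^ 2))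
    (innerSL ℝ u)
  rw [hmean, hvar] at hmap
  rw [gaussianReal_map_const_mul, mul_zero, mul_one]
  refine hmap.trans ?_
  congr 1
  exact Real.toNNReal_of_nonneg (sq_nonneg _)

end DataLaw

/-- The live examples with a margin larger than `τ` in direction `v`. -/
def liveMargin {d : ℕ} (τ : ℝ) (v : Feature d) : Set (Example d) :=
  {x | x.2 = false ∧ τ < ⟪v, x.1⟫}

theorem measurableSet_liveMargin {d : ℕ} (τ : ℝ) (v : Feature d) :
    MeasurableSet (liveMargin τ v) :=
  (measurable_snd (measurableSet_singleton false)).inter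
    (measurableSet_lt (f := fun _ => τ) (g := fun x : Example d => ⟪v, x.1⟫) measurable_const
      (by fun_prop))

/-- The two properties of the data distribution that keep the MAP hyperplane bounded: the second
moment grows at most like `c * d`, and in every direction at least a fraction `p` of the data
consists of live examples on the far side of the hyperplane at height `τ`. -/
structure IsSpread {d : ℕ} (D : Measure (Example d)) (c τ p : ℝ) : Prop where
  lintegral_norm_sq_le : ∫⁻ x, ENNReal.ofReal (‖x.1‖ ^ 2) ∂D ≤ ENNReal.ofReal (c * d)
  le_liveMargin : ∀ v : Feature d, 1 / 2 ≤ ‖v‖ → ENNReal.ofReal p ≤ D (liveMargin τ v)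

theorem gaussianReal_Ioi_one_pos : 0 < (gaussianReal 0 1).real (Set.Ioi 1) := by
  refine ENNReal.toReal_pos (fun h => ?_) (measure_ne_top _ _)
  have := gaussianReal_absolutelyContinuous' 0 (one_ne_zero (α := NNReal)) h
  simp at this

theorem gaussianReal_Ioi_one_le_isoGaussian {d : ℕ} {σ : ℝ} (hσ : 0 < σ) {v : Feature d}
    (hv : 1 / 2 ≤ ‖v‖) :
    gaussianReal 0 1 (Set.Ioi 1) ≤ isoGaussian 0 (σ ^ 2) {z : Feature d | σ / 2 < ⟪v, z⟫} := by
  have hinner : Measurable fun z : Feature d => ⟪v, z⟫ := by fun_prop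
  change _ ≤ isoGaussian 0 (σ ^ 2) ((fun z : Feature d => ⟪v, z⟫) ⁻¹' Set.Ioi (σ / 2))
  rw [← Measure.map_apply hinner measurableSet_Ioi, map_inner_isoGaussian,
    Measure.map_apply (measurable_const_mul _) measurableSet_Ioi]
  refine measure_mono fun x (hx : 1 < x) => ?_
  calc σ / 2 = σ * (1 / 2) * 1 := by ring
    _ < σ * (1 / 2) * x := by gcongr
    _ ≤ σ * ‖v‖ * x := by gcongr

theorem isSpread_dataLaw {d K : ℕ} {p₀ σ₀ ε M : ℝ} {w : Fin K → ℝ} {μ : Fin K → Feature d}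
    (hp0 : 0 ≤ p₀) (hp1 : p₀ ≤ 1) (hσ₀ : 0 < σ₀) (hε : 0 ≤ ε) (hw : ∀ k, 0 ≤ w k)
    (hw1 : ∑ k, w k = 1) (hμ : ∀ k, ‖μ k‖ ≤ M * Real.sqrt d) :
    IsSpread (dataLaw p₀ σ₀ ε w μ) (2 * (σ₀ ^ 2 + ε + M ^ 2)) (σ₀ / 2)
      (p₀ * (gaussianReal 0 1).real (Set.Ioi 1)) where
  lintegral_norm_sq_le := lintegral_norm_sq_dataLaw_le hp0 hp1 hε hw hw1 hμ
  le_liveMargin v hv := by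
    have hslice : (fun z => (z, false)) ⁻¹' liveMargin (σ₀ / 2) v = {z | σ₀ / 2 < ⟪v, z⟫} := by
      ext z
      simp [liveMargin]
    rw [ENNReal.ofReal_mul hp0, ofReal_measureReal, dataLaw, Measure.add_apply,
      Measure.smul_apply, Measure.prod_dirac,
      Measure.map_apply measurable_prodMk_right (measurableSet_liveMargin _ v), hslice]
    exact le_add_right (mul_le_mul_right (gaussianReal_Ioi_one_le_isoGaussian hσ₀ hv) _)

/-! ### A grid net of the unit ball -/

theorem exists_grid_abs_sub_le {k : ℕ} (hk : 0 < k) {x : ℝ} (hx : |x| ≤ 1) :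
    ∃ s : Fin (2 * k + 1), |x - ((s : ℝ) - k) / k| ≤ 1 / k := by
  have hk' : (0 : ℝ) < k := by exact_mod_cast hk
  obtain ⟨hx0, hx1⟩ := abs_le.1 hx
  have hnonneg : 0 ≤ k * (x + 1) := mul_nonneg hk'.le (by linarith)
  have hlt : ⌊k * (x + 1)⌋₊ < 2 * k + 1 := by
    rw [Nat.floor_lt hnonneg]
    push_cast
    nlinarith
  have hround : x - ((⌊k * (x + 1)⌋₊ : ℝ) - k) / k = (k * (x + 1) - ⌊k * (x + 1)⌋₊) / k := by
    field_simp
    ring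
  refine ⟨⟨⌊k * (x + 1)⌋₊, hlt⟩, ?_⟩
  rw [hround, abs_of_nonneg (div_nonneg (sub_nonneg.2 (Nat.floor_le hnonneg)) hk'.le)]
  gcongr
  linarith [Nat.lt_floor_add_one (k * (x + 1))]

theorem exists_net (d : ℕ) {k : ℕ} (hk : 0 < k) :
    ∃ T : Finset (Feature d), T.card ≤ (2 * k + 1) ^ d ∧
      ∀ u : Feature d, ‖u‖ ≤ 1 → ∃ v ∈ T, ‖u - v‖ ≤ Real.sqrt d / k := by
  classical
  let F (s : Fin d → Fin (2 * k + 1)) : Feature d := WithLp.toLp 2 fun j => ((s j : ℝ) - k) / k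
  refine ⟨Finset.univ.image F, Finset.card_image_le.trans (by simp), fun u hu => ?_⟩
  choose s hs using fun j => exists_grid_abs_sub_le hk ((PiLp.norm_apply_le u j).trans hu)
  refine ⟨F s, Finset.mem_image_of_mem _ (Finset.mem_univ _), ?_⟩
  rw [EuclideanSpace.norm_eq, Real.sqrt_le_left (by positivity), div_pow,
    Real.sq_sqrt (Nat.cast_nonneg d)]
  calc ∑ j, ‖(u - F s) j‖ ^ 2 ≤ ∑ _j : Fin d, (1 / (k : ℝ)) ^ 2 :=
        Finset.sum_le_sum fun j _ => pow_le_pow_left₀ (norm_nonneg _) (hs j) 2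
    _ = d / k ^ 2 := by simp [div_eq_mul_inv]

/-! ### The size of the MAP hyperplane -/

theorem logisticLoss_nonneg (x : ℝ) : 0 ≤ logisticLoss x :=
  Real.log_nonneg (le_add_of_nonneg_right (Real.exp_pos _).le)

theorem neg_le_logisticLoss (x : ℝ) : -x ≤ logisticLoss x :=
  (Real.le_log_iff_exp_le (by positivity)).2 (le_add_of_nonneg_left zero_le_one)

section MAP

variable {d N : ℕ} {σβ : ℝ}

theorem logisticNLL_symMAP_add_le (hσ : 0 < σβ) (S : Fin N → Example d) :
    logisticNLL linearScore S (symMAP σβ S) + ‖symMAP σβ S‖ ^ 2 / (2 * σβ ^ 2) ≤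
      N * Real.log 2 := by
  have hzero : symObjective σβ S 0 = N * Real.log 2 := by
    norm_num [symObjective, logisticNLL, linearScore]
  exact (symMAP_le hσ S 0).trans_eq hzero

theorem norm_symMAP_sq_le (hσ : 0 < σβ) (S : Fin N → Example d) :
    ‖symMAP σβ S‖ ^ 2 ≤ N * Real.log 2 * (2 * σβ ^ 2) := by
  rw [← div_le_iff₀ (by positivity)]
  linarith [logisticNLL_symMAP_add_le hσ S,
    logisticNLL_nonneg linearScore S (symMAP σβ S)]

theorem mul_sub_le_logisticLoss {t ρ τ : ℝ} {u v : Feature d} (ht : 0 ≤ t) (huv : ‖u - v‖ ≤ ρ)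
    (x : Example d) :
    t * (τ * (liveMargin τ v).indicator (fun _ => 1) x - ρ * ‖x.1‖) ≤
      logisticLoss (signedLabel x.2 * ⟪t • u, x.1⟫) := by
  have hρ : 0 ≤ ρ := (norm_nonneg _).trans huv
  by_cases hx : x ∈ liveMargin τ v
  · have hdiff : -(ρ * ‖x.1‖) ≤ ⟪u - v, x.1⟫ :=
      neg_le_of_abs_le ((abs_real_inner_le_norm _ _).trans (by gcongr))
    rw [inner_sub_left] at hdiff
    have hmargin : signedLabel x.2 * ⟪t • u, x.1⟫ = -(t * ⟪u, x.1⟫) := by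
      simp [hx.1, signedLabel, real_inner_smul_left]
    calc t * (τ * (liveMargin τ v).indicator (fun _ => 1) x - ρ * ‖x.1‖) ≤ t * ⟪u, x.1⟫ := by
          rw [Set.indicator_of_mem hx]
          gcongr
          linarith [hx.2]
      _ ≤ logisticLoss (signedLabel x.2 * ⟪t • u, x.1⟫) := by
          simpa only [hmargin, neg_neg] using neg_le_logisticLoss (-(t * ⟪u, x.1⟫))
  · rw [Set.indicator_of_notMem hx, mul_zero, zero_sub]
    exact (mul_nonpos_of_nonneg_of_nonpos ht (neg_nonpos.2 (by positivity))).trans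
      (logisticLoss_nonneg _)

theorem mul_empFreq_sub_le_logisticNLL {t ρ τ : ℝ} {u v : Feature d} (hN : 0 < N) (ht : 0 ≤ t)
    (huv : ‖u - v‖ ≤ ρ) (S : Fin N → Example d) :
    t * (τ * (N * empFreq (liveMargin τ v) S) - ρ * ∑ i, ‖(S i).1‖) ≤
      logisticNLL linearScore S (t • u) := by
  have hcount : N * empFreq (liveMargin τ v) S =
      ∑ i, (liveMargin τ v).indicator (fun _ => (1 : ℝ)) (S i) := by
    rw [empFreq, ← mul_assoc, mul_one_div_cancel (by positivity), one_mul]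
  rw [hcount, Finset.mul_sum, Finset.mul_sum, ← Finset.sum_sub_distrib, Finset.mul_sum]
  exact Finset.sum_le_sum fun i _ => mul_sub_le_logisticLoss ht huv (S i)

theorem sum_norm_le_of_sum_norm_sq_le {S : Fin N → Example d} {R : ℝ} (hR : 0 ≤ R)
    (hS : ∑ i, ‖(S i).1‖ ^ 2 ≤ N * R ^ 2) : ∑ i, ‖(S i).1‖ ≤ N * R := by
  refine le_of_sq_le_sq ?_ (by positivity)
  calc (∑ i, ‖(S i).1‖) ^ 2 ≤ N * ∑ i, ‖(S i).1‖ ^ 2 := by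
        simpa using sq_sum_le_card_mul_sum_sq (s := Finset.univ) (f := fun i => ‖(S i).1‖)
    _ ≤ N * (N * R ^ 2) := by gcongr
    _ = (N * R) ^ 2 := by ring

/-- If in every direction many live examples lie well on the wrong side, the logistic loss grows
linearly along every ray, faster than its value at the origin allows for the MAP estimate. -/
theorem norm_symMAP_le_of_empFreq_liveMargin (hN : 0 < N) (hσ : 0 < σβ) {S : Fin N → Example d}
    {τ p ρ R : ℝ} (hτ : 0 < τ) (hp : 0 < p) (hρ : 0 ≤ ρ) (hR : 0 ≤ R)
    (hρR : ρ * R ≤ τ * p / 4) (hS : ∑ i, ‖(S i).1‖ ^ 2 ≤ N * R ^ 2)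
    (h : ∀ u : Feature d, ‖u‖ = 1 → ∃ v, ‖u - v‖ ≤ ρ ∧ p / 2 ≤ empFreq (liveMargin τ v) S) :
    ‖symMAP σβ S‖ ≤ 4 / (τ * p) := by
  rcases eq_or_ne (symMAP σβ S) 0 with hm | hm
  · rw [hm, norm_zero]
    positivity
  have hN' : (0 : ℝ) < N := by exact_mod_cast hN
  obtain ⟨v, huv, hfreq⟩ := h (‖symMAP σβ S‖⁻¹ • symMAP σβ S) (norm_smul_inv_norm hm)
  have hgrowth := mul_empFreq_sub_le_logisticNLL (τ := τ) hN (norm_nonneg (symMAP σβ S)) huv S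
  rw [smul_inv_smul₀ (norm_ne_zero_iff.2 hm)] at hgrowth
  have hnll : logisticNLL linearScore S (symMAP σβ S) ≤ N := by
    have hquad : 0 ≤ ‖symMAP σβ S‖ ^ 2 / (2 * σβ ^ 2) := by positivity
    have hlog : N * Real.log 2 ≤ N * 1 := by
      gcongr
      linarith [Real.log_two_lt_d9]
    linarith [logisticNLL_symMAP_add_le hσ S]
  have hslope : N * (τ * p / 4) ≤
      τ * (N * empFreq (liveMargin τ v) S) - ρ * ∑ i, ‖(S i).1‖ := by
    have hmargin : τ * (N * (p / 2)) ≤ τ * (N * empFreq (liveMargin τ v) S) := by gcongr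
    have hnet : ρ * ∑ i, ‖(S i).1‖ ≤ N * (τ * p / 4) := calc
      ρ * ∑ i, ‖(S i).1‖ ≤ ρ * (N * R) := by gcongr; exact sum_norm_le_of_sum_norm_sq_le hR hS
      _ = N * (ρ * R) := by ring
      _ ≤ N * (τ * p / 4) := by gcongr
    linarith
  have hbound : N * (‖symMAP σβ S‖ * (τ * p / 4)) ≤ N * 1 := calc
    N * (‖symMAP σβ S‖ * (τ * p / 4)) = ‖symMAP σβ S‖ * (N * (τ * p / 4)) := by ring
    _ ≤ N * 1 := by
      rw [mul_one]
      exact ((mul_le_mul_of_nonneg_left hslope (norm_nonneg _)).trans hgrowth).trans hnll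
  rw [le_div_iff₀ (by positivity)]
  linarith [le_of_mul_le_mul_left hbound hN']

end MAP

theorem highProb_sum_norm_sq_le {d N : ℕ} (hN : 0 < N) (D : Measure (Example d))
    [IsProbabilityMeasure D] {c δ : ℝ} (hc : 0 < c) (hδ : 0 < δ)
    (h : ∫⁻ x, ENNReal.ofReal (‖x.1‖ ^ 2) ∂D ≤ ENNReal.ofReal c) :
    HighProb (sampleLaw D N) δ fun S => ∑ i, ‖(S i).1‖ ^ 2 ≤ N * (c / δ) := by
  have hmeas : Measurable fun x : Example d => ENNReal.ofReal (‖x.1‖ ^ 2) := by fun_prop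
  have hterm (i : Fin N) : Measurable fun S : Fin N → Example d => ENNReal.ofReal (‖(S i).1‖ ^ 2) :=
    hmeas.comp (measurable_pi_apply i)
  have hmean : ∫⁻ S, ∑ i, ENNReal.ofReal (‖(S i).1‖ ^ 2) ∂(sampleLaw D N) ≤
      ENNReal.ofReal (N * c) := by
    rw [lintegral_finsetSum _ fun i _ => hterm i]
    calc ∑ i, ∫⁻ S, ENNReal.ofReal (‖(S i).1‖ ^ 2) ∂(sampleLaw D N)
        = ∑ _i : Fin N, ∫⁻ x, ENNReal.ofReal (‖x.1‖ ^ 2) ∂D :=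
          Finset.sum_congr rfl fun i _ =>
            (measurePreserving_eval (fun _ : Fin N => D) i).lintegral_comp hmeas
      _ ≤ ∑ _i : Fin N, ENNReal.ofReal c := Finset.sum_le_sum fun _ _ => h
      _ = ENNReal.ofReal (N * c) := by simp [ENNReal.ofReal_mul]
  have hpos : 0 < N * (c / δ) := by positivity
  calc sampleLaw D N {S | ¬ ∑ i, ‖(S i).1‖ ^ 2 ≤ N * (c / δ)}
      ≤ sampleLaw D N
          {S | ENNReal.ofReal (N * (c / δ)) ≤ ∑ i, ENNReal.ofReal (‖(S i).1‖ ^ 2)} :=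
        measure_mono fun S (hS : ¬ _ ≤ _) => by
          rw [Set.mem_ofPred_eq, ← ENNReal.ofReal_sum_of_nonneg fun i _ => sq_nonneg _]
          exact ENNReal.ofReal_le_ofReal (not_le.1 hS).le
    _ ≤ ENNReal.ofReal (N * c) / ENNReal.ofReal (N * (c / δ)) :=
        (meas_ge_le_lintegral_div (Finset.measurable_sum _ fun i _ => hterm i).aemeasurable
          (ENNReal.ofReal_pos.2 hpos).ne' ENNReal.ofReal_ne_top).trans (by gcongr)
    _ = ENNReal.ofReal δ := by
        rw [← ENNReal.ofReal_div_of_pos hpos]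
        congr 1
        field_simp

theorem highProb_forall_le_empFreq {Ω ι : Type} [MeasurableSpace Ω] {N : ℕ} (hN : 0 < N)
    (D : Measure Ω) [IsProbabilityMeasure D] {A : ι → Set Ω} (hA : ∀ i, MeasurableSet (A i))
    {T : Finset ι} {p : ℝ} (hp : 0 ≤ p) (h : ∀ i ∈ T, p ≤ D.real (A i)) :
    HighProb (Measure.pi fun _ : Fin N => D)
      (T.card * (2 * Real.sqrt N * Real.exp (-(N * p ^ 2 / 2))))
      fun S => ∀ i ∈ T, p / 2 ≤ empFreq (A i) S := by
  calc (Measure.pi fun _ : Fin N => D) {S | ¬ ∀ i ∈ T, p / 2 ≤ empFreq (A i) S}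
      ≤ (Measure.pi fun _ : Fin N => D)
          (⋃ i ∈ T, {S | empFreq (A i) S + p / 2 < D.real (A i)}) :=
        measure_mono fun S (hS : ¬ ∀ i ∈ T, _) => by
          push Not at hS
          obtain ⟨i, hi, hlt⟩ := hS
          refine Set.mem_biUnion hi ?_
          rw [Set.mem_ofPred_eq]
          linarith [h i hi]
    _ ≤ ∑ _i ∈ T, ENNReal.ofReal (2 * Real.sqrt N * Real.exp (-(2 * N * (p / 2) ^ 2))) :=
        (measure_biUnion_finset_le _ _).trans <| Finset.sum_le_sum fun i _ =>
          measure_empFreq_deviation_le D (hA i) hN (by positivity)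
    _ = ENNReal.ofReal (T.card * (2 * Real.sqrt N * Real.exp (-(N * p ^ 2 / 2)))) := by
        rw [Finset.sum_const, nsmul_eq_mul, ENNReal.ofReal_mul (Nat.cast_nonneg _),
          ENNReal.ofReal_natCast]
        ring_nf

theorem half_le_log_two_mul_div {N : ℕ} (hN : 1 ≤ N) {δ : ℝ} (hδ : 0 < δ) (hδ1 : δ ≤ 1) :
    1 / 2 ≤ Real.log (2 * N / δ) := by
  have hN' : (1 : ℝ) ≤ N := by exact_mod_cast hN
  have htwo : (2 : ℝ) ≤ 2 * N / δ := by
    rw [le_div_iff₀ hδ]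
    linarith
  linarith [Real.log_le_log two_pos htwo, Real.log_two_gt_d9]

theorem exists_grid_size {d : ℕ} {x a : ℝ} (c : ℝ) (hx : 1 ≤ x) (hdx : d ≤ x) (ha : 0 < a) :
    ∃ k : ℕ, 0 < k ∧ Real.sqrt d / k ≤ 1 / 2 ∧ Real.sqrt d / k * Real.sqrt (c * x) ≤ a ∧
      (2 * k + 1 : ℝ) ≤ (7 + 2 * (Real.sqrt c / a)) * x := by
  have hx0 : 0 < x := by linarith
  have hsqrt : Real.sqrt d ≤ Real.sqrt x := Real.sqrt_le_sqrt hdx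
  have hy : 0 < (2 + Real.sqrt c / a) * x := by positivity
  refine ⟨⌈(2 + Real.sqrt c / a) * x⌉₊, Nat.ceil_pos.2 hy, ?_, ?_, ?_⟩
  · rw [div_le_iff₀ (hy.trans_le (Nat.le_ceil _))]
    have hle : Real.sqrt x ≤ x := Real.sqrt_le_iff.2 ⟨hx0.le, le_self_pow₀ hx two_ne_zero⟩
    have hnonneg : 0 ≤ Real.sqrt c / a * x := by positivity
    linarith [Nat.le_ceil ((2 + Real.sqrt c / a) * x)]
  · rw [div_mul_eq_mul_div, div_le_iff₀ (hy.trans_le (Nat.le_ceil _))]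
    calc Real.sqrt d * Real.sqrt (c * x) ≤ Real.sqrt x * Real.sqrt (c * x) := by gcongr
      _ = a * (Real.sqrt c / a * x) := by
          rw [Real.sqrt_mul' c hx0.le, mul_left_comm, Real.mul_self_sqrt hx0.le]
          field_simp
      _ ≤ a * ((2 + Real.sqrt c / a) * x) := by
          gcongr
          linarith
      _ ≤ a * ⌈(2 + Real.sqrt c / a) * x⌉₊ := by
          gcongr
          exact Nat.le_ceil _
  · linarith [Nat.ceil_lt_add_one hy.le]

section UnionBound

variable {N : ℕ} {δ : ℝ}

theorem pow_le_exp_mul_log {d k : ℕ} {C : ℝ} (hN : 1 ≤ N) (hδ : 0 < δ) (hδ1 : δ ≤ 1) (hC : 0 ≤ C)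
    (hdN : d ≤ N) (hk : (2 * k + 1 : ℝ) ≤ C * (d / δ)) :
    (((2 * k + 1) ^ d : ℕ) : ℝ) ≤ Real.exp (d * ((2 * C + 1) * Real.log (2 * N / δ))) := by
  have hΛ := half_le_log_two_mul_div hN hδ hδ1
  have hCexp : C ≤ Real.exp (2 * C * Real.log (2 * N / δ)) := calc
    C ≤ 2 * C * Real.log (2 * N / δ) := by nlinarith
    _ ≤ Real.exp (2 * C * Real.log (2 * N / δ)) := by
      linarith [Real.add_one_le_exp (2 * C * Real.log (2 * N / δ))]
  have hdexp : d / δ ≤ Real.exp (Real.log (2 * N / δ)) := by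
    rw [Real.exp_log (by positivity)]
    gcongr
    exact_mod_cast hdN.trans (Nat.le_mul_of_pos_left N two_pos)
  rw [Real.exp_nat_mul, Nat.cast_pow]
  gcongr
  push_cast
  calc (2 * k + 1 : ℝ) ≤ C * (d / δ) := hk
    _ ≤ Real.exp (2 * C * Real.log (2 * N / δ)) * Real.exp (Real.log (2 * N / δ)) := by gcongr
    _ = Real.exp ((2 * C + 1) * Real.log (2 * N / δ)) := by
        rw [← Real.exp_add]
        ring_nf

theorem two_mul_sqrt_le_mul_exp (hN : 1 ≤ N) (hδ : 0 < δ) (hδ1 : δ ≤ 1) :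
    2 * Real.sqrt N ≤ δ / 2 * Real.exp (2 * Real.log (2 * N / δ)) := by
  have hN' : (1 : ℝ) ≤ N := by exact_mod_cast hN
  have hexp : Real.exp (2 * Real.log (2 * N / δ)) = (2 * N / δ) ^ 2 := by
    rw [two_mul, Real.exp_add, Real.exp_log (by positivity), sq]
  calc 2 * Real.sqrt N ≤ 2 * N := by
        gcongr
        exact Real.sqrt_le_iff.2 ⟨by positivity, le_self_pow₀ hN' two_ne_zero⟩
    _ ≤ 2 * N * (N / δ) := le_mul_of_one_le_right (by positivity) ((one_le_div hδ).2 (by linarith))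
    _ = δ / 2 * Real.exp (2 * Real.log (2 * N / δ)) := by
        rw [hexp]
        field_simp

theorem net_union_bound_le {d k : ℕ} {p C : ℝ} (hd : 1 ≤ d) (hN : 1 ≤ N) (hδ : 0 < δ)
    (hδ1 : δ ≤ 1) (hp : 0 < p) (hC : 0 ≤ C) (hk : (2 * k + 1 : ℝ) ≤ C * (d / δ))
    (hlarge : (2 * (2 * C + 3) / p ^ 2 + 2) * (d * Real.log (2 * N / δ)) < N) :
    ((2 * k + 1) ^ d : ℕ) * (2 * Real.sqrt N * Real.exp (-(N * p ^ 2 / 2))) ≤ δ / 2 := by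
  have hd' : (1 : ℝ) ≤ d := by exact_mod_cast hd
  have hΛ := half_le_log_two_mul_div hN hδ hδ1
  have hpow := pow_le_exp_mul_log (d := d) (k := k) hN hδ hδ1 hC
  have hsqrt := two_mul_sqrt_le_mul_exp hN hδ hδ1
  set Λ := Real.log (2 * N / δ)
  have hnonneg : 0 ≤ 2 * (2 * C + 3) / p ^ 2 * (d * Λ) := by positivity
  have hdN : d ≤ N := by
    have : (d : ℝ) ≤ N := by nlinarith
    exact_mod_cast this
  have hexponent : d * ((2 * C + 1) * Λ) + 2 * Λ - N * p ^ 2 / 2 ≤ 0 := by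
    have hquot : 2 * (2 * C + 3) / p ^ 2 * (d * Λ) ≤ N := by nlinarith
    rw [div_mul_eq_mul_div, div_le_iff₀ (by positivity)] at hquot
    nlinarith
  calc (((2 * k + 1) ^ d : ℕ) : ℝ) * (2 * Real.sqrt N * Real.exp (-(N * p ^ 2 / 2)))
      ≤ Real.exp (d * ((2 * C + 1) * Λ)) *
          (δ / 2 * Real.exp (2 * Λ) * Real.exp (-(N * p ^ 2 / 2))) := by
        gcongr
        exact hpow hdN hk
    _ = δ / 2 * Real.exp (d * ((2 * C + 1) * Λ) + 2 * Λ - N * p ^ 2 / 2) := by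
        rw [sub_eq_add_neg, Real.exp_add, Real.exp_add]
        ring
    _ ≤ δ / 2 := mul_le_of_le_one_right (by positivity) (Real.exp_le_one_iff.2 hexponent)

end UnionBound

theorem exists_highProb_norm_symMAP_le {c τ p : ℝ} (hc : 0 < c) (hτ : 0 < τ) (hp : 0 < p) :
    ∃ c₀ : ℝ, 0 < c₀ ∧ ∀ {d N : ℕ} (D : Measure (Example d)) [IsProbabilityMeasure D] {σβ δ : ℝ},
      IsSpread D c τ p → 1 ≤ d → 1 ≤ N → 0 < σβ → 0 < δ → δ ≤ 1 →
      c₀ * (d * Real.log (2 * N / δ)) < N →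
      HighProb (sampleLaw D N) (δ / 2) fun S =>
        ∑ i, ‖(S i).1‖ ^ 2 ≤ N * (2 * c * (d / δ)) → ‖symMAP σβ S‖ ≤ 4 / (τ * p) := by
  set C := 7 + 2 * (Real.sqrt (2 * c) / (τ * p / 4))
  refine ⟨2 * (2 * C + 3) / p ^ 2 + 2, by positivity, ?_⟩
  intro d N D _ σβ δ hD hd hN hσ hδ hδ1 hlarge
  have hd' : (1 : ℝ) ≤ d := by exact_mod_cast hd
  have hdδ : (d : ℝ) ≤ d / δ := le_div_self (by positivity) hδ hδ1
  obtain ⟨k, hk, hk_half, hk_small, hk_card⟩ :=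
    exists_grid_size (2 * c) (hd'.trans hdδ) hdδ (by positivity : 0 < τ * p / 4)
  obtain ⟨T, hTcard, hT⟩ := exists_net d hk
  have hfreq : HighProb (sampleLaw D N) _ fun S =>
      ∀ v ∈ T.filter fun v => 1 / 2 ≤ ‖v‖, p / 2 ≤ empFreq (liveMargin τ v) S :=
    highProb_forall_le_empFreq hN D (measurableSet_liveMargin τ) hp.le fun v hv =>
      (ENNReal.ofReal_le_iff_le_toReal (measure_ne_top _ _)).1
        (hD.le_liveMargin v (Finset.mem_filter.1 hv).2)
  have hcard : ((T.filter fun v => 1 / 2 ≤ ‖v‖).card : ℝ) ≤ ((2 * k + 1) ^ d : ℕ) := by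
    exact_mod_cast (Finset.card_filter_le _ _).trans hTcard
  refine (hfreq.mono fun S hS hsum => ?_).trans (ENNReal.ofReal_le_ofReal
    ((mul_le_mul_of_nonneg_right hcard (by positivity)).trans
      (net_union_bound_le hd hN hδ hδ1 hp (by positivity) hk_card hlarge)))
  refine norm_symMAP_le_of_empFreq_liveMargin hN hσ hτ hp (by positivity)
    (Real.sqrt_nonneg _) hk_small ?_ fun u hu => ?_
  · rwa [Real.sq_sqrt (by positivity)]
  · obtain ⟨v, hv, huv⟩ := hT u hu.le
    refine ⟨v, huv, hS v (Finset.mem_filter.2 ⟨hv, ?_⟩)⟩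
    linarith [norm_sub_norm_le u v]

theorem exists_norm_symMAP_sq_le {c τ p σβ : ℝ} (hc : 0 < c) (hτ : 0 < τ) (hp : 0 < p)
    (hσ : 0 < σβ) :
    ∃ A : ℝ, 0 < A ∧ ∀ {d N : ℕ} (D : Measure (Example d)) [IsProbabilityMeasure D] {δ : ℝ},
      IsSpread D c τ p → 1 ≤ d → 1 ≤ N → 0 < δ → δ ≤ 1 →
      HighProb (sampleLaw D N) δ fun S =>
        ‖symMAP σβ S‖ ^ 2 ≤ A * (d * Real.log (2 * N / δ)) ∧
          ∑ i, ‖(S i).1‖ ^ 2 ≤ N * (2 * c * (d / δ)) := by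
  obtain ⟨c₀, hc₀, hMAP⟩ := exists_highProb_norm_symMAP_le hc hτ hp
  refine ⟨c₀ * (2 * σβ ^ 2) + 2 * (4 / (τ * p)) ^ 2, by positivity, ?_⟩
  intro d N D _ δ hD hd hN hδ hδ1
  have hd' : (1 : ℝ) ≤ d := by exact_mod_cast hd
  have hΛ := half_le_log_two_mul_div hN hδ hδ1
  have hdΛ : 1 / 2 ≤ d * Real.log (2 * N / δ) := by nlinarith
  have hmoment : HighProb (sampleLaw D N) (δ / 2) fun S =>
      ∑ i, ‖(S i).1‖ ^ 2 ≤ N * (2 * c * (d / δ)) := by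
    convert highProb_sum_norm_sq_le hN D (by positivity) (half_pos hδ) hD.lintegral_norm_sq_le
      using 4
    field_simp
  set Λ := Real.log (2 * N / δ)
  rcases lt_or_ge (c₀ * (d * Λ)) N with hlarge | hsmall
  · have hboth := hmoment.and (hMAP D hD hd hN hσ hδ hδ1 hlarge) (by positivity) (by positivity)
    rw [add_halves] at hboth
    refine hboth.mono fun S hS => ⟨?_, hS.1⟩
    calc ‖symMAP σβ S‖ ^ 2 ≤ (4 / (τ * p)) ^ 2 * 1 := by
          rw [mul_one]
          exact pow_le_pow_left₀ (norm_nonneg _) (hS.2 hS.1) 2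
      _ ≤ (4 / (τ * p)) ^ 2 * (2 * (d * Λ)) := by
          gcongr
          linarith
      _ ≤ (c₀ * (2 * σβ ^ 2) + 2 * (4 / (τ * p)) ^ 2) * (d * Λ) := by
          have : 0 ≤ c₀ * (2 * σβ ^ 2) * (d * Λ) := by positivity
          linarith
  · refine HighProb.mono (hmoment.trans (ENNReal.ofReal_le_ofReal (half_le_self hδ.le)))
      fun S hS => ⟨?_, hS⟩
    calc ‖symMAP σβ S‖ ^ 2 ≤ N * Real.log 2 * (2 * σβ ^ 2) := norm_symMAP_sq_le hσ S
      _ ≤ c₀ * (d * Λ) * 1 * (2 * σβ ^ 2) := by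
          gcongr
          linarith [Real.log_two_lt_d9]
      _ ≤ (c₀ * (2 * σβ ^ 2) + 2 * (4 / (τ * p)) ^ 2) * (d * Λ) := by
          have : 0 ≤ 2 * (4 / (τ * p)) ^ 2 * (d * Λ) := by positivity
          linarith

theorem log_one_add_mul_le {x y : ℝ} (hx : 0 ≤ x) (hy : 1 ≤ y) :
    Real.log (1 + x * y) ≤ x + Real.log y := by
  have hle : 1 + x * y ≤ (1 + x) * y := by linarith
  calc Real.log (1 + x * y) ≤ Real.log (1 + x) + Real.log y := by
        rw [← Real.log_mul (by positivity) (by positivity)]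
        gcongr
    _ ≤ x + Real.log y := by linarith [Real.log_le_sub_one_of_pos (by positivity : 0 < 1 + x)]

theorem tiltBound_sym_le {d N : ℕ} {σβ c δ : ℝ} (hd : 1 ≤ d) (hN : 1 ≤ N) (hc : 0 ≤ c) (hδ : 0 < δ)
    (hδ1 : δ ≤ 1) {S : Fin N → Example d} (hS : ∑ i, ‖(S i).1‖ ^ 2 ≤ N * (2 * c * (d / δ))) :
    tiltBound 0 (symMAP σβ S) σβ (signedFeature S) ≤
      3 / 2 * ‖symMAP σβ S‖ ^ 2 / σβ ^ 2 +
        d * (1 + (σβ ^ 2 * c / 4 + Real.log (2 * N / δ)) / 2) := by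
  have hN' : (1 : ℝ) ≤ N := by exact_mod_cast hN
  have hlog : Real.log (1 + σβ ^ 2 * (∑ i, ‖(S i).1‖ ^ 2) / (4 * d)) ≤
      σβ ^ 2 * c / 4 + Real.log (2 * N / δ) := by
    refine le_trans ?_ (log_one_add_mul_le (by positivity) ((one_le_div hδ).2 (by linarith)))
    gcongr
    calc σβ ^ 2 * (∑ i, ‖(S i).1‖ ^ 2) / (4 * d)
        ≤ σβ ^ 2 * (N * (2 * c * (d / δ))) / (4 * d) := by gcongr
      _ = σβ ^ 2 * c / 4 * (2 * N / δ) := by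
          field_simp
  have hdlog := mul_le_mul_of_nonneg_left hlog (Nat.cast_nonneg d)
  simp only [tiltBound, gibbsDrop, norm_signedFeature_sq, finrank_euclideanSpace_fin, sub_zero]
  linarith

theorem exists_highProb_tiltBound_sym_le {c τ p σβ : ℝ} (hc : 0 < c) (hτ : 0 < τ) (hp : 0 < p)
    (hσ : 0 < σβ) :
    ∃ C : ℝ, 0 < C ∧ ∀ {d N : ℕ} (D : Measure (Example d)) [IsProbabilityMeasure D] {δ : ℝ},
      IsSpread D c τ p → 1 ≤ d → 1 ≤ N → 0 < δ → δ ≤ 1 →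
      HighProb (sampleLaw D N) δ fun S =>
        tiltBound 0 (symMAP σβ S) σβ (signedFeature S) ≤ C * (d * Real.log (2 * N / δ)) := by
  obtain ⟨A, hA, hMAP⟩ := exists_norm_symMAP_sq_le hc hτ hp hσ
  refine ⟨3 / 2 * A / σβ ^ 2 + (5 / 2 + σβ ^ 2 * c / 4), by positivity, ?_⟩
  intro d N D _ δ hD hd hN hδ hδ1
  have hΛ := half_le_log_two_mul_div hN hδ hδ1
  refine (hMAP D hD hd hN hδ hδ1).mono fun S hS => ?_
  refine (tiltBound_sym_le hd hN hc.le hδ hδ1 hS.2).trans ?_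
  set Λ := Real.log (2 * N / δ)
  calc 3 / 2 * ‖symMAP σβ S‖ ^ 2 / σβ ^ 2 + d * (1 + (σβ ^ 2 * c / 4 + Λ) / 2)
      ≤ 3 / 2 * (A * (d * Λ)) / σβ ^ 2 +
          d * (2 * Λ + (σβ ^ 2 * c / 4 * (2 * Λ) + Λ) / 2) := by
        gcongr
        · exact hS.1
        · linarith
        · exact le_mul_of_one_le_right (by positivity) (by linarith)
    _ = (3 / 2 * A / σβ ^ 2 + (5 / 2 + σβ ^ 2 * c / 4)) * (d * Λ) := by ring

/-! ### Uniform convergence over monotone families of sets -/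

section Bracketing

variable {Ω : Type*} [MeasurableSpace Ω] {A : ℝ → Set Ω} {N : ℕ}

theorem exists_measurableSet_subset_of_le (D : Measure Ω) [IsFiniteMeasure D] (hA : Monotone A)
    (hm : ∀ R, MeasurableSet (A R)) {c : ℝ} (hc : ∃ R, c ≤ D.real (A R)) :
    ∃ B, MeasurableSet B ∧ c ≤ D.real B ∧ ∀ R, c ≤ D.real (A R) → B ⊆ A R := by
  let I : Set ℝ := {R | c ≤ D.real (A R)}
  have hupper : IsUpperSet I := fun _ _ hab ha => le_trans ha (measureReal_mono (hA hab))
  have : I.OrdConnected := hupper.ordConnected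
  have : Nonempty I := nonempty_subtype.2 hc
  obtain ⟨u, hu, hlim⟩ := exists_seq_antitone_tendsto_atTop_atBot I
  have hmeas : ∀ n, MeasurableSet (A (u n)) := fun n => hm _
  refine ⟨⋂ n, A (u n), MeasurableSet.iInter hmeas, ?_, fun R hR => ?_⟩
  · have htend := tendsto_measure_iInter_atTop (μ := D) (fun n => (hmeas n).nullMeasurableSet)
      (fun _ _ hmn => hA (hu hmn)) ⟨0, measure_ne_top _ _⟩
    exact ge_of_tendsto' ((ENNReal.tendsto_toReal (measure_ne_top D _)).comp htend)
      fun n => (u n).2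
  · obtain ⟨n, hn⟩ := (hlim.eventually (eventually_le_atBot (⟨R, hR⟩ : I))).exists
    exact (Set.iInter_subset _ n).trans (hA hn)

theorem exists_lower_brackets (D : Measure Ω) [IsProbabilityMeasure D] (hA : Monotone A)
    (hm : ∀ R, MeasurableSet (A R)) (hN : 0 < N) :
    ∃ B : Fin (N + 1) → Set Ω, (∀ k, MeasurableSet (B k)) ∧
      ∀ R, ∃ k, B k ⊆ A R ∧ D.real (A R) ≤ D.real (B k) + 1 / N := by
  have hN' : (0 : ℝ) < N := by exact_mod_cast hN
  have hbracket (k : Fin (N + 1)) : ∃ B, MeasurableSet B ∧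
      ∀ R, (k : ℝ) / N ≤ D.real (A R) → B ⊆ A R ∧ (k : ℝ) / N ≤ D.real B := by
    by_cases hk : ∃ R, (k : ℝ) / N ≤ D.real (A R)
    · obtain ⟨B, hB, hle, hsub⟩ := exists_measurableSet_subset_of_le D hA hm hk
      exact ⟨B, hB, fun R hR => ⟨hsub R hR, hle⟩⟩
    · exact ⟨∅, MeasurableSet.empty, fun R hR => (hk ⟨R, hR⟩).elim⟩
  choose B hB hsub using hbracket
  refine ⟨B, hB, fun R => ?_⟩
  have hnonneg : 0 ≤ N * D.real (A R) := mul_nonneg hN'.le measureReal_nonneg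
  have hlevel : ⌊N * D.real (A R)⌋₊ < N + 1 :=
    Nat.lt_succ_of_le (Nat.floor_le_of_le (mul_le_of_le_one_right hN'.le measureReal_le_one))
  have hround : (⌊N * D.real (A R)⌋₊ : ℝ) / N ≤ D.real (A R) := by
    rw [div_le_iff₀ hN', mul_comm (D.real _)]
    exact Nat.floor_le hnonneg
  obtain ⟨hsubR, hleB⟩ := hsub ⟨_, hlevel⟩ R hround
  refine ⟨_, hsubR, ?_⟩
  calc D.real (A R) ≤ (⌊N * D.real (A R)⌋₊ : ℝ) / N + 1 / N := by
        rw [← add_div, le_div_iff₀ hN', mul_comm (D.real _)]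
        exact (Nat.lt_floor_add_one _).le
    _ ≤ D.real (B ⟨_, hlevel⟩) + 1 / N := by gcongr

end Bracketing

theorem highProb_forall_le_empFreq_of_monotone {Ω : Type} [MeasurableSpace Ω] (D : Measure Ω)
    [IsProbabilityMeasure D] {A : ℝ → Set Ω} (hA : Monotone A) (hm : ∀ R, MeasurableSet (A R))
    {N : ℕ} (hN : 0 < N) {t : ℝ} (ht : 0 ≤ t) :
    HighProb (Measure.pi fun _ : Fin N => D)
      ((N + 1) * (2 * Real.sqrt N * Real.exp (-(2 * N * t ^ 2))))
      fun S => ∀ R, D.real (A R) ≤ empFreq (A R) S + (t + 1 / N) := by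
  obtain ⟨B, hB, hbracket⟩ := exists_lower_brackets D hA hm hN
  calc (Measure.pi fun _ : Fin N => D) {S | ¬ ∀ R, D.real (A R) ≤ empFreq (A R) S + (t + 1 / N)}
      ≤ (Measure.pi fun _ : Fin N => D) (⋃ k, {S | empFreq (B k) S + t < D.real (B k)}) :=
        measure_mono fun S (hS : ¬ ∀ R, _) => by
          push Not at hS
          obtain ⟨R, hR⟩ := hS
          obtain ⟨k, hsub, hle⟩ := hbracket R
          refine Set.mem_iUnion.2 ⟨k, ?_⟩
          rw [Set.mem_ofPred_eq]
          linarith [empFreq_mono hsub S]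
    _ ≤ ∑ _k : Fin (N + 1), ENNReal.ofReal (2 * Real.sqrt N * Real.exp (-(2 * N * t ^ 2))) :=
        (measure_iUnion_fintype_le _ _).trans <| Finset.sum_le_sum fun k _ =>
          measure_empFreq_deviation_le D (hB k) hN ht
    _ = ENNReal.ofReal ((N + 1) * (2 * Real.sqrt N * Real.exp (-(2 * N * t ^ 2)))) := by
        rw [Finset.sum_const, Finset.card_univ, Fintype.card_fin, nsmul_eq_mul,
          ← Nat.cast_add_one, ENNReal.ofReal_mul (Nat.cast_nonneg _), ENNReal.ofReal_natCast]

/-! ### The radial classifier -/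

/-- The spoof examples that the radial classifier with parameter `R` accepts as live. -/
def missedSpoof (d q : ℕ) (R : ℝ) : Set (Example d) := {x | x.2 = true ∧ ‖x.1‖ ^ q ≤ R}

/-- The live examples that the radial classifier with parameter `-T` rejects; the sign makes the
family increasing in `T`. -/
def rejectedLive (d q : ℕ) (T : ℝ) : Set (Example d) := {x | x.2 = false ∧ -T < ‖x.1‖ ^ q}

theorem measurableSet_missedSpoof (d q : ℕ) (R : ℝ) : MeasurableSet (missedSpoof d q R) :=
  (measurable_snd (measurableSet_singleton true)).inter
    (measurableSet_le (measurable_fst.norm.pow_const q) measurable_const)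

theorem measurableSet_rejectedLive (d q : ℕ) (T : ℝ) : MeasurableSet (rejectedLive d q T) :=
  (measurable_snd (measurableSet_singleton false)).inter
    (measurableSet_lt measurable_const (measurable_fst.norm.pow_const q))

theorem monotone_missedSpoof (d q : ℕ) : Monotone (missedSpoof d q) :=
  fun _ _ h _ hx => ⟨hx.1, hx.2.trans h⟩

theorem monotone_rejectedLive (d q : ℕ) : Monotone (rejectedLive d q) :=
  fun _ _ h _ hx => ⟨hx.1, (neg_le_neg h).trans_lt hx.2⟩

theorem errorSet_radialScore (d q : ℕ) (R : ℝ) :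
    errorSet (radialScore (d := d) q) R = missedSpoof d q R ∪ rejectedLive d q (-R) := by
  ext ⟨z, y⟩
  cases y <;> simp [errorSet, radialScore, missedSpoof, rejectedLive]

theorem disjoint_missedSpoof_rejectedLive (d q : ℕ) (R T : ℝ) :
    Disjoint (missedSpoof d q R) (rejectedLive d q T) :=
  Set.disjoint_left.2 fun _ hspoof hlive => Bool.noConfusion (hspoof.1.symm.trans hlive.1)

section RadialRate

variable {N : ℕ} {δ : ℝ}

theorem inv_le_sqrt_two_mul_log_div (hN : 1 ≤ N) (hδ : 0 < δ) (hδ1 : δ ≤ 1) :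
    1 / N ≤ Real.sqrt (2 * Real.log (2 * N / δ) / N) := by
  have hN' : (1 : ℝ) ≤ N := by exact_mod_cast hN
  refine Real.le_sqrt_of_sq_le ?_
  calc (1 / (N : ℝ)) ^ 2 ≤ 1 / N := by
        rw [sq]
        exact mul_le_of_le_one_left (by positivity) (by rwa [div_le_one₀ (by positivity)])
    _ ≤ 2 * Real.log (2 * N / δ) / N := by
        gcongr
        linarith [half_le_log_two_mul_div hN hδ hδ1]

theorem asymRate_thirtyTwo : asymRate 32 N δ = 4 * Real.sqrt (2 * Real.log (2 * N / δ) / N) := by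
  have hsq : 32 * Real.log (2 * N / δ) / N = 4 ^ 2 * (2 * Real.log (2 * N / δ) / N) := by ring
  rw [asymRate, hsq, Real.sqrt_mul (by positivity), Real.sqrt_sq (by positivity)]

theorem bracket_union_bound_le (hN : 1 ≤ N) (hδ : 0 < δ) (hδ1 : δ ≤ 1) :
    (N + 1) * (2 * Real.sqrt N *
      Real.exp (-(2 * N * Real.sqrt (2 * Real.log (2 * N / δ) / N) ^ 2))) ≤ δ / 2 := by
  have hN' : (1 : ℝ) ≤ N := by exact_mod_cast hN
  have hΛ := half_le_log_two_mul_div hN hδ hδ1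
  have hsqrt := two_mul_sqrt_le_mul_exp hN hδ hδ1
  have hcard : (N + 1 : ℝ) ≤ Real.exp (Real.log (2 * N / δ)) := by
    rw [Real.exp_log (by positivity), le_div_iff₀ hδ]
    nlinarith
  rw [Real.sq_sqrt (by positivity)]
  set Λ := Real.log (2 * N / δ)
  have hexponent : 2 * N * (2 * Λ / N) = 2 * (2 * Λ) := by field_simp
  rw [hexponent]
  calc (N + 1) * (2 * Real.sqrt N * Real.exp (-(2 * (2 * Λ))))
      ≤ Real.exp Λ * (δ / 2 * Real.exp (2 * Λ) * Real.exp (-(2 * (2 * Λ)))) := by gcongr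
    _ = δ / 2 * Real.exp (-Λ) := by
        rw [mul_assoc, mul_left_comm, ← Real.exp_add, ← Real.exp_add]
        ring_nf
    _ ≤ δ / 2 := mul_le_of_le_one_right (by positivity) (Real.exp_le_one_iff.2 (by linarith))

/-- The errors of a radial classifier are the union of two monotone families of sets, so the radial
classifiers generalize uniformly, whatever the dimension. -/
theorem highProb_forall_risk_radialScore_le {d : ℕ} (q : ℕ) (D : Measure (Example d))
    [IsProbabilityMeasure D] (hN : 1 ≤ N) (hδ : 0 < δ) (hδ1 : δ ≤ 1) :
    HighProb (sampleLaw D N) δ fun S => ∀ R,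
      risk D (radialScore q) R ≤ empRisk S (radialScore q) R + asymRate 32 N δ := by
  have hfail := ENNReal.ofReal_le_ofReal (bracket_union_bound_le hN hδ hδ1)
  have hinv := inv_le_sqrt_two_mul_log_div hN hδ hδ1
  have hspoof := (highProb_forall_le_empFreq_of_monotone D (monotone_missedSpoof d q)
    (measurableSet_missedSpoof d q) hN (Real.sqrt_nonneg _)).trans hfail
  have hlive := (highProb_forall_le_empFreq_of_monotone D (monotone_rejectedLive d q)
    (measurableSet_rejectedLive d q) hN (Real.sqrt_nonneg _)).trans hfail
  have hboth := HighProb.and hspoof hlive (by positivity) (by positivity)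
  rw [add_halves] at hboth
  refine hboth.mono fun S hS R => ?_
  rw [risk, empRisk_eq_empFreq, errorSet_radialScore,
    empFreq_union (disjoint_missedSpoof_rejectedLive d q R (-R)), asymRate_thirtyTwo]
  linarith [measureReal_union_le (μ := D) (missedSpoof d q R) (rejectedLive d q (-R)),
    hS.1 R, hS.2 (-R)]

end RadialRate

/-! ### Generalization of the two classifiers -/

theorem measurable_uncurry_linearScore (d : ℕ) :
    Measurable (Function.uncurry (linearScore (d := d))) := by
  unfold linearScore Function.uncurry
  fun_prop

theorem measurable_uncurry_radialScore (d q : ℕ) :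
    Measurable (Function.uncurry (radialScore (d := d) q)) := by
  unfold radialScore Function.uncurry
  fun_prop

theorem RiskBound.mono {d N : ℕ} {Θ : Type} [MeasurableSpace Θ] {D : Measure (Example d)}
    {S : Fin N → Example d} {f : Θ → Feature d → ℝ} {post : Measure Θ} {δ r r' : ℝ}
    (h : RiskBound D S f post δ r) (hr : r ≤ r') : RiskBound D S f post δ r' :=
  ⟨h.1.trans (by gcongr), HighProb.mono h.2 fun _ hθ => hθ.trans (by gcongr)⟩

section Rate

variable {N : ℕ} {δ : ℝ}

theorem asymRate_mono (hN : 1 ≤ N) (hδ : 0 < δ) (hδ1 : δ ≤ 1) {C C' : ℝ} (h : C ≤ C') :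
    asymRate C N δ ≤ asymRate C' N δ := by
  have := half_le_log_two_mul_div hN hδ hδ1
  unfold asymRate
  gcongr

theorem half_le_log_two_mul (hN : 1 ≤ N) : 1 / 2 ≤ Real.log (2 * N) := by
  simpa only [div_one] using half_le_log_two_mul_div hN one_pos le_rfl

theorem log_two_mul_div_half_le (hN : 1 ≤ N) (hδ : 0 < δ) (hδ1 : δ ≤ 1) :
    Real.log (2 * N / (δ / 2)) ≤ 2 * Real.log (2 * N / δ) := by
  have hN' : (1 : ℝ) ≤ N := by exact_mod_cast hN
  have htwo : 2 ≤ 2 * N / δ := by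
    rw [le_div_iff₀ hδ]
    linarith
  have hhalf : 2 * N / (δ / 2) = 2 * (2 * N / δ) := by ring
  rw [hhalf, Real.log_mul two_ne_zero (by positivity), two_mul (Real.log _)]
  gcongr

theorem one_add_le_mul_exp (hN : 1 ≤ N) (hδ : 0 < δ) (hδ1 : δ ≤ 1) :
    1 + 2 * Real.sqrt N / (δ / 2) ≤ δ * Real.exp (3 * Real.log (2 * N / δ)) := by
  have hN' : (1 : ℝ) ≤ N := by exact_mod_cast hN
  have hexp : Real.exp (Real.log (2 * N / δ)) = 2 * N / δ := Real.exp_log (by positivity)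
  have hsqrt : 2 * Real.sqrt N / (δ / 2) ≤ Real.exp (2 * Real.log (2 * N / δ)) := by
    rw [div_le_iff₀' (by positivity)]
    exact two_mul_sqrt_le_mul_exp hN hδ hδ1
  have hone : 1 ≤ Real.exp (2 * Real.log (2 * N / δ)) :=
    Real.one_le_exp (by linarith [half_le_log_two_mul_div hN hδ hδ1])
  calc 1 + 2 * Real.sqrt N / (δ / 2) ≤ 2 * Real.exp (2 * Real.log (2 * N / δ)) := by linarith
    _ ≤ 2 * N * Real.exp (2 * Real.log (2 * N / δ)) := by gcongr; linarith
    _ = δ * (Real.exp (Real.log (2 * N / δ)) * Real.exp (2 * Real.log (2 * N / δ))) := by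
        rw [hexp]
        field_simp
    _ = δ * Real.exp (3 * Real.log (2 * N / δ)) := by
        rw [← Real.exp_add]
        ring_nf

theorem exp_mul_one_add_le {A κ : ℝ} (hA : 0 ≤ A) (hN : 1 ≤ N) (hδ : 0 < δ) (hδ1 : δ ≤ 1)
    (hκ : κ ≤ A * Real.log (2 * N / (δ / 2))) :
    Real.exp κ * (1 + 2 * Real.sqrt N / (δ / 2)) ≤
      δ * Real.exp (N * asymRate (2 * A + 3) N δ ^ 2) := by
  have hlog := half_le_log_two_mul_div hN hδ hδ1
  rw [asymRate, Real.sq_sqrt (by positivity), mul_div_cancel₀ _ (by positivity)]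
  calc Real.exp κ * (1 + 2 * Real.sqrt N / (δ / 2))
      ≤ Real.exp (A * (2 * Real.log (2 * N / δ))) *
          (δ * Real.exp (3 * Real.log (2 * N / δ))) := by
        gcongr
        · exact hκ.trans (mul_le_mul_of_nonneg_left (log_two_mul_div_half_le hN hδ hδ1) hA)
        · exact one_add_le_mul_exp hN hδ hδ1
    _ = δ * Real.exp ((2 * A + 3) * Real.log (2 * N / δ)) := by
        rw [mul_left_comm, ← Real.exp_add]
        ring_nf

theorem exists_asymRate_lt_symRate {C C' η : ℝ} (hC : 0 < C) (hC' : 0 < C') (hη : 0 < η) :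
    ∃ n₀ : ℕ, ∀ (d K N : ℕ) (δ : ℝ), n₀ ≤ d + K → 1 ≤ N → 0 < δ → δ < 1 →
      asymRate C' N δ < η * symRate C d K N δ := by
  obtain ⟨n₀, hn₀⟩ := exists_nat_gt (C' / (η ^ 2 * C))
  refine ⟨n₀, fun d K N δ hdK hN hδ hδ1 => ?_⟩
  have hlog := half_le_log_two_mul_div hN hδ hδ1.le
  have hlt : C' < η ^ 2 * (C * (d + K)) := by
    rw [← mul_assoc, ← div_lt_iff₀' (by positivity)]
    exact hn₀.trans_le (by exact_mod_cast hdK)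
  calc asymRate C' N δ
      < Real.sqrt (η ^ 2 * (C * (d + K)) * Real.log (2 * N / δ) / N) :=
        Real.sqrt_lt_sqrt (by positivity) (by gcongr)
    _ = η * symRate C d K N δ := by
        rw [mul_assoc (η ^ 2), mul_div_assoc (η ^ 2), Real.sqrt_mul (by positivity),
          Real.sqrt_sq hη.le, symRate]

end Rate

theorem highProb_riskBound {d N : ℕ} {Θ : Type} [MeasurableSpace Θ] (D : Measure (Example d))
    [IsProbabilityMeasure D] {f : Θ → Feature d → ℝ} (hf : Measurable (Function.uncurry f))
    (prior : Measure Θ) [IsProbabilityMeasure prior] {post : (Fin N → Example d) → Measure Θ}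
    {κ : (Fin N → Example d) → ℝ} (hpost : ∀ S, PosteriorControl prior (post S) (κ S)) {A δ : ℝ}
    (hA : 0 ≤ A) (hN : 1 ≤ N) (hδ : 0 < δ) (hδ1 : δ ≤ 1)
    (hκ : HighProb (sampleLaw D N) (δ / 2) fun S => κ S ≤ A * Real.log (2 * N / (δ / 2))) :
    HighProb (sampleLaw D N) δ fun S =>
      RiskBound D S f (post S) δ (asymRate (2 * A + 3) N δ) := by
  have hgap := highProb_gapMoment_lt D hf prior hN (half_pos hδ)
  have hboth := hκ.and hgap (half_pos hδ).le (half_pos hδ).le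
  rw [add_halves] at hboth
  exact hboth.mono fun S hS => riskBound_of_gapMoment_lt D hf S (hpost S) hN hδ1 (by positivity)
    (Real.sqrt_nonneg _) hS.2 (exp_mul_one_add_le hA hN hδ hδ1 hS.1)

theorem tiltBound_asym_le {d N : ℕ} (hN : 1 ≤ N) (μR m σR : ℝ)
    (S : Fin N → Example d) :
    tiltBound μR m σR (fun i => -signedLabel (S i).2) ≤
      (3 / 2 / σR ^ 2 + 3 + σR ^ 2) * (Real.log (2 * N) + (m - μR) ^ 2) := by
  have hN' : (1 : ℝ) ≤ N := by exact_mod_cast hN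
  have hhalf := half_le_log_two_mul hN
  have hsum : ∑ i, ‖-signedLabel (S i).2‖ ^ 2 = N := by simp [signedLabel_sq]
  have hlog : Real.log (1 + σR ^ 2 * N / 4) ≤ σR ^ 2 / 8 + Real.log (2 * N) := by
    have hsplit : σR ^ 2 * N / 4 = σR ^ 2 / 8 * (2 * N) := by ring
    rw [hsplit]
    exact log_one_add_mul_le (by positivity) (by linarith)
  have hσ_log : σR ^ 2 * (1 / 2) ≤ σR ^ 2 * Real.log (2 * N) := by gcongr
  have hcoeff : 0 ≤ 3 / 2 / σR ^ 2 := by positivity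
  rw [tiltBound, gibbsDrop, hsum, Module.finrank_self, Nat.cast_one, mul_one, Real.norm_eq_abs,
    sq_abs]
  calc 3 / 2 * (m - μR) ^ 2 / σR ^ 2 + (1 / 2 + 1 / 2 * Real.log (1 + σR ^ 2 * N / 4)) + 1 / 2
      ≤ 3 / 2 / σR ^ 2 * (m - μR) ^ 2 + (3 + σR ^ 2) * Real.log (2 * N) := by
        rw [mul_div_right_comm]
        linarith [sq_nonneg σR]
    _ ≤ (3 / 2 / σR ^ 2 + 3 + σR ^ 2) * (m - μR) ^ 2 +
          (3 / 2 / σR ^ 2 + 3 + σR ^ 2) * Real.log (2 * N) := by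
        gcongr ?_ * _ + ?_ * _
        all_goals linarith [sq_nonneg σR]
    _ = (3 / 2 / σR ^ 2 + 3 + σR ^ 2) * (Real.log (2 * N) + (m - μR) ^ 2) := by ring

end AsyIRM

theorem mainTheorem1_general :
    (∀ c τ p σβ : ℝ, 0 < c → 0 < τ → 0 < p → 0 < σβ →
      ∃ C : ℝ, 0 < C ∧
        ∀ (d N : ℕ) (D : Measure (Example d)) [IsProbabilityMeasure D] (δ : ℝ),
          IsSpread D c τ p → 1 ≤ d → 1 ≤ N → 0 < δ → δ < 1 →
          ∀ post ∈ ({bayesPosterior (symPrior d σβ) linearScore, symLaplace σβ} :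
              Set ((Fin N → Example d) → Measure (Feature d))),
            HighProb (sampleLaw D N) δ (fun S =>
              klDiv (post S) (symPrior d σβ) ≤
                ENNReal.ofReal (C * d * Real.log (2 * N / δ))) ∧
            HighProb (sampleLaw D N) δ (fun S =>
              PACBayesBound D S linearScore (post S) (symPrior d σβ) δ) ∧
            HighProb (sampleLaw D N) δ (fun S =>
              RiskBound D S linearScore (post S) δ (asymRate (C * d) N δ))) ∧
    (∀ σR : ℝ, 0 < σR →
      ∃ C : ℝ, 0 < C ∧
        ∀ (d N : ℕ) (D : Measure (Example d)) [IsProbabilityMeasure D] (μR δ : ℝ) (q : ℕ),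
          1 ≤ N → 0 < δ → δ < 1 →
          ∀ post ∈ ({bayesPosterior (asymPrior μR σR) (radialScore q), asymLaplace q μR σR} :
              Set ((Fin N → Example d) → Measure ℝ)),
            (∀ S : Fin N → Example d, klDiv (post S) (asymPrior μR σR) ≤
              ENNReal.ofReal (C * (Real.log (2 * N) + (asymMAP q μR σR S - μR) ^ 2))) ∧
            HighProb (sampleLaw D N) δ (fun S =>
              PACBayesBound D S (radialScore q) (post S) (asymPrior μR σR) δ) ∧
            HighProb (sampleLaw D N) δ (fun S =>
              RiskBound D S (radialScore q) (post S) δ (asymRate C N δ))) := by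
  refine ⟨fun c τ p σβ hc hτ hp hσ => ?_, fun σR hσ => ?_⟩
  · obtain ⟨C, hC, htilt⟩ := exists_highProb_tiltBound_sym_le hc hτ hp hσ
    refine ⟨2 * C + 3, by positivity, fun d N D _ δ hD hd hN hδ hδ1 post hpost => ?_⟩
    have hd' : (1 : ℝ) ≤ d := by exact_mod_cast hd
    have hlog := half_le_log_two_mul_div hN hδ hδ1.le
    have := (isIsotropicGaussian_symPrior d hσ).isProbabilityMeasure
    have hf := measurable_uncurry_linearScore d
    have hctrl := posteriorControl_sym hσ hpost
    refine ⟨(htilt D hD hd hN hδ hδ1.le).mono fun S hS => (hctrl S).klDiv_le.trans ?_,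
      highProb_pacBayesBound D hf _ hctrl hN hδ hδ1,
      (highProb_riskBound D hf _ hctrl (A := C * d) (by positivity) hN hδ hδ1.le ?_).mono
        fun S hS => hS.mono (asymRate_mono hN hδ hδ1.le ?_)⟩
    · refine ENNReal.ofReal_le_ofReal (hS.trans ?_)
      rw [← mul_assoc]
      gcongr
      linarith
    · simpa only [mul_assoc] using htilt D hD hd hN (half_pos hδ) (by linarith)
    · linarith
  · have hnonneg : 0 ≤ 3 / 2 / σR ^ 2 + 3 + σR ^ 2 := by positivity
    refine ⟨3 / 2 / σR ^ 2 + 3 + σR ^ 2 + 32, by positivity,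
      fun d N D _ μR δ q hN hδ hδ1 post hpost => ?_⟩
    have := (isIsotropicGaussian_asymPrior μR hσ).isProbabilityMeasure
    have hf := measurable_uncurry_radialScore d q
    have hctrl := posteriorControl_asym q μR hσ hpost
    refine ⟨fun S => (hctrl S).klDiv_le.trans (ENNReal.ofReal_le_ofReal
        ((tiltBound_asym_le hN μR _ σR S).trans ?_)),
      highProb_pacBayesBound D hf _ hctrl hN hδ hδ1,
      (highProb_forall_risk_radialScore_le q D hN hδ hδ1.le).mono fun S hS => ?_⟩
    · have hlog := half_le_log_two_mul hN
      gcongr ?_ * _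
      linarith
    · have := (hctrl S).isProbabilityMeasure
      exact (riskBound_of_forall_le D hf S hS).mono
        (asymRate_mono hN hδ hδ1.le (by linarith))

theorem mainTheorem1 :
    -- symmetric IRM: hyperplane classifier
    (∀ p₀ σ₀ ε σβ M : ℝ, 0 < p₀ → p₀ < 1 → 0 < σ₀ → 0 < ε → 0 < σβ → 0 < M →
      ∃ C : ℝ, 0 < C ∧
        ∀ (d K N : ℕ) (w : Fin K → ℝ) (μ : Fin K → Feature d) (δ : ℝ),
          1 ≤ d → 1 ≤ N → (∀ k, 0 ≤ w k) → ∑ k, w k = 1 → (∀ k, ‖μ k‖ ≤ M * Real.sqrt d) →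
          0 < δ → δ < 1 →
          ∀ post ∈ ({bayesPosterior (symPrior d σβ) linearScore, symLaplace σβ} :
              Set ((Fin N → Example d) → Measure (Feature d))),
            HighProb (sampleLaw (dataLaw p₀ σ₀ ε w μ) N) δ (fun S =>
              klDiv (post S) (symPrior d σβ) ≤
                ENNReal.ofReal (C * ((d : ℝ) + K) * Real.log (2 * N / δ))) ∧
            HighProb (sampleLaw (dataLaw p₀ σ₀ ε w μ) N) δ (fun S =>
              PACBayesBound (dataLaw p₀ σ₀ ε w μ) S linearScore (post S) (symPrior d σβ) δ) ∧
            HighProb (sampleLaw (dataLaw p₀ σ₀ ε w μ) N) δ (fun S =>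
              RiskBound (dataLaw p₀ σ₀ ε w μ) S linearScore (post S) δ (symRate C d K N δ))) ∧
    -- AsyIRM: radial classifier
    (∀ σR : ℝ, 0 < σR →
      ∃ C : ℝ, 0 < C ∧
        ∀ (d K N : ℕ) (p₀ σ₀ ε μR : ℝ) (w : Fin K → ℝ) (μ : Fin K → Feature d) (δ : ℝ) (q : ℕ),
          1 ≤ d → 1 ≤ N → 0 < p₀ → p₀ < 1 → 0 < σ₀ → 0 < ε → (∀ k, 0 ≤ w k) → ∑ k, w k = 1 →
          0 < δ → δ < 1 → (q = 1 ∨ q = 2) →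
          ∀ post ∈ ({bayesPosterior (asymPrior μR σR) (radialScore q), asymLaplace q μR σR} :
              Set ((Fin N → Example d) → Measure ℝ)),
            (∀ S : Fin N → Example d, klDiv (post S) (asymPrior μR σR) ≤
              ENNReal.ofReal (C * (Real.log (2 * N) + (asymMAP q μR σR S - μR) ^ 2))) ∧
            HighProb (sampleLaw (dataLaw p₀ σ₀ ε w μ) N) δ (fun S =>
              PACBayesBound (dataLaw p₀ σ₀ ε w μ) S (radialScore q) (post S)
                (asymPrior μR σR) δ) ∧
            HighProb (sampleLaw (dataLaw p₀ σ₀ ε w μ) N) δ (fun S =>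
              RiskBound (dataLaw p₀ σ₀ ε w μ) S (radialScore q) (post S) δ (asymRate C N δ))) ∧
    -- strictly better scaling of the second bound, whatever the constants
    (∀ C C' η : ℝ, 0 < C → 0 < C' → 0 < η → ∃ n₀ : ℕ, ∀ (d K N : ℕ) (δ : ℝ),
      n₀ ≤ d + K → 1 ≤ N → 0 < δ → δ < 1 → asymRate C' N δ < η * symRate C d K N δ) := by
  refine ⟨fun p₀ σ₀ ε σβ M hp0 hp1 hσ₀ hε hσβ hM => ?_, fun σR hσR => ?_,
    fun C C' η hC hC' hη => exists_asymRate_lt_symRate hC hC' hη⟩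
  · obtain ⟨C, hC, hsym⟩ := mainTheorem1_general.1 (2 * (σ₀ ^ 2 + ε + M ^ 2)) (σ₀ / 2)
      (p₀ * (gaussianReal 0 1).real (Set.Ioi 1)) σβ (by positivity) (by positivity)
      (mul_pos hp0 gaussianReal_Ioi_one_pos) hσβ
    refine ⟨C, hC, fun d K N w μ δ hd hN hw hw1 hμ hδ hδ1 post hpost => ?_⟩
    have := isProbabilityMeasure_dataLaw σ₀ ε μ hp0.le hp1.le hw hw1
    have hspread := isSpread_dataLaw hp0.le hp1.le hσ₀ hε.le hw hw1 hμ
    have hCd : C * d ≤ C * (d + K) := by gcongr; simp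
    have hlog := half_le_log_two_mul_div hN hδ hδ1.le
    obtain ⟨hkl, hpac, hrisk⟩ := hsym d N _ δ hspread hd hN hδ hδ1 post hpost
    exact ⟨hkl.mono fun S hS => hS.trans (by gcongr), hpac,
      hrisk.mono fun S hS => hS.mono (asymRate_mono hN hδ hδ1.le hCd)⟩
  · obtain ⟨C, hC, hasym⟩ := mainTheorem1_general.2 σR hσR
    refine ⟨C, hC, fun d K N p₀ σ₀ ε μR w μ δ q _ hN hp0 hp1 _ _ hw hw1 hδ hδ1 _ => ?_⟩
    have := isProbabilityMeasure_dataLaw σ₀ ε μ hp0.le hp1.le hw hw1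
    exact hasym d N _ μR δ q hN hδ hδ1
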